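/- **Proposition (cycle Voros coefficient).** Let $m,\beta\in\mathbb C^*$, fix a square root $\beta^{1/2}$ and put $\mathscr Q=\beta^{1/2}-\beta^{-1/2}$. Let $\mu\in\mathbb C$, let $\nu_+,\nu_-\in\mathbb C$ with $\nu_++\nu_-=1$, and put $\nu=\nu_+-\nu_-$. *Curves.* Let $\overline\Sigma\cong\mathbf P^1$ be the compact Riemann surface of the Weber curve $y^2=\frac{x^2}{4}-m$ or of the Whittaker curve $y^2=\frac{x+4m}{4x}$. Let $\sigma$ be the involution exchanging the two sheets, $\mathcal R$ the set of the two ramification points of $x$, and $\infty_\pm$ the two points over $x=\infty$, labelled by $\operatorname{Res}_{\infty_\pm}y\,dx=\pm m$. Let $\gamma$ be the generator of $H_1(\overline\Sigma\setminus\{\infty_+,\infty_-\},\mathbb Z)\cong\mathbb Z$ with $\oint_\gamma y\,dx=2\pi i m$, represented by loops avoiding $\mathcal R$. (In a suitable coordinate $z$ on $\mathbf P^1$ one has $\sigma(z)=1/z$, $\infty_+=\infty$, $\infty_-=0$, $\mathcal R=\{1,-1\}$, and $\gamma$ is represented by any circle $|z|=R$, $0<R\neq1$, run through clockwise.) *Refined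 topological recursion.* Let $B=\frac{dz_1dz_2}{(z_1-z_2)^2}$, $\eta_p(p_0)=\int_{\sigma(p)}^{p}B(p_0,\cdot)$, $$\omega_{0,1}=y\,dx,\qquad \omega_{0,2}(p_0,p_1)=-B(\sigma(p_0),p_1),\qquad \omega_{\frac12,1}=\tfrac{\mathscr Q}{2}\Bigl(-\tfrac{dy}{y}+\mu\,\eta_{\infty_+}\Bigr).$$ For $g\in\frac12\mathbb Z_{\ge0}$, $n\ge0$ with $2g-2+n\ge0$ and $J=(p_1,\dots,p_n)$ define recursively $$\omega_{g,n+1}(p_0,J)=-\sum_{r\in\mathcal R\cup\{\sigma(p_0),\dots,\sigma(p_n)\}\cup\{\infty_+\}}\operatorname*{Res}_{p=r}\frac{\eta_p(p_0)}{2\omega_{0,1}(p)}\,\mathrm{Rec}_{g,n+1}(p,J),$$ $$\mathrm{Rec}_{g,n+1}(p,J)=\sum_{i=1}^n\frac{dx(p)\,dx(p_i)}{(x(p)-x(p_i))^2}\,\omega_{g,n}(p,J\setminus p_i)+\sum^{*}_{\substack{g_1+g_2=g\\J_1\sqcup J_2=J}}\omega_{g_1,|J_1|+1}(p,J_1)\,\omega_{g_2,|J_2|+1}(p,J_2)+\omega_{g-1,n+2}(p,p,J)+\mathscr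 Q\,dx(p)\,d_p\Bigl(\frac{\omega_{g-\frac12,n+1}(p,J)}{dx(p)}\Bigr),$$ where $*$ means that terms containing $\omega_{0,1}$ are omitted, and terms of negative genus are zero. *Cycle Voros coefficient.* Write $\int_{D(z)}\omega=\nu_+\int_{\infty_+}^z\omega+\nu_-\int_{\infty_-}^z\omega$. Let $T\,dz$ be the logarithmic derivative of the wave function $$\psi=\exp\Bigl(\sum_{g\in\frac12\mathbb Z_{\ge0},\,n\ge1}\frac{\hbar^{2g-2+n}}{\beta^{n/2}\,n!}\int_{D(z)}\!\!\cdots\int_{D(z)}\omega_{g,n}\Bigr),$$ that is, since the $\omega_{g,n}$ are symmetric, the formal series of meromorphic one-forms $$T\,dz=\sum_{g\in\frac12\mathbb Z_{\ge0},\,n\ge0}\frac{\hbar^{2g-1+n}}{\beta^{(n+1)/2}\,n!}\int_{D(z)}\!\!\cdots\int_{D(z)}\omega_{g,n+1}(z,\cdot,\dots,\cdot)\qquad(n\text{ integrations}).$$ Put $T_{\rm odd}\,dz=\frac12\bigl(T\,dz-\sigma^*(T\,dz)\bigr)$ and let $V_\gamma(\hbar)=\oint_\gamma T_{\rm odd}\,dz$,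 integrated term by term in $\hbar$. *Quantum central charge.* Let $\widehat Z(\gamma)=Z(\gamma)+\hbar\,\mathfrak z(\gamma)$ with $Z(\gamma)=\oint_\gamma\omega_{0,1}$ and $\mathfrak z(\gamma)=\oint_\gamma\omega^{\rm odd}_{\frac12,1}$, where $\omega^{\rm odd}_{\frac12,1}=\frac{\mathscr Q}{2}\mu\,\eta_{\infty_+}$, and let $\nu(\gamma)=\nu$. Then, for the Weber curve and for the Whittaker curve, $V_\gamma$ is a two-term series: as formal Laurent series in $\hbar$, $$V_\gamma(\hbar)=\frac{\widehat Z(\gamma)}{\hbar\,\beta^{1/2}}-\frac{\pi i\,\nu(\gamma)}{\beta}.$$ -/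

import Mathlib

/-!
Refined topological recursion on the genus zero curves `Weber` and `Whittaker`, the logarithmic
derivative of its wave function, and the Voros coefficient of the cycle `γ`.

The compact curve is the Riemann sphere with coordinate `z`. A multidifferential is represented by
its coefficient function with respect to the coordinates `z`. For both curves the parametrisation
is normalised so that
* the involution exchanging the two sheets is `σ z = 1 / z`,
* the ramification points of `x` are `z = 1` and `z = -1`,
* the poles of `y dx` are `∞₊` at `z = ∞` and `∞₋` at `z = 0`.
-/

open Complex MeasureTheory Filter Topology

noncomputable section

namespace RefinedTR

/-! ### The curves -/

/-- The two coordinate functions of a parametrised curve `z ↦ (x z, y z)`. -/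
structure SpectralCurve where
  x : ℂ → ℂ
  y : ℂ → ℂ

/-- The Weber curve `y ^ 2 = x ^ 2 / 4 - m`, where `s ^ 2 = m`. -/
def weber (s : ℂ) : SpectralCurve where
  x z := s * (z + z⁻¹)
  y z := s / 2 * (z - z⁻¹)

/-- The Whittaker curve `y ^ 2 = (x + 4 m) / (4 x)`. -/
def whittaker (m : ℂ) : SpectralCurve where
  x z := m * (z - 2 + z⁻¹)
  y z := -(z + 1) / (2 * (z - 1))

/-- The covering involution. -/
def σ (z : ℂ) : ℂ := z⁻¹

/-- The ramification points of `x`. -/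
def ramification : Finset ℂ := {1, -1}

/-- `weber s` parametrises the whole affine Weber curve, once. -/
theorem weber_bijOn {m s : ℂ} (hm : m ≠ 0) (hs : s ^ 2 = m) :
    Set.BijOn (fun z => ((weber s).x z, (weber s).y z)) {z | z ≠ 0}
      {P | P.2 ^ 2 = P.1 ^ 2 / 4 - m} := by
  have hs0 : s ≠ 0 := by
    rintro rfl
    exact hm (by simpa using hs.symm)
  subst hs
  refine ⟨?_, ?_, ?_⟩
  · intro z hz
    have hz : z ≠ 0 := hz
    simp only [weber, Set.mem_ofPred_eq]
    field_simp
    ring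
  · intro z _ w _ h
    simp only [weber, Prod.mk.injEq] at h
    obtain ⟨h1, h2⟩ := h
    have : 2 * s * z = 2 * s * w := by linear_combination h1 + 2 * h2
    exact mul_left_cancel₀ (mul_ne_zero two_ne_zero hs0) this
  · rintro ⟨X, Y⟩ h
    simp only [Set.mem_ofPred_eq] at h
    have hp : (X / 2 + Y) * (X / 2 - Y) = s ^ 2 := by linear_combination -h
    have h1 : X / 2 + Y ≠ 0 := by
      intro h0
      rw [h0, zero_mul] at hp
      exact pow_ne_zero 2 hs0 hp.symm
    have hinv : ((X / 2 + Y) / s)⁻¹ = (X / 2 - Y) / s := by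
      rw [inv_div, div_eq_div_iff h1 hs0]
      linear_combination -hp
    refine ⟨(X / 2 + Y) / s, div_ne_zero h1 hs0, ?_⟩
    simp only [weber, hinv, Prod.mk.injEq]
    constructor <;> field_simp <;> ring

/-- `whittaker m` parametrises the whole affine Whittaker curve, once; the remaining point
`z = 1` is the one over the simple pole `x = 0`. -/
theorem whittaker_bijOn {m : ℂ} (hm : m ≠ 0) :
    Set.BijOn (fun z => ((whittaker m).x z, (whittaker m).y z)) {z | z ≠ 0 ∧ z ≠ 1}
      {P | P.1 ≠ 0 ∧ P.2 ^ 2 = (P.1 + 4 * m) / (4 * P.1)} := by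
  have key : ∀ z : ℂ, z ≠ 0 → m * (z - 2 + z⁻¹) = m * (z - 1) ^ 2 / z := by
    intro z hz
    field_simp
    ring
  refine ⟨?_, ?_, ?_⟩
  · rintro z ⟨hz, hz1⟩
    have h1 : z - 1 ≠ 0 := sub_ne_zero.2 hz1
    simp only [whittaker, Set.mem_ofPred_eq, key z hz]
    refine ⟨by positivity, ?_⟩
    field_simp
    ring
  · rintro z ⟨_, hz1⟩ w ⟨_, hw1⟩ h
    simp only [whittaker, Prod.mk.injEq] at h
    have h1 : z - 1 ≠ 0 := sub_ne_zero.2 hz1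
    have h2 : w - 1 ≠ 0 := sub_ne_zero.2 hw1
    have h3 := h.2
    rw [div_eq_div_iff (mul_ne_zero two_ne_zero h1) (mul_ne_zero two_ne_zero h2)] at h3
    linear_combination (1 / 4) * h3
  · rintro ⟨X, Y⟩ ⟨hX, h⟩
    simp only at hX h
    rw [eq_div_iff (mul_ne_zero (by norm_num) hX)] at h
    have hp : X * ((2 * Y + 1) * (2 * Y - 1)) = 4 * m := by linear_combination h
    have hp1 : 2 * Y + 1 ≠ 0 := by
      intro h0
      rw [h0] at hp
      exact hm (by linear_combination -(1 / 4) * hp)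
    have hp2 : 2 * Y - 1 ≠ 0 := by
      intro h0
      rw [h0] at hp
      exact hm (by linear_combination -(1 / 4) * hp)
    have hz : (2 * Y - 1) / (2 * Y + 1) ≠ 0 := div_ne_zero hp2 hp1
    have hz1 : (2 * Y - 1) / (2 * Y + 1) - 1 = -2 / (2 * Y + 1) := by
      field_simp
      ring
    refine ⟨(2 * Y - 1) / (2 * Y + 1), ⟨hz, ?_⟩, ?_⟩
    · rw [← sub_ne_zero, hz1]
      exact div_ne_zero (by norm_num) hp1
    · simp only [whittaker, key _ hz, hz1, Prod.mk.injEq]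
      constructor
      · field_simp
        linear_combination -hp
      · field_simp
        ring

/-- `σ` exchanges the two sheets of the Weber curve. -/
theorem weber_σ (s z : ℂ) :
    (weber s).x (σ z) = (weber s).x z ∧ (weber s).y (σ z) = -(weber s).y z := by
  constructor <;> simp only [weber, σ, inv_inv] <;> ring

/-- `σ` exchanges the two sheets of the Whittaker curve. -/
theorem whittaker_σ (m z : ℂ) (hz : z ≠ 0) :
    (whittaker m).x (σ z) = (whittaker m).x z ∧
      (whittaker m).y (σ z) = -(whittaker m).y z := by
  refine ⟨by simp only [whittaker, σ, inv_inv]; ring, ?_⟩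
  by_cases h1 : z = 1
  · simp [whittaker, σ, h1]
  have h1' : z - 1 ≠ 0 := sub_ne_zero.2 h1
  have h2 : (1 : ℂ) - z ≠ 0 := sub_ne_zero.2 (Ne.symm h1)
  have h3 : z⁻¹ - 1 = (1 - z) / z := by field_simp
  simp only [whittaker, σ, h3]
  field_simp
  ring

/-! ### Residues -/

/-- The residue of `f dz` at the finite point `a`. -/
def residueAt (f : ℂ → ℂ) (a : ℂ) : ℂ :=
  limUnder (𝓝[>] (0 : ℝ)) fun ε => (2 * Real.pi * I)⁻¹ * ∮ z in C(a, ε), f z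

/-- The residue of `f dz` at the point `z = ∞`. -/
def residueAtInfty (f : ℂ → ℂ) : ℂ :=
  -limUnder (atTop : Filter ℝ) fun r => (2 * Real.pi * I)⁻¹ * ∮ z in C(0, r), f z

/-! ### Refined topological recursion -/

/-- The fundamental bidifferential `B`. -/
def bergman (z w : ℂ) : ℂ := 1 / (z - w) ^ 2

/-- The primitive of `B z ·` that vanishes at `∞`. -/
def bergmanPrimitive (z w : ℂ) : ℂ := 1 / (z - w)

theorem hasDerivAt_bergmanPrimitive {z w : ℂ} (h : z ≠ w) :
    HasDerivAt (bergmanPrimitive z) (bergman z w) w := by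
  have h' : z - w ≠ 0 := sub_ne_zero.2 h
  have := ((hasDerivAt_id w).const_sub z).inv h'
  have e : bergmanPrimitive z = fun i => (z - i)⁻¹ := by
    funext i
    simp [bergmanPrimitive]
  rw [e]
  simpa [bergman, Pi.inv_def] using this

/-- `η_p`, the integral of `B p₀ ·` from `σ p` to `p`. -/
def eta (p p₀ : ℂ) : ℂ := bergmanPrimitive p₀ p - bergmanPrimitive p₀ (σ p)

/-- `η_p` for `p = ∞₊`: the integral of `B p₀ ·` from `∞₋ = 0` to `∞₊ = ∞`. -/
def etaInfty (p₀ : ℂ) : ℂ := -bergmanPrimitive p₀ 0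

/-- `ω_{0,1} = y dx`. -/
def omega01 (S : SpectralCurve) (p : ℂ) : ℂ := S.y p * deriv S.x p

/-- `ω_{0,2}(p, q) = -B(σ p, q)`. -/
def omega02 (p q : ℂ) : ℂ := -(bergman (σ p) q * deriv σ p)

/-- The odd part `(Q / 2) μ η_{∞₊}` of `ω_{1/2,1}`. -/
def omegaHalfOdd (Q μ p : ℂ) : ℂ := Q / 2 * (μ * etaInfty p)

/-- `ω_{1/2,1} = (Q / 2) (- dy / y + μ η_{∞₊})`. -/
def omegaHalf (S : SpectralCurve) (Q μ p : ℂ) : ℂ :=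
  Q / 2 * (-(deriv S.y p / S.y p) + μ * etaInfty p)

/-- The expression `Rec_{g,n+1}(p, J)`, with `h = 2 g` and `J` of cardinality `n`, for a family
`W h p J` standing for `ω_{h/2, n+1}(p, J)`. In the quadratic term the summands that contain
`ω_{0,1}` are left out. -/
def recTerm (S : SpectralCurve) (Q : ℂ) (W : ℕ → ℂ → Multiset ℂ → ℂ)
    (h : ℕ) (p : ℂ) (J : Multiset ℂ) : ℂ :=
  (J.map fun q =>
      deriv S.x p * deriv S.x q / (S.x p - S.x q) ^ 2 * W h p (J.erase q)).sum
    + ∑ h₁ ∈ Finset.range (h + 1), (J.antidiagonal.map fun K =>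
        if (h₁ = 0 ∧ K.1 = 0) ∨ (h₁ = h ∧ K.2 = 0) then 0
        else W h₁ p K.1 * W (h - h₁) p K.2).sum
    + (if 2 ≤ h then W (h - 2) p (p ::ₘ J) else 0)
    + (if 1 ≤ h then Q * deriv S.x p * deriv (fun q => W (h - 1) q J / deriv S.x q) p else 0)

/-- The right-hand side of the recursion: minus the sum of the residues at the ramification
points, at `σ(p₀), σ(p₁), …, σ(pₙ)` and at `∞₊`. -/
def recursionStep (S : SpectralCurve) (Q : ℂ) (W : ℕ → ℂ → Multiset ℂ → ℂ)
    (h : ℕ) (p₀ : ℂ) (J : Multiset ℂ) : ℂ :=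
  -(∑ r ∈ ramification ∪ ((p₀ ::ₘ J).map σ).toFinset,
        residueAt (fun p => eta p p₀ / (2 * omega01 S p) * recTerm S Q W h p J) r
      + residueAtInfty (fun p => eta p p₀ / (2 * omega01 S p) * recTerm S Q W h p J))

/-- Auxiliary to `omega`: correct in the range `h + n < N`. -/
def omegaAux (S : SpectralCurve) (Q μ : ℂ) : ℕ → ℕ → ℂ → Multiset ℂ → ℂ
  | 0 => fun _ _ _ => 0
  | N + 1 => fun h p J =>
      if h = 0 ∧ J = 0 then omega01 S p
      else if h = 0 ∧ J.card = 1 then (J.map (omega02 p)).sum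
      else if h = 1 ∧ J = 0 then omegaHalf S Q μ p
      else recursionStep S Q (omegaAux S Q μ N) h p J

/-- The multidifferential `ω_{g,n+1}(p, J)` of the refined topological recursion with refinement
parameter `Q` and divisor `μ [∞₊]`, where `h = 2 g` and `n = J.card`. -/
def omega (S : SpectralCurve) (Q μ : ℂ) (h : ℕ) (p : ℂ) (J : Multiset ℂ) : ℂ :=
  omegaAux S Q μ (h + J.card + 1) h p J

theorem recTerm_congr (S : SpectralCurve) (Q : ℂ) {V W : ℕ → ℂ → Multiset ℂ → ℂ}
    {h : ℕ} {J : Multiset ℂ}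
    (H : ∀ k p K, k + K.card < h + J.card → V k p K = W k p K) (p : ℂ) :
    recTerm S Q V h p J = recTerm S Q W h p J := by
  unfold recTerm
  congr 1
  · congr 1
    · congr 1
      · congr 1
        refine Multiset.map_congr rfl fun q hq => ?_
        rw [H]
        have := Multiset.card_erase_lt_of_mem hq
        omega
      · refine Finset.sum_congr rfl fun k hk => ?_
        congr 1
        refine Multiset.map_congr rfl fun K hK => ?_
        have hc : K.1.card + K.2.card = J.card := by
          rw [← Multiset.card_add, Multiset.mem_antidiagonal.1 hK]
        have hk' : k ≤ h := Nat.lt_succ_iff.1 (Finset.mem_range.1 hk)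
        split_ifs with hif
        · rfl
        · push Not at hif
          have h1 : 0 < k + K.1.card := by
            rcases Nat.eq_zero_or_pos k with h0 | h0
            · have := Multiset.card_pos.2 (hif.1 h0)
              omega
            · omega
          have h2 : 0 < (h - k) + K.2.card := by
            rcases Nat.lt_or_ge k h with h0 | h0
            · omega
            · have := Multiset.card_pos.2 (hif.2 (le_antisymm hk' h0))
              omega
          rw [H k p K.1 (by omega), H (h - k) p K.2 (by omega)]
    · split_ifs with h2
      · exact H _ _ _ (by rw [Multiset.card_cons]; omega)
      · rfl
  · split_ifs with h1
    · have : (fun q => V (h - 1) q J / deriv S.x q) = fun q => W (h - 1) q J / deriv S.x q := by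
        funext q
        rw [H _ _ _ (by omega)]
      rw [this]
    · rfl

theorem omegaAux_eq_omega (S : SpectralCurve) (Q μ : ℂ) (N : ℕ) :
    ∀ h p J, h + J.card < N → omegaAux S Q μ N h p J = omega S Q μ h p J := by
  induction N using Nat.strong_induction_on with
  | _ N ih =>
    intro h p J hN
    rcases Nat.lt_or_ge (h + J.card + 1) N with hlt | hge
    · obtain ⟨M, rfl⟩ : ∃ M, N = M + 1 := ⟨N - 1, by omega⟩
      have H : ∀ k p K, k + Multiset.card K < h + J.card →
          omegaAux S Q μ M k p K = omegaAux S Q μ (h + J.card) k p K := fun k p K hk => by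
        rw [ih M (by omega) k p K (by omega), ih _ (by omega) k p K hk]
      unfold omega
      simp only [omegaAux, recursionStep, recTerm_congr S Q H]
    · have : N = h + J.card + 1 := by omega
      rw [this, omega]

/-- `omega` satisfies the refined topological recursion. -/
theorem omega_recursion (S : SpectralCurve) (Q μ : ℂ) (h : ℕ) (p : ℂ) (J : Multiset ℂ)
    (hJ : 2 ≤ h + J.card) :
    omega S Q μ h p J = recursionStep S Q (omega S Q μ) h p J := by
  have H : ∀ k p K, k + Multiset.card K < h + J.card →
      omegaAux S Q μ (h + J.card) k p K = omega S Q μ k p K := fun k p K hk =>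
    omegaAux_eq_omega S Q μ _ k p K hk
  have h1 : ¬(h = 0 ∧ J = 0) := by
    rintro ⟨rfl, rfl⟩
    simp at hJ
  have h2 : ¬(h = 0 ∧ J.card = 1) := by omega
  have h3 : ¬(h = 1 ∧ J = 0) := by
    rintro ⟨rfl, rfl⟩
    simp at hJ
  rw [omega]
  simp only [omegaAux, recursionStep, if_neg h1, if_neg h2, if_neg h3, recTerm_congr S Q H]

/-! ### The wave function -/

/-- The integral of `f dζ` from `∞₋ = 0` to `z`, along the ray through `z`. -/
def intFromZero (f : ℂ → ℂ) (z : ℂ) : ℂ := ∫ t in (0 : ℝ)..1, f (t * z) * z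

/-- The integral of `f dζ` from `∞₊ = ∞` to `z`, along the ray through `z`. -/
def intFromInfty (f : ℂ → ℂ) (z : ℂ) : ℂ := -∫ t in Set.Ioi (1 : ℝ), f (t * z) * z

/-- The integral of `f dζ` along the divisor `D(z) = ν₊ [∞₊] + ν₋ [∞₋]`. -/
def divisorInt (νp νm : ℂ) (f : ℂ → ℂ) (z : ℂ) : ℂ :=
  νp * intFromInfty f z + νm * intFromZero f z

/-- The `n`-fold integral along `D(z)`, the innermost integral being the one over the last
variable. -/
def multiInt (νp νm : ℂ) : ℕ → (Multiset ℂ → ℂ) → ℂ → ℂ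
  | 0, f, _ => f 0
  | n + 1, f, z => divisorInt νp νm (fun ζ => multiInt νp νm n (fun J => f (ζ ::ₘ J)) z) z

/-- The coefficient of `ħ ^ (j - 1)` in the logarithmic derivative `T` of the wave function
`exp (∑ ħ ^ (2g-2+n) / (β ^ (n/2) n!) ∫_{D(z)} ⋯ ∫_{D(z)} ω_{g,n})`, where `b = β ^ (1/2)`.

Since `ω_{g,n+1}` is symmetric, the `z`-derivative of its `(n+1)`-fold integral along `D(z)` is
`n + 1` times the `n`-fold integral of `ω_{g,n+1}(z, ·)`; this is also what the logarithmic
derivative means for `(g,n+1) = (0,1), (1/2,1), (0,2)`, where the `(n+1)`-fold integral itself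
diverges. The sum runs over the `(g,n+1)` with `2g - 2 + (n+1) = j - 1`. -/
def T (S : SpectralCurve) (b μ νp νm : ℂ) (j : ℕ) (z : ℂ) : ℂ :=
  ∑ n ∈ Finset.range (j + 1), 1 / ((n.factorial : ℂ) * b ^ (n + 1)) *
    multiInt νp νm n (fun J => omega S (b - b⁻¹) μ (j - n) z J) z

/-- The odd part `(T dz - σ^*(T dz)) / 2`, again divided by `dz`. -/
def Todd (S : SpectralCurve) (b μ νp νm : ℂ) (j : ℕ) (z : ℂ) : ℂ :=
  (T S b μ νp νm j z - T S b μ νp νm j (σ z) * deriv σ z) / 2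

/-! ### The cycle `γ` -/

/-- The integral of `f dz` over the generator `γ` of the homology of the punctured plane
`z ≠ 0, ∞`, oriented positively around `∞₊`: the circle `|z| = R`, run through clockwise in the
coordinate `z`. -/
def gammaInt (R : ℝ) (f : ℂ → ℂ) : ℂ := -∮ z in C(0, R), f z

/-- The Voros coefficient of the cycle `γ`, the term-wise integral of `T_odd dz`, as a formal
Laurent series in `ħ`. -/
def vorosGamma (S : SpectralCurve) (b μ νp νm : ℂ) (R : ℝ) : LaurentSeries ℂ :=
  HahnSeries.single (-1) 1 *
    HahnSeries.ofPowerSeries ℤ ℂ (PowerSeries.mk fun j => gammaInt R (Todd S b μ νp νm j))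

/-- The central charge `Z(γ)`. -/
def centralCharge (S : SpectralCurve) (R : ℝ) : ℂ := gammaInt R (omega01 S)

/-- The quantum correction to the central charge at `γ`. -/
def quantumCorrection (Q μ : ℂ) (R : ℝ) : ℂ := gammaInt R (omegaHalfOdd Q μ)

/-- The quantum central charge `Z(γ) + ħ z(γ)`, a formal power series in `ħ`. -/
def quantumCentralCharge (S : SpectralCurve) (Q μ : ℂ) (R : ℝ) : PowerSeries ℂ :=
  PowerSeries.C (centralCharge S R) + PowerSeries.X * PowerSeries.C (quantumCorrection Q μ R)

theorem gammaInt_eq {f F : ℂ → ℂ} {b : ℂ} {R : ℝ} (hR : 0 < R)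
    (hc : ContinuousOn f (Metric.sphere 0 R))
    (hF : ∀ z ∈ Metric.sphere (0 : ℂ) R, HasDerivAt F (f z - b * z⁻¹) z) :
    gammaInt R f = -(2 * Real.pi * I * b) := by
  have hz : ∀ z ∈ Metric.sphere (0 : ℂ) R, z ≠ 0 := by
    rintro z hz rfl
    simp at hz
    exact hR.ne hz
  have c1 : ContinuousOn (fun z : ℂ => b * z⁻¹) (Metric.sphere 0 R) :=
    continuousOn_const.mul (continuousOn_id.inv₀ hz)
  have h0 := circleIntegral.integral_eq_zero_of_hasDerivWithinAt hR.le
    fun z hz => (hF z hz).hasDerivWithinAt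
  have h1 := circleIntegral.integral_sub (hc.circleIntegrable hR.le) (c1.circleIntegrable hR.le)
  rw [h0, circleIntegral.integral_const_mul] at h1
  have h2 := circleIntegral.integral_sub_center_inv (0 : ℂ) hR.ne'
  simp only [sub_zero] at h2
  rw [h2] at h1
  unfold gammaInt
  linear_combination h1

/-- The cycle `γ` is normalised by `∫_γ y dx = 2 π i m`: Weber curve. -/
theorem centralCharge_weber (s : ℂ) {R : ℝ} (hR : 0 < R) :
    centralCharge (weber s) R = 2 * Real.pi * I * s ^ 2 := by
  have hz : ∀ z ∈ Metric.sphere (0 : ℂ) R, z ≠ 0 := by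
    rintro z hz rfl
    simp at hz
    exact hR.ne hz
  have hx : ∀ z : ℂ, z ≠ 0 → deriv (weber s).x z = s * (1 - (z ^ 2)⁻¹) := fun z h => by
    have := (((hasDerivAt_id z).add (hasDerivAt_inv h)).const_mul s).deriv
    rw [sub_eq_add_neg]
    exact this
  have hω : ∀ z ∈ Metric.sphere (0 : ℂ) R,
      omega01 (weber s) z = s / 2 * (z - z⁻¹) * (s * (1 - (z ^ 2)⁻¹)) := fun z h => by
    rw [omega01, hx z (hz z h)]
    rfl
  rw [centralCharge, gammaInt_eq (b := -s ^ 2)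
    (F := fun z => s ^ 2 / 4 * (z ^ 2 - (z ^ 2)⁻¹)) hR]
  · ring
  · refine ContinuousOn.congr ?_ hω
    have h1 : ContinuousOn (fun z : ℂ => z⁻¹) (Metric.sphere 0 R) := continuousOn_id.inv₀ hz
    have h2 : ContinuousOn (fun z : ℂ => (z ^ 2)⁻¹) (Metric.sphere 0 R) :=
      (continuousOn_id.pow 2).inv₀ fun z h => pow_ne_zero 2 (hz z h)
    fun_prop
  · intro z h
    rw [hω z h]
    have h0 := hz z h
    have h1 := hasDerivAt_pow 2 z
    have := (h1.sub (h1.inv (pow_ne_zero 2 h0))).const_mul (s ^ 2 / 4)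
    refine this.congr_deriv ?_
    field_simp
    ring

/-- The cycle `γ` is normalised by `∫_γ y dx = 2 π i m`: Whittaker curve. -/
theorem centralCharge_whittaker (m : ℂ) {R : ℝ} (hR : 0 < R) (hR1 : R ≠ 1) :
    centralCharge (whittaker m) R = 2 * Real.pi * I * m := by
  have hz : ∀ z ∈ Metric.sphere (0 : ℂ) R, z ≠ 0 := by
    rintro z hz rfl
    simp at hz
    exact hR.ne hz
  have hz1 : ∀ z ∈ Metric.sphere (0 : ℂ) R, z - 1 ≠ 0 := by
    intro z hz h
    rw [sub_eq_zero.1 h] at hz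
    simp at hz
    exact hR1 hz.symm
  have hx : ∀ z : ℂ, z ≠ 0 → deriv (whittaker m).x z = m * (1 - (z ^ 2)⁻¹) := fun z h => by
    have := ((((hasDerivAt_id z).sub_const 2).add (hasDerivAt_inv h)).const_mul m).deriv
    rw [sub_eq_add_neg]
    exact this
  have hω : ∀ z ∈ Metric.sphere (0 : ℂ) R,
      omega01 (whittaker m) z = -(m / 2) * (1 + 2 * z⁻¹ + (z ^ 2)⁻¹) := fun z h => by
    rw [omega01, hx z (hz z h)]
    have h0 := hz z h
    have h1 := hz1 z h
    simp only [whittaker]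
    field_simp
    ring
  rw [centralCharge, gammaInt_eq (b := -m) (F := fun z => -(m / 2) * (z - z⁻¹)) hR]
  · ring
  · refine ContinuousOn.congr ?_ hω
    have h1 : ContinuousOn (fun z : ℂ => z⁻¹) (Metric.sphere 0 R) := continuousOn_id.inv₀ hz
    have h2 : ContinuousOn (fun z : ℂ => (z ^ 2)⁻¹) (Metric.sphere 0 R) :=
      (continuousOn_id.pow 2).inv₀ fun z h => pow_ne_zero 2 (hz z h)
    fun_prop
  · intro z h
    rw [hω z h]
    have h0 := hz z h
    have := ((hasDerivAt_id z).sub (hasDerivAt_inv h0)).const_mul (-(m / 2))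
    refine this.congr_deriv ?_
    field_simp
    ring

end RefinedTR

end

/-!
The statement holds because of how the multidifferentials behave at the corners of the
configuration space of `z`-coordinates, that is, when the coordinates tend to `0` or `∞` at
different rates.

Written with respect to the logarithms of the coordinates, every `ω_{g,n+1}(p, J)` except `ω_{0,1}`
is the derivative, in all variables of `J`, of a polynomial `P` in the functions
`1 / (1 - v_i v_l)`, where `v_l` is another or the same variable, or `± 1`. Such a polynomial has a
limit at each corner (`CornerAlg`, `corner`). For `2g - 2 + (n + 1) ≥ 1` all these limits vanish.
The reason is that `1 / (2 ω_{0,1})` equals `e ^ 2 - e` up to a constant, where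
`e = 1 / (1 - v ^ 2)` or `e = 1 / (1 + v)`; at a corner `e` is `0` or `1`. By the residue theorem
the sum of residues in the recursion can be evaluated at the complementary poles `p₀, p₁, …, pₙ`
(`negResidueSum_step`). The outcome is a combination of products and divided differences of
multiples of `1 / ω_{0,1}`, and the elements that vanish at all corners form an ideal that is
preserved by divided differences (`exists_dividedDiff`, `exists_represents_step`,
`exists_represents`).

Integrating a derivative in `v_i` along `D(z)` evaluates its primitive at the divisor
`[z] - ν₊ [∞] - ν₋ [0]`, an operation that again preserves the ideal (`multiInt_eq_ev`,
`divisorEvals_mem_cornerIdeal`). Thus each coefficient of `T dz`, apart from the leading one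
`ω_{0,1} / β ^ (1/2)`, has the form `τ(z) dz / z` with `τ` rational, regular at `0` and `∞`, and
with poles at `± 1` only. The integral of its odd part over `γ` is `- π i (τ(0) + τ(∞))`, on either
side of the unit circle (`gammaInt_odd`). This is zero for all coefficients beyond the first two
(`exists_symbol_T`); the first is given by the oddness of `ω_{0,1}` (`gammaInt_Todd_zero`), and
the second is computed from `ω_{1/2,1}` and `ω_{0,2}` (`exists_symbol_T_one`).

For non-real `z` the rays of integration meet no poles. The circle of integration contains only two
real points, and these do not affect the cycle integral.
-/

noncomputable section

namespace RefinedTR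

/-! ### Sums of residues -/

/-- Along the filter `l` of radii, the circle integrals of `f` around `c` exist and are eventually
equal to `2 π i ρ`. -/
def EventualIntegral (c : ℂ) (l : Filter ℝ) (f : ℂ → ℂ) (ρ : ℂ) : Prop :=
  ∀ᶠ ε in l, CircleIntegrable f c ε ∧ (∮ z in C(c, ε), f z) = 2 * Real.pi * I * ρ

theorem EventualIntegral.add {c : ℂ} {l : Filter ℝ} {f g : ℂ → ℂ} {ρ τ : ℂ}
    (hf : EventualIntegral c l f ρ) (hg : EventualIntegral c l g τ) :
    EventualIntegral c l (f + g) (ρ + τ) := by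
  filter_upwards [hf, hg] with ε h1 h2
  refine ⟨h1.1.add h2.1, ?_⟩
  have := circleIntegral.integral_add h1.1 h2.1
  simp only [Pi.add_apply]
  rw [this, h1.2, h2.2]
  ring

theorem EventualIntegral.smul {c : ℂ} {l : Filter ℝ} {f : ℂ → ℂ} {ρ : ℂ} (a : ℂ)
    (hf : EventualIntegral c l f ρ) : EventualIntegral c l (a • f) (a * ρ) := by
  filter_upwards [hf] with ε h1
  refine ⟨h1.1.const_smul, ?_⟩
  simp only [Pi.smul_apply, smul_eq_mul, circleIntegral.integral_const_mul]
  rw [h1.2]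
  ring

theorem eventuallyEq_codiscreteWithin_of_finite {f g : ℂ → ℂ} {s : Set ℂ} (hs : s.Finite)
    (h : ∀ z ∉ s, f z = g z) (U : Set ℂ) : f =ᶠ[codiscreteWithin U] g := by
  filter_upwards [compl_finite_mem_codiscreteWithin hs] with z hz using h z hz

theorem EventualIntegral.congr {c : ℂ} {l : Filter ℝ} {f g : ℂ → ℂ} {ρ : ℂ} {s : Set ℂ}
    (hl : ∀ᶠ ε in l, ε ≠ 0) (hf : EventualIntegral c l f ρ) (hs : s.Finite)
    (h : ∀ z ∉ s, f z = g z) : EventualIntegral c l g ρ := by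
  filter_upwards [hf, hl] with ε h1 h2
  have e := eventuallyEq_codiscreteWithin_of_finite hs h (Metric.sphere c |ε|)
  exact ⟨h1.1.congr_codiscreteWithin e,
    (circleIntegral.circleIntegral_congr_codiscreteWithin e h2).symm.trans h1.2⟩

/-- `lam` is minus the sum of the residues of `f` at the points of `I` and at `∞`. -/
def NegResidueSum (I : Finset ℂ) (f : ℂ → ℂ) (lam : ℂ) : Prop :=
  ∃ (ρ : ℂ → ℂ) (κ : ℂ), (∀ r ∈ I, EventualIntegral r (𝓝[>] 0) f (ρ r)) ∧
    EventualIntegral 0 atTop f κ ∧ lam = κ - ∑ r ∈ I, ρ r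

theorem NegResidueSum.add {I : Finset ℂ} {f g : ℂ → ℂ} {a b : ℂ} (hf : NegResidueSum I f a)
    (hg : NegResidueSum I g b) : NegResidueSum I (f + g) (a + b) := by
  obtain ⟨ρ, κ, h1, h2, rfl⟩ := hf
  obtain ⟨ρ', κ', h1', h2', rfl⟩ := hg
  refine ⟨ρ + ρ', κ + κ', fun r hr => (h1 r hr).add (h1' r hr), h2.add h2', ?_⟩
  simp only [Pi.add_apply, Finset.sum_add_distrib]
  ring

theorem NegResidueSum.smul {I : Finset ℂ} {f : ℂ → ℂ} {a : ℂ} (c : ℂ)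
    (hf : NegResidueSum I f a) : NegResidueSum I (c • f) (c * a) := by
  obtain ⟨ρ, κ, h1, h2, rfl⟩ := hf
  refine ⟨c • ρ, c * κ, fun r hr => (h1 r hr).smul c, h2.smul c, ?_⟩
  simp only [Pi.smul_apply, smul_eq_mul, ← Finset.mul_sum]
  ring

theorem NegResidueSum.congr {I : Finset ℂ} {f g : ℂ → ℂ} {a : ℂ} {s : Set ℂ}
    (hf : NegResidueSum I f a) (hs : s.Finite) (h : ∀ z ∉ s, f z = g z) :
    NegResidueSum I g a := by
  obtain ⟨ρ, κ, h1, h2, rfl⟩ := hf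
  refine ⟨ρ, κ, fun r hr => (h1 r hr).congr ?_ hs h, h2.congr (eventually_ne_atTop 0) hs h, rfl⟩
  filter_upwards [self_mem_nhdsWithin] with ε hε using ne_of_gt hε

theorem NegResidueSum.zero (I : Finset ℂ) : NegResidueSum I 0 0 := by
  refine ⟨0, 0, fun r _ => ?_, ?_, by simp⟩ <;>
  · refine Eventually.of_forall fun ε => ⟨?_, by simp [circleIntegral]⟩
    exact continuousOn_const.circleIntegrable'

theorem NegResidueSum.sum {ι : Type*} {I : Finset ℂ} {f : ι → ℂ → ℂ} {a : ι → ℂ} (s : Finset ι)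
    (h : ∀ i ∈ s, NegResidueSum I (f i) (a i)) :
    NegResidueSum I (∑ i ∈ s, f i) (∑ i ∈ s, a i) := by
  classical
  induction s using Finset.induction_on with
  | empty => simpa using NegResidueSum.zero I
  | insert i s hi ih =>
    rw [Finset.sum_insert hi, Finset.sum_insert hi]
    exact (h i (Finset.mem_insert_self i s)).add
      (ih fun j hj => h j (Finset.mem_insert_of_mem hj))

theorem NegResidueSum.residue_eq {I : Finset ℂ} {f : ℂ → ℂ} {a : ℂ} (hf : NegResidueSum I f a) :
    -(∑ r ∈ I, residueAt f r + residueAtInfty f) = a := by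
  obtain ⟨ρ, κ, h1, h2, rfl⟩ := hf
  have h3 : ∀ r ∈ I, residueAt f r = ρ r := fun r hr => by
    refine Tendsto.limUnder_eq (tendsto_const_nhds.congr' ?_)
    filter_upwards [h1 r hr] with ε hε
    rw [hε.2, inv_mul_cancel_left₀ two_pi_I_ne_zero]
  have h4 : residueAtInfty f = -κ := by
    rw [residueAtInfty, neg_inj]
    refine Tendsto.limUnder_eq (tendsto_const_nhds.congr' ?_)
    filter_upwards [h2] with ε hε
    rw [hε.2, inv_mul_cancel_left₀ two_pi_I_ne_zero]
  rw [Finset.sum_congr rfl h3, h4]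
  ring

theorem eventualIntegral_sub_inv (r s : ℂ) :
    EventualIntegral r (𝓝[>] 0) (fun z => (z - s) ^ (-1 : ℤ)) (if r = s then 1 else 0) := by
  rcases eq_or_ne r s with rfl | hrs
  · filter_upwards [self_mem_nhdsWithin] with ε hε
    have hε : 0 < ε := hε
    refine ⟨circleIntegrable_sub_zpow_iff.2 (Or.inr (Or.inr ?_)), ?_⟩
    · rw [abs_of_pos hε, Metric.mem_sphere, dist_self]
      exact hε.ne
    · simp only [zpow_neg_one, if_true, mul_one]
      exact circleIntegral.integral_sub_center_inv r hε.ne'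
  · have : ∀ᶠ ε in 𝓝[>] (0 : ℝ), ε < dist s r :=
      nhdsWithin_le_nhds (eventually_lt_nhds (dist_pos.2 hrs.symm))
    filter_upwards [self_mem_nhdsWithin, this] with ε hε h2
    have hε : 0 < ε := hε
    have hne : ∀ z ∈ Metric.closedBall r ε, z - s ≠ 0 := by
      intro z hz h
      rw [sub_eq_zero.1 h, Metric.mem_closedBall] at hz
      linarith
    refine ⟨circleIntegrable_sub_zpow_iff.2 (Or.inr (Or.inr ?_)), ?_⟩
    · rw [abs_of_pos hε, Metric.mem_sphere]
      exact h2.ne'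
    · simp only [zpow_neg_one, if_neg hrs, mul_zero]
      refine Complex.circleIntegral_eq_zero_of_differentiable_on_off_countable hε.le
        Set.countable_empty ?_ fun z hz => ?_
      · exact (continuousOn_id.sub continuousOn_const).inv₀ hne
      · exact (differentiableAt_id.sub_const s).inv (hne z (Metric.ball_subset_closedBall hz.1))

theorem eventualIntegral_sub_zpow (r s : ℂ) {n : ℤ} (hn : n ≠ -1) :
    EventualIntegral r (𝓝[>] 0) (fun z => (z - s) ^ n) 0 := by
  have : ∀ᶠ ε in 𝓝[>] (0 : ℝ), ε ≠ dist s r := by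
    rcases eq_or_ne s r with rfl | h
    · filter_upwards [self_mem_nhdsWithin] with ε hε
      simpa using ne_of_gt hε
    · filter_upwards [nhdsWithin_le_nhds (eventually_lt_nhds (dist_pos.2 h))] with ε hε using hε.ne
  filter_upwards [this, self_mem_nhdsWithin] with ε hε h0
  refine ⟨circleIntegrable_sub_zpow_iff.2 (Or.inr (Or.inr ?_)), ?_⟩
  · rw [abs_of_pos h0, Metric.mem_sphere]
    exact hε.symm
  · rw [circleIntegral.integral_sub_zpow_of_ne hn, mul_zero]

theorem eventualIntegral_atTop_sub_zpow (s : ℂ) (n : ℤ) :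
    EventualIntegral 0 atTop (fun z => (z - s) ^ n) (if n = -1 then 1 else 0) := by
  filter_upwards [eventually_gt_atTop (dist s 0), eventually_gt_atTop 0] with ε hε h0
  refine ⟨circleIntegrable_sub_zpow_iff.2 (Or.inr (Or.inr ?_)), ?_⟩
  · rw [abs_of_pos h0, Metric.mem_sphere]
    exact hε.ne
  · split_ifs with h
    · subst h
      simp only [zpow_neg_one, mul_one]
      exact circleIntegral.integral_sub_inv_of_mem_ball hε
    · rw [circleIntegral.integral_sub_zpow_of_ne h, mul_zero]

theorem negResidueSum_sub_zpow (I : Finset ℂ) (s : ℂ) (n : ℤ) :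
    NegResidueSum I (fun z => (z - s) ^ n) (if n = -1 ∧ s ∉ I then 1 else 0) := by
  by_cases hn : n = -1
  · subst hn
    refine ⟨_, _, fun r _ => eventualIntegral_sub_inv r s, eventualIntegral_atTop_sub_zpow s _, ?_⟩
    by_cases hs : s ∈ I <;> simp [hs]
  · refine ⟨_, _, fun r _ => eventualIntegral_sub_zpow r s hn,
      eventualIntegral_atTop_sub_zpow s _, ?_⟩
    simp [hn]

/-! ### Rational functions with prescribed poles -/

/-- The rational functions with poles in `S ∪ {∞}`, as functions on `ℂ` with junk values at the
poles. -/
def ratFun (S : Set ℂ) : Subalgebra ℂ (ℂ → ℂ) :=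
  Algebra.adjoin ℂ (insert id ((fun s z => (z - s)⁻¹) '' S))

theorem id_mem_ratFun (S : Set ℂ) : (fun z => z) ∈ ratFun S :=
  Algebra.subset_adjoin (Set.mem_insert _ _)

theorem sub_inv_mem_ratFun {S : Set ℂ} {s : ℂ} (hs : s ∈ S) : (fun z => (z - s)⁻¹) ∈ ratFun S :=
  Algebra.subset_adjoin (Set.mem_insert_of_mem _ ⟨s, hs, rfl⟩)

theorem const_mem_ratFun (S : Set ℂ) (c : ℂ) : (fun _ => c) ∈ ratFun S :=
  (ratFun S).algebraMap_mem c

/-- The function `z ↦ 1 / (1 - z u)` has its only pole at `1 / u`. -/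
theorem one_sub_mul_inv_mem_ratFun {S : Set ℂ} {u : ℂ} (hu : u ≠ 0 → u⁻¹ ∈ S) :
    (fun z => (1 - z * u)⁻¹) ∈ ratFun S := by
  rcases eq_or_ne u 0 with rfl | h
  · simpa using const_mem_ratFun S 1
  · have := (ratFun S).smul_mem (sub_inv_mem_ratFun (hu h)) (-u⁻¹)
    convert this using 1
    funext z
    simp only [Pi.smul_apply, smul_eq_mul]
    have e : 1 - z * u = -u * (z - u⁻¹) := by
      field_simp
      ring
    rw [e, mul_inv, inv_neg]

theorem ratFun_differentiableAt {S : Set ℂ} {f : ℂ → ℂ} (hf : f ∈ ratFun S) {a : ℂ} (ha : a ∉ S) :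
    DifferentiableAt ℂ f a := by
  induction hf using Algebra.adjoin_induction with
  | mem f hf =>
    rcases hf with rfl | ⟨s, hs, rfl⟩
    · exact differentiableAt_id
    · exact (differentiableAt_id.sub_const s).inv (sub_ne_zero.2 fun h => ha (by
        rwa [show a = s from h]))
  | algebraMap c => exact differentiableAt_const c
  | add f g _ _ h1 h2 => exact h1.add h2
  | mul f g _ _ h1 h2 => exact h1.mul h2

/-- Division with remainder by `z - a` at a point `a` that is not a pole. -/
theorem ratFun_divide {S : Set ℂ} {f : ℂ → ℂ} (hf : f ∈ ratFun S) {a : ℂ} (ha : a ∉ S) :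
    ∃ k ∈ ratFun S, ∀ z ∉ S, f z = f a + (z - a) * k z := by
  induction hf using Algebra.adjoin_induction with
  | mem f hf =>
    rcases hf with rfl | ⟨s, hs, rfl⟩
    · exact ⟨1, (ratFun S).one_mem, fun z _ => by simp⟩
    · refine ⟨_, (ratFun S).smul_mem (sub_inv_mem_ratFun hs) (-(a - s)⁻¹), fun z hz => ?_⟩
      have h1 : z - s ≠ 0 := sub_ne_zero.2 fun h => hz (h ▸ hs)
      have h2 : a - s ≠ 0 := sub_ne_zero.2 fun h => ha (h ▸ hs)
      simp only [Pi.smul_apply, smul_eq_mul]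
      field_simp
      ring
  | algebraMap c => exact ⟨0, (ratFun S).zero_mem, fun z _ => by simp⟩
  | add f g _ _ h1 h2 =>
    obtain ⟨k, hk, h1⟩ := h1
    obtain ⟨l, hl, h2⟩ := h2
    refine ⟨k + l, (ratFun S).add_mem hk hl, fun z hz => ?_⟩
    simp only [Pi.add_apply, h1 z hz, h2 z hz]
    ring
  | mul f g hf hg h1 h2 =>
    obtain ⟨k, hk, h1⟩ := h1
    obtain ⟨l, hl, h2⟩ := h2
    refine ⟨k * g + f a • l, (ratFun S).add_mem ((ratFun S).mul_mem hk hg)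
      ((ratFun S).smul_mem hl _), fun z hz => ?_⟩
    simp only [Pi.add_apply, Pi.mul_apply, Pi.smul_apply, smul_eq_mul, h1 z hz]
    linear_combination f a * h2 z hz

/-- The span of the powers `(z - s) ^ n`, `s ∈ S`, `n ∈ ℤ`. -/
def zpowSpan (S : Set ℂ) : Submodule ℂ (ℂ → ℂ) :=
  Submodule.span ℂ {f | ∃ s ∈ S, ∃ n : ℤ, f = fun z => (z - s) ^ n}

theorem zpow_mem_zpowSpan {S : Set ℂ} {s : ℂ} (hs : s ∈ S) (n : ℤ) :
    (fun z => (z - s) ^ n) ∈ zpowSpan S :=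
  Submodule.subset_span ⟨s, hs, n, rfl⟩

/-- Partial fractions for `(z - t)⁻¹ (z - s) ^ n`. -/
theorem exists_mem_zpowSpan_inv_mul {S : Set ℂ} {s t : ℂ} (hs : s ∈ S) (ht : t ∈ S) (n : ℤ) :
    ∃ g ∈ zpowSpan S, ∀ z ∉ S, (z - t)⁻¹ * (z - s) ^ n = g z := by
  rcases eq_or_ne t s with rfl | hts
  · refine ⟨_, zpow_mem_zpowSpan ht (n - 1), fun z hz => ?_⟩
    have h1 : z - t ≠ 0 := sub_ne_zero.2 fun h => hz (h ▸ ht)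
    rw [zpow_sub_one₀ h1, mul_comm]
  have hts' : t - s ≠ 0 := sub_ne_zero.2 hts
  have key : ∀ (n : ℤ), ∀ z ∉ S, (z - t)⁻¹ * (z - s) ^ (n + 1)
      = (z - s) ^ n + (t - s) * ((z - t)⁻¹ * (z - s) ^ n) := by
    intro n z hz
    have h1 : z - s ≠ 0 := sub_ne_zero.2 fun h => hz (h ▸ hs)
    have h2 : z - t ≠ 0 := sub_ne_zero.2 fun h => hz (h ▸ ht)
    rw [zpow_add_one₀ h1]
    field_simp
    ring
  induction n using Int.induction_on with
  | zero => exact ⟨_, zpow_mem_zpowSpan ht (-1), fun z _ => by simp⟩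
  | succ n ih =>
    obtain ⟨g, hg, h⟩ := ih
    refine ⟨_, (zpowSpan S).add_mem (zpow_mem_zpowSpan hs n) ((zpowSpan S).smul_mem (t - s) hg),
      fun z hz => ?_⟩
    rw [key n z hz, h z hz]
    rfl
  | pred n ih =>
    obtain ⟨g, hg, h⟩ := ih
    refine ⟨_, (zpowSpan S).smul_mem (t - s)⁻¹
      ((zpowSpan S).sub_mem hg (zpow_mem_zpowSpan hs (-n - 1))), fun z hz => ?_⟩
    have := key (-n - 1) z hz
    rw [sub_add_cancel, h z hz] at this
    simp only [Pi.smul_apply, Pi.sub_apply, smul_eq_mul, this]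
    field_simp
    ring

/-- Partial fractions. -/
theorem exists_mem_zpowSpan {S : Set ℂ} (hS : S.Nonempty) {f : ℂ → ℂ} (hf : f ∈ ratFun S) :
    ∃ g ∈ zpowSpan S, ∀ z ∉ S, f z = g z := by
  have step : ∀ u ∈ insert id ((fun s z => (z - s)⁻¹) '' S), ∀ f ∈ zpowSpan S,
      ∃ g ∈ zpowSpan S, ∀ z ∉ S, (u * f) z = g z := by
    intro u hu f hf
    induction hf using Submodule.span_induction with
    | mem f hf =>
      obtain ⟨s, hs, n, rfl⟩ := hf
      rcases hu with rfl | ⟨t, ht, rfl⟩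
      · refine ⟨_, (zpowSpan S).add_mem (zpow_mem_zpowSpan hs (n + 1))
          ((zpowSpan S).smul_mem s (zpow_mem_zpowSpan hs n)), fun z hz => ?_⟩
        have h1 : z - s ≠ 0 := sub_ne_zero.2 fun h => hz (h ▸ hs)
        simp only [Pi.mul_apply, Pi.add_apply, Pi.smul_apply, smul_eq_mul, id, zpow_add_one₀ h1]
        ring
      · exact exists_mem_zpowSpan_inv_mul hs ht n
    | zero => exact ⟨0, (zpowSpan S).zero_mem, fun z _ => by simp⟩
    | add f g _ _ h1 h2 =>
      obtain ⟨k, hk, h1⟩ := h1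
      obtain ⟨l, hl, h2⟩ := h2
      refine ⟨k + l, (zpowSpan S).add_mem hk hl, fun z hz => ?_⟩
      rw [mul_add, Pi.add_apply, Pi.add_apply, h1 z hz, h2 z hz]
    | smul c f _ h1 =>
      obtain ⟨k, hk, h1⟩ := h1
      refine ⟨c • k, (zpowSpan S).smul_mem c hk, fun z hz => ?_⟩
      rw [mul_smul_comm, Pi.smul_apply, Pi.smul_apply, h1 z hz]
  obtain ⟨s, hs⟩ := hS
  have step' : ∀ f ∈ ratFun S, ∀ u ∈ zpowSpan S, ∃ g ∈ zpowSpan S, ∀ z ∉ S, (f * u) z = g z := by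
    intro f hf
    induction hf using Algebra.adjoin_induction with
    | mem f hf => exact step f hf
    | algebraMap c =>
      intro u hu
      exact ⟨_, (zpowSpan S).smul_mem c hu, fun z _ => rfl⟩
    | add f g _ _ h1 h2 =>
      intro u hu
      obtain ⟨k, hk, h1⟩ := h1 u hu
      obtain ⟨l, hl, h2⟩ := h2 u hu
      refine ⟨k + l, (zpowSpan S).add_mem hk hl, fun z hz => ?_⟩
      rw [add_mul, Pi.add_apply, Pi.add_apply, h1 z hz, h2 z hz]
    | mul f g _ _ h1 h2 =>
      intro u hu
      obtain ⟨k, hk, h2⟩ := h2 u hu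
      obtain ⟨l, hl, h1⟩ := h1 k hk
      refine ⟨l, hl, fun z hz => ?_⟩
      rw [mul_assoc, Pi.mul_apply, h2 z hz, ← h1 z hz, Pi.mul_apply]
  obtain ⟨g, hg, h⟩ := step' f hf _ (zpow_mem_zpowSpan hs 0)
  exact ⟨g, hg, fun z hz => by simpa using h z hz⟩

/-- The residue theorem for a rational function all of whose poles lie in `I`. -/
theorem negResidueSum_of_mem_ratFun {I : Finset ℂ} (hI : I.Nonempty) {f : ℂ → ℂ}
    (hf : f ∈ ratFun (I : Set ℂ)) : NegResidueSum I f 0 := by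
  obtain ⟨g, hg, h⟩ := exists_mem_zpowSpan (S := (I : Set ℂ)) hI hf
  refine NegResidueSum.congr (f := g) ?_ I.finite_toSet fun z hz => (h z hz).symm
  clear h
  induction hg using Submodule.span_induction with
  | mem f hf =>
    obtain ⟨s, hs, n, rfl⟩ := hf
    have := negResidueSum_sub_zpow I s n
    rwa [if_neg fun h => h.2 hs] at this
  | zero => exact NegResidueSum.zero I
  | add f g _ _ h1 h2 => simpa using h1.add h2
  | smul c f _ h1 => simpa using h1.smul c

theorem negResidueSum_div_sub {I : Finset ℂ} (hI : I.Nonempty) {k : ℂ → ℂ}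
    (hk : k ∈ ratFun (I : Set ℂ)) {a : ℂ} (ha : a ∉ I) :
    NegResidueSum I (fun z => (a - z)⁻¹ * k z) (-k a) := by
  obtain ⟨l, hl, h⟩ := ratFun_divide hk (a := a) (by simpa using ha)
  have h1 := (negResidueSum_sub_zpow I a (-1)).smul (-k a)
  have h2 := (negResidueSum_of_mem_ratFun hI hl).smul (-1)
  have := h1.add h2
  simp only [ha, not_false_eq_true, and_self, if_true, mul_one, mul_zero, add_zero] at this
  refine this.congr (s := insert a I) (I.finite_toSet.insert a) fun z hz => ?_
  rw [Set.mem_insert_iff, not_or] at hz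
  have hz1 : z - a ≠ 0 := sub_ne_zero.2 hz.1
  have hz2 : a - z ≠ 0 := sub_ne_zero.2 (Ne.symm hz.1)
  have e : a - z = -(z - a) := by ring
  simp only [Pi.add_apply, Pi.smul_apply, smul_eq_mul, zpow_neg_one, h z hz.2]
  rw [e]
  field_simp
  ring

theorem negResidueSum_div_sub_sq {I : Finset ℂ} (hI : I.Nonempty) {k : ℂ → ℂ}
    (hk : k ∈ ratFun (I : Set ℂ)) {a : ℂ} (ha : a ∉ I) :
    NegResidueSum I (fun z => ((z - a) ^ 2)⁻¹ * k z) (deriv k a) := by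
  have ha' : a ∉ (I : Set ℂ) := by simpa using ha
  obtain ⟨l, hl, h⟩ := ratFun_divide hk ha'
  obtain ⟨l', hl', h'⟩ := ratFun_divide hl ha'
  have hd : deriv k a = l a := by
    have h3 : k =ᶠ[𝓝 a] fun z => k a + (z - a) * l z := by
      filter_upwards [I.finite_toSet.isClosed.isOpen_compl.mem_nhds ha'] with z hz using h z hz
    rw [h3.deriv_eq]
    have h4 := (((hasDerivAt_id a).sub_const a).mul
      (ratFun_differentiableAt hl ha').hasDerivAt).const_add (k a)
    simpa using h4.deriv
  have h1 := (negResidueSum_sub_zpow I a (-1)).smul (l a)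
  have h2 := (negResidueSum_sub_zpow I a (-2)).smul (k a)
  have := (h1.add h2).add (negResidueSum_of_mem_ratFun hI hl')
  simp only [ha, not_false_eq_true, and_self, if_true, mul_one, add_zero] at this
  rw [if_neg (by simp), mul_zero, add_zero] at this
  rw [hd]
  refine this.congr (s := insert a I) (I.finite_toSet.insert a) fun z hz => ?_
  rw [Set.mem_insert_iff, not_or] at hz
  have hz1 : z - a ≠ 0 := sub_ne_zero.2 hz.1
  have e : (z - a) ^ (-2 : ℤ) = ((z - a) ^ 2)⁻¹ := by
    rw [zpow_neg]
    rfl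
  simp only [Pi.add_apply, Pi.smul_apply, smul_eq_mul, zpow_neg_one, h z hz.2, h' z hz.2, e]
  field_simp
  ring

/-- A differential with a double zero at `∞` whose poles all lie off `I` contributes nothing. -/
theorem negResidueSum_kernel {I : Finset ℂ} {a q : ℂ} (ha : a ∉ I) (hq : q ∉ I) :
    NegResidueSum I (fun z => (a - z)⁻¹ * ((z - q) ^ 2)⁻¹) 0 ∧
      NegResidueSum I (fun z => (a - z)⁻¹ * (z - q)⁻¹) 0 := by
  have e : ∀ z : ℂ, (z - q) ^ (-2 : ℤ) = ((z - q) ^ 2)⁻¹ := fun z => by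
    rw [zpow_neg]
    rfl
  have e3 : ∀ z : ℂ, (z - q) ^ (-3 : ℤ) = ((z - q) ^ 3)⁻¹ := fun z => by
    rw [zpow_neg]
    rfl
  have fin : (insert a {q} : Set ℂ).Finite := (Set.finite_singleton q).insert a
  rcases eq_or_ne a q with rfl | haq
  · have h1 := (negResidueSum_sub_zpow I a (-3)).smul (-1)
    have h2 := (negResidueSum_sub_zpow I a (-2)).smul (-1)
    rw [if_neg (by simp), mul_zero] at h1 h2
    constructor
    · refine h1.congr fin fun z hz => ?_
      have hz1 : z - a ≠ 0 := sub_ne_zero.2 fun h => hz (Or.inl h)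
      have e' : a - z = -(z - a) := by ring
      simp only [Pi.smul_apply, smul_eq_mul, e3]
      rw [e']
      field_simp
    · refine h2.congr fin fun z hz => ?_
      have hz1 : z - a ≠ 0 := sub_ne_zero.2 fun h => hz (Or.inl h)
      have e' : a - z = -(z - a) := by ring
      simp only [Pi.smul_apply, smul_eq_mul, e]
      rw [e']
      field_simp
  · have hd : a - q ≠ 0 := sub_ne_zero.2 haq
    have h1 := (negResidueSum_sub_zpow I q (-2)).smul (a - q)⁻¹
    have h2 := (negResidueSum_sub_zpow I q (-1)).smul ((a - q) ^ 2)⁻¹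
    have h3 := (negResidueSum_sub_zpow I a (-1)).smul (-((a - q) ^ 2)⁻¹)
    have h4 := (negResidueSum_sub_zpow I q (-1)).smul (a - q)⁻¹
    have h5 := (negResidueSum_sub_zpow I a (-1)).smul (-(a - q)⁻¹)
    rw [if_neg (by simp), mul_zero] at h1
    rw [if_pos ⟨rfl, hq⟩] at h2 h4
    rw [if_pos ⟨rfl, ha⟩] at h3 h5
    have h6 := (h1.add h2).add h3
    have h7 := h4.add h5
    simp only [mul_one, zero_add, add_neg_cancel] at h6 h7
    constructor
    · refine h6.congr fin fun z hz => ?_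
      have hz1 : z - a ≠ 0 := sub_ne_zero.2 fun h => hz (Or.inl h)
      have hz2 : z - q ≠ 0 := sub_ne_zero.2 fun h => hz (Or.inr h)
      have hz3 : a - z ≠ 0 := sub_ne_zero.2 fun h => hz (Or.inl h.symm)
      simp only [Pi.add_apply, Pi.smul_apply, smul_eq_mul, e, zpow_neg_one]
      field_simp
      ring
    · refine h7.congr fin fun z hz => ?_
      have hz1 : z - a ≠ 0 := sub_ne_zero.2 fun h => hz (Or.inl h)
      have hz2 : z - q ≠ 0 := sub_ne_zero.2 fun h => hz (Or.inr h)
      have hz3 : a - z ≠ 0 := sub_ne_zero.2 fun h => hz (Or.inl h.symm)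
      simp only [Pi.add_apply, Pi.smul_apply, smul_eq_mul, zpow_neg_one]
      field_simp
      ring

/-! ### The algebra of corner-regular functions -/

/-- The generators of `CornerAlg`: the pair `(i, l)` stands for `1 / (1 - v i * v l)`, where `v i`
is the `i`-th variable and `v l` is `1` (`Sum.inl true`), `-1` (`Sum.inl false`) or a variable,
possibly `v i` itself. -/
abbrev Gen := ℕ × (Bool ⊕ ℕ)

/-- Polynomials in the symbols `1 / (1 - v i * v l)`. These functions have limits when
variables tend to `0` or to `∞` at different rates. -/
abbrev CornerAlg := MvPolynomial Gen ℂ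

open MvPolynomial (X)

/-- The value of the second entry of a generator: a sign or a variable. -/
def secondValue (v : ℕ → ℂ) : Bool ⊕ ℕ → ℂ := Sum.elim (fun s => if s then 1 else -1) v

/-- The denominator of a generator. -/
def den (v : ℕ → ℂ) (g : Gen) : ℂ := 1 - v g.1 * secondValue v g.2

/-- Evaluation of an element of `CornerAlg` at values `v` of the variables. -/
def ev (v : ℕ → ℂ) : CornerAlg →ₐ[ℂ] ℂ := MvPolynomial.aeval fun g => (den v g)⁻¹

/-- The variable `k` occurs in the generator `g`. -/
def Uses (g : Gen) (k : ℕ) : Prop := g.1 = k ∨ g.2 = Sum.inr k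

instance (g : Gen) (k : ℕ) : Decidable (Uses g k) := inferInstanceAs (Decidable (_ ∨ _))

/-- The exponent of the variable `k` in the monomial `v i * v l` of the generator `(i, l)`. -/
def mult (g : Gen) (k : ℕ) : ℕ := (if g.1 = k then 1 else 0) + (if g.2 = Sum.inr k then 1 else 0)

/-- The Euler derivation `v k * ∂ / ∂ v k`. -/
def euler (k : ℕ) : Derivation ℂ CornerAlg CornerAlg :=
  MvPolynomial.mkDerivation ℂ fun g => mult g k • (X g ^ 2 - X g)

/-- Substitution of the variable `a` for the variable `i`. -/
def subst (i a : ℕ) : CornerAlg →ₐ[ℂ] CornerAlg :=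
  MvPolynomial.rename (Prod.map (Function.update id i a) (Sum.map id (Function.update id i a)))

/-- The limit for the variable `i` tending to `0`. -/
def atZero (i : ℕ) : CornerAlg →ₐ[ℂ] CornerAlg :=
  MvPolynomial.aeval fun g => if Uses g i then 1 else X g

/-- The limit for the variable `i` tending to `∞`. -/
def atInfty (i : ℕ) : CornerAlg →ₐ[ℂ] CornerAlg :=
  MvPolynomial.aeval fun g => if Uses g i then 0 else X g

@[simp] theorem ev_X (v : ℕ → ℂ) (g : Gen) : ev v (X g) = (den v g)⁻¹ := by simp [ev]

@[simp] theorem euler_X (k : ℕ) (g : Gen) : euler k (X g) = mult g k • (X g ^ 2 - X g) := by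
  simp [euler, MvPolynomial.mkDerivation_X]

@[simp] theorem subst_X (i a : ℕ) (g : Gen) : subst i a (X g) =
    X (Function.update id i a g.1, Sum.map id (Function.update id i a) g.2) := by
  simp [subst, Prod.map]

@[simp] theorem atZero_X (i : ℕ) (g : Gen) :
    atZero i (X g) = if Uses g i then 1 else X g := by simp [atZero]

@[simp] theorem atInfty_X (i : ℕ) (g : Gen) :
    atInfty i (X g) = if Uses g i then 0 else X g := by simp [atInfty]

theorem mult_eq_zero {g : Gen} {k : ℕ} (h : ¬Uses g k) : mult g k = 0 := by
  unfold Uses at h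
  push Not at h
  simp [mult, h.1, h.2]

theorem euler_one (k : ℕ) : euler k 1 = 0 := (euler k).map_one_eq_zero

theorem euler_comm (j k : ℕ) (f : CornerAlg) : euler j (euler k f) = euler k (euler j f) := by
  have : ⁅euler j, euler k⁆ = 0 := by
    refine MvPolynomial.derivation_ext fun g => ?_
    simp only [Derivation.commutator_apply, euler_X, map_nsmul, map_sub, Derivation.leibniz_pow,
      Derivation.zero_apply]
    simp only [smul_eq_mul, nsmul_eq_mul]
    ring
  have h := congrArg (fun D => D f) this
  simpa [Derivation.commutator_apply, sub_eq_zero] using h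

/-- An algebra map that commutes with `euler j` on the generators commutes with it. -/
theorem euler_algHom (j : ℕ) (φ : CornerAlg →ₐ[ℂ] CornerAlg)
    (h : ∀ g, euler j (φ (X g)) = φ (euler j (X g))) (f : CornerAlg) :
    euler j (φ f) = φ (euler j f) := by
  induction f using MvPolynomial.induction_on with
  | C c =>
    have h1 : φ (MvPolynomial.C c) = algebraMap ℂ CornerAlg c := φ.commutes c
    have h2 : euler j (MvPolynomial.C c) = 0 := (euler j).map_algebraMap c
    rw [h1, h2, map_zero]
    exact (euler j).map_algebraMap c
  | add p q hp hq => simp only [map_add, hp, hq]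
  | mul_X p g hp => simp only [map_mul, Derivation.leibniz, hp, h, smul_eq_mul, map_add]

theorem euler_subst {i a j : ℕ} (hi : j ≠ i) (ha : j ≠ a) (f : CornerAlg) :
    euler j (subst i a f) = subst i a (euler j f) := by
  have key : ∀ u, Function.update id i a u = j ↔ u = j := by
    intro u
    rcases eq_or_ne u i with rfl | h
    · simp [hi.symm, ha.symm]
    · simp [Function.update_of_ne h]
  refine euler_algHom j _ (fun g => ?_) f
  obtain ⟨u, s | w⟩ := g <;> simp [mult, key, apply_ite (subst i a)]

theorem euler_atZero {i j : ℕ} (f : CornerAlg) :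
    euler j (atZero i f) = atZero i (euler j f) := by
  refine euler_algHom j _ (fun g => ?_) f
  by_cases h : Uses g i <;> simp [h]

theorem euler_atInfty {i j : ℕ} (f : CornerAlg) :
    euler j (atInfty i f) = atInfty i (euler j f) := by
  refine euler_algHom j _ (fun g => ?_) f
  by_cases h : Uses g i <;> simp [h]

theorem ev_subst (v : ℕ → ℂ) (i a : ℕ) (f : CornerAlg) :
    ev v (subst i a f) = ev (Function.update v i (v a)) f := by
  have : v ∘ Function.update id i a = Function.update v i (v a) := by
    rw [Function.comp_update]
    rfl
  rw [← this, subst, ev, ev, MvPolynomial.aeval_rename]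
  congr 2
  funext g
  obtain ⟨u, s | w⟩ := g <;> simp [den, secondValue]

/-! ### Subalgebras generated by some of the generators -/

/-- The polynomials in the generators from `s`. -/
def algOn (s : Set Gen) : Subalgebra ℂ CornerAlg := Algebra.adjoin ℂ (X '' s)

theorem algOn_univ (f : CornerAlg) : f ∈ algOn Set.univ := by
  rw [algOn, Set.image_univ, MvPolynomial.adjoin_range_X]
  exact Algebra.mem_top

/-- The elements of `CornerAlg` in which only variables from `L` occur. -/
def supp (L : Finset ℕ) : Subalgebra ℂ CornerAlg := algOn {g | ∀ k, Uses g k → k ∈ L}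

theorem supp_mono {L L' : Finset ℕ} (h : L ⊆ L') : supp L ≤ supp L' :=
  Algebra.adjoin_mono (Set.image_mono fun _ hg k hk => h (hg k hk))

theorem X_mem_supp {L : Finset ℕ} {g : Gen} (h : ∀ k, Uses g k → k ∈ L) : X g ∈ supp L :=
  Algebra.subset_adjoin ⟨g, h, rfl⟩

theorem X_pair_mem_supp {L : Finset ℕ} {i j : ℕ} (hi : i ∈ L) (hj : j ∈ L) :
    X (i, Sum.inr j) ∈ supp L := by
  refine X_mem_supp fun k hk => ?_
  rcases hk with h | h
  · exact h ▸ hi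
  · exact (Sum.inr.inj h) ▸ hj

theorem X_sign_mem_supp {L : Finset ℕ} {i : ℕ} (hi : i ∈ L) (s : Bool) :
    X (i, Sum.inl s) ∈ supp L := by
  refine X_mem_supp fun k hk => ?_
  rcases hk with h | h
  · exact h ▸ hi
  · exact absurd h (by simp)

theorem euler_mem_supp {L : Finset ℕ} (k : ℕ) {f : CornerAlg} (hf : f ∈ supp L) :
    euler k f ∈ supp L := by
  induction hf using Algebra.adjoin_induction with
  | mem f hf =>
    obtain ⟨g, hg, rfl⟩ := hf
    rw [euler_X]
    have := X_mem_supp hg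
    exact nsmul_mem (sub_mem (pow_mem this 2) this) _
  | algebraMap c => simp [(supp L).zero_mem]
  | add f g _ _ h1 h2 => rw [map_add]; exact add_mem h1 h2
  | mul f g hf hg h1 h2 =>
    rw [Derivation.leibniz]
    exact add_mem (mul_mem hf h2) (mul_mem hg h1)

theorem euler_eq_zero {L : Finset ℕ} {k : ℕ} (hk : k ∉ L) {f : CornerAlg} (hf : f ∈ supp L) :
    euler k f = 0 := by
  induction hf using Algebra.adjoin_induction with
  | mem f hf =>
    obtain ⟨g, hg, rfl⟩ := hf
    rw [euler_X, mult_eq_zero fun h => hk (hg k h), zero_smul]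
  | algebraMap c => simp
  | add f g _ _ h1 h2 => rw [map_add, h1, h2, add_zero]
  | mul f g _ _ h1 h2 => rw [Derivation.leibniz, h1, h2, smul_zero, smul_zero, add_zero]

theorem subst_mem_supp {L L' : Finset ℕ} {i a : ℕ} (ha : a ∈ L') (hL : ∀ k ∈ L, k ≠ i → k ∈ L')
    {f : CornerAlg} (hf : f ∈ supp L) : subst i a f ∈ supp L' := by
  have key : ∀ k ∈ L, Function.update id i a k ∈ L' := by
    intro k hk
    rcases eq_or_ne k i with rfl | h
    · simpa using ha
    · simpa [Function.update_of_ne h] using hL k hk h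
  induction hf using Algebra.adjoin_induction with
  | mem f hf =>
    obtain ⟨⟨u, s | w⟩, hg, rfl⟩ := hf
    · rw [subst_X]
      exact X_sign_mem_supp (key u (hg u (Or.inl rfl))) s
    · rw [subst_X]
      exact X_pair_mem_supp (key u (hg u (Or.inl rfl))) (key w (hg w (Or.inr rfl)))
  | algebraMap c => rw [AlgHom.commutes]; exact (supp L').algebraMap_mem c
  | add f g _ _ h1 h2 => rw [map_add]; exact add_mem h1 h2
  | mul f g _ _ h1 h2 => rw [map_mul]; exact mul_mem h1 h2

/-! ### Derivatives of evaluations -/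

/-- Products of two values of variables from `L` (possibly the same one) differ from `1`. -/
def Good (L : Finset ℕ) (v : ℕ → ℂ) : Prop := ∀ u ∈ L, ∀ w ∈ L, v u * v w ≠ 1

theorem Good.mono {L L' : Finset ℕ} {v : ℕ → ℂ} (h : Good L v) (hL : L' ⊆ L) : Good L' v :=
  fun u hu w hw => h u (hL hu) w (hL hw)

theorem Good.den_ne_zero {L : Finset ℕ} {v : ℕ → ℂ} (h : Good L v) {g : Gen}
    (hg : ∀ k, Uses g k → k ∈ L) : den v g ≠ 0 := by
  obtain ⟨u, s | w⟩ := g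
  · have h1 := h u (hg u (Or.inl rfl)) u (hg u (Or.inl rfl))
    intro h0
    apply h1
    cases s
    · have : v u = -1 := by
        simp only [den, secondValue, Sum.elim_inl, Bool.false_eq_true, if_false] at h0
        linear_combination h0
      rw [this]
      norm_num
    · have : v u = 1 := by
        simp only [den, secondValue, Sum.elim_inl, if_true] at h0
        linear_combination -h0
      rw [this]
      norm_num
  · exact sub_ne_zero.2 (h u (hg u (Or.inl rfl)) w (hg w (Or.inr rfl))).symm

theorem hasDerivAt_update_apply (v : ℕ → ℂ) (k u : ℕ) (t : ℂ) :
    HasDerivAt (fun t => Function.update v k t u) (if u = k then 1 else 0) t := by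
  rcases eq_or_ne u k with rfl | h
  · simpa using hasDerivAt_id' t
  · simpa [Function.update_of_ne h, h] using hasDerivAt_const t (v u)

/-- The Euler derivation computes derivatives of evaluations. -/
theorem hasDerivAt_ev {s : Set Gen} {v : ℕ → ℂ} (hs : ∀ g ∈ s, den v g ≠ 0) (k : ℕ)
    {f : CornerAlg} (hf : f ∈ algOn s) :
    ∃ c, HasDerivAt (fun t => ev (Function.update v k t) f) c (v k) ∧
      ev v (euler k f) = v k * c := by
  have e0 : Function.update v k (v k) = v := Function.update_eq_self k v
  induction hf using Algebra.adjoin_induction with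
  | mem f hf =>
    obtain ⟨g, hg, rfl⟩ := hf
    have h0 := hs g hg
    have h2 : HasDerivAt (fun t => secondValue (Function.update v k t) g.2)
        (if g.2 = Sum.inr k then 1 else 0) (v k) := by
      obtain ⟨u, s | w⟩ := g
      · simpa [secondValue] using hasDerivAt_const (v k) _
      · simpa [secondValue] using hasDerivAt_update_apply v k w (v k)
    have h3 := (((hasDerivAt_update_apply v k g.1 (v k)).mul h2).const_sub 1).inv
      (by simp only [Pi.mul_apply, e0]; exact h0)
    simp only [ev_X]
    refine ⟨_, h3, ?_⟩
    rw [euler_X]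
    simp only [Pi.mul_apply, e0, map_nsmul, map_sub, map_pow, ev_X]
    simp only [nsmul_eq_mul, mult]
    have h5 : (1 : ℂ) - v g.1 * secondValue v g.2 = den v g := rfl
    rw [h5]
    have h6 : (if g.1 = k then (1 : ℂ) else 0) * v g.1 = (if g.1 = k then (1 : ℂ) else 0) * v k := by
      split_ifs with h
      · rw [h]
      · simp
    have h7 : (if g.2 = Sum.inr k then (1 : ℂ) else 0) * secondValue v g.2 =
        (if g.2 = Sum.inr k then (1 : ℂ) else 0) * v k := by
      split_ifs with h
      · rw [h]
        rfl
      · simp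
    have h8 : (den v g)⁻¹ ^ 2 - (den v g)⁻¹ = v g.1 * secondValue v g.2 / den v g ^ 2 := by
      field_simp
      rw [← h5]
      ring
    rw [h8]
    push_cast
    field_simp
    linear_combination secondValue v g.2 * h6 + v g.1 * h7
  | algebraMap c =>
    refine ⟨0, ?_, by simp⟩
    simpa using hasDerivAt_const (v k) c
  | add f g _ _ h1 h2 =>
    obtain ⟨c, h1, h1'⟩ := h1
    obtain ⟨d, h2, h2'⟩ := h2
    refine ⟨c + d, ?_, ?_⟩
    · simp only [map_add]
      exact h1.add h2
    · rw [map_add, map_add, h1', h2']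
      ring
  | mul f g _ _ h1 h2 =>
    obtain ⟨c, h1, h1'⟩ := h1
    obtain ⟨d, h2, h2'⟩ := h2
    have h3 := h1.mul h2
    simp only [e0] at h3
    refine ⟨c * ev v g + ev v f * d, ?_, ?_⟩
    · simp only [map_mul]
      exact h3
    · rw [Derivation.leibniz, map_add, smul_eq_mul, smul_eq_mul, map_mul, map_mul, h1', h2']
      ring

theorem Good.hasDerivAt {L : Finset ℕ} {v : ℕ → ℂ} (h : Good L v) (k : ℕ)
    {f : CornerAlg} (hf : f ∈ supp L) :
    ∃ c, HasDerivAt (fun t => ev (Function.update v k t) f) c (v k) ∧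
      ev v (euler k f) = v k * c :=
  hasDerivAt_ev (fun _ hg => h.den_ne_zero hg) k hf

theorem Good.eventually {L : Finset ℕ} {v : ℕ → ℂ} (h : Good L v) (k : ℕ) :
    ∀ᶠ t in 𝓝 (v k), Good L (Function.update v k t) := by
  have e0 : Function.update v k (v k) = v := Function.update_eq_self k v
  unfold Good
  rw [Filter.eventually_all_finset]
  intro u hu
  rw [Filter.eventually_all_finset]
  intro w hw
  have hc := ((hasDerivAt_update_apply v k u (v k)).mul
    (hasDerivAt_update_apply v k w (v k))).continuousAt
  refine hc.eventually_ne ?_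
  simp only [Pi.mul_apply, e0]
  exact h u hu w hw

/-! ### Iterated Euler derivations -/

instance : LeftCommutative (fun (k : ℕ) (f : CornerAlg) => euler k f) := ⟨euler_comm⟩

/-- The composition of the Euler derivations for the labels in `M`. -/
def eulers (M : Multiset ℕ) (f : CornerAlg) : CornerAlg := M.foldr (fun k f => euler k f) f

@[simp] theorem eulers_zero (f : CornerAlg) : eulers 0 f = f := rfl

@[simp] theorem eulers_cons (k : ℕ) (M : Multiset ℕ) (f : CornerAlg) :
    eulers (k ::ₘ M) f = euler k (eulers M f) := Multiset.foldr_cons _ _ _ _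

theorem euler_eulers (k : ℕ) (M : Multiset ℕ) (f : CornerAlg) :
    euler k (eulers M f) = eulers M (euler k f) := by
  induction M using Multiset.induction_on with
  | empty => rfl
  | cons j M ih => rw [eulers_cons, eulers_cons, euler_comm, ih]

theorem eulers_add (M : Multiset ℕ) (f g : CornerAlg) :
    eulers M (f + g) = eulers M f + eulers M g := by
  induction M using Multiset.induction_on with
  | empty => rfl
  | cons j M ih => simp only [eulers_cons, ih, map_add]

theorem eulers_map_zero (M : Multiset ℕ) : eulers M 0 = 0 := by
  induction M using Multiset.induction_on with
  | empty => rfl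
  | cons j M ih => simp only [eulers_cons, ih, map_zero]

theorem eulers_sum {ι : Type*} (M : Multiset ℕ) (s : Finset ι) (f : ι → CornerAlg) :
    eulers M (∑ i ∈ s, f i) = ∑ i ∈ s, eulers M (f i) := by
  classical
  induction s using Finset.induction_on with
  | empty => simp [eulers_map_zero]
  | insert i s hi ih => rw [Finset.sum_insert hi, Finset.sum_insert hi, eulers_add, ih]

theorem eulers_mul (K M : Multiset ℕ) {f g : CornerAlg} (hf : ∀ k ∈ M, euler k f = 0)
    (hg : ∀ k ∈ K, euler k g = 0) : eulers (K + M) (f * g) = eulers K f * eulers M g := by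
  induction K using Multiset.induction_on with
  | empty =>
    rw [zero_add, eulers_zero]
    induction M using Multiset.induction_on with
    | empty => rfl
    | cons j M ih =>
      rw [eulers_cons, eulers_cons, ih fun k hk => hf k (Multiset.mem_cons_of_mem hk),
        Derivation.leibniz, hf j (Multiset.mem_cons_self j M), smul_zero, add_zero, smul_eq_mul]
  | cons j K ih =>
    rw [Multiset.cons_add, eulers_cons, eulers_cons, ih fun k hk => hg k (Multiset.mem_cons_of_mem hk),
      Derivation.leibniz, euler_eulers j M g, hg j (Multiset.mem_cons_self j K), eulers_map_zero,
      smul_zero, zero_add, smul_eq_mul, mul_comm]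

theorem eulers_mul_left (M : Multiset ℕ) {f g : CornerAlg} (hf : ∀ k ∈ M, euler k f = 0) :
    eulers M (f * g) = f * eulers M g := by
  simpa using eulers_mul 0 M (g := g) hf (by simp)

theorem eulers_algebraMap_mul (M : Multiset ℕ) (c : ℂ) (g : CornerAlg) :
    eulers M (algebraMap ℂ CornerAlg c * g) = algebraMap ℂ CornerAlg c * eulers M g :=
  eulers_mul_left M fun k _ => (euler k).map_algebraMap c

theorem eulers_neg (M : Multiset ℕ) (f : CornerAlg) : eulers M (-f) = -eulers M f := by
  have := eulers_algebraMap_mul M (-1) f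
  simpa using this

theorem eulers_sub (M : Multiset ℕ) (f g : CornerAlg) :
    eulers M (f - g) = eulers M f - eulers M g := by
  rw [sub_eq_add_neg, eulers_add, eulers_neg, ← sub_eq_add_neg]

theorem eulers_subst {i a : ℕ} (M : Multiset ℕ) (hi : i ∉ M) (ha : a ∉ M) (f : CornerAlg) :
    eulers M (subst i a f) = subst i a (eulers M f) := by
  induction M using Multiset.induction_on with
  | empty => rfl
  | cons j M ih =>
    rw [Multiset.mem_cons, not_or] at hi ha
    rw [eulers_cons, eulers_cons, ih hi.2 ha.2, euler_subst (Ne.symm hi.1) (Ne.symm ha.1)]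

theorem eulers_mem_supp {L : Finset ℕ} (M : Multiset ℕ) {f : CornerAlg} (hf : f ∈ supp L) :
    eulers M f ∈ supp L := by
  induction M using Multiset.induction_on with
  | empty => exact hf
  | cons j M ih => rw [eulers_cons]; exact euler_mem_supp j ih

/-! ### Corner values -/

/-- The order of growth of the second entry of a generator. -/
def secondOrder (r : ℕ → ℤ) : Bool ⊕ ℕ → ℤ := Sum.elim (fun _ => 0) r

/-- The limit for `v k = c k * t ^ r k`, `t → ∞`. If the monomial in the denominator of a generator
has order `0`, the order is read as slightly positive, so that the value of the generator is `0`. -/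
def corner (r : ℕ → ℤ) : CornerAlg →ₐ[ℂ] ℂ :=
  MvPolynomial.aeval fun g => if r g.1 + secondOrder r g.2 < 0 then 1 else 0

@[simp] theorem corner_X (r : ℕ → ℤ) (g : Gen) :
    corner r (X g) = if r g.1 + secondOrder r g.2 < 0 then 1 else 0 := by simp [corner]

/-- The elements of `CornerAlg` that vanish at all corners. The orders of growth are bounded so
that one more variable can always be made larger or smaller than all the others. -/
def cornerIdeal : Ideal CornerAlg :=
  ⨅ r : {r : ℕ → ℤ // ∃ N, ∀ k, |r k| < N}, RingHom.ker (corner r.1)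

theorem mem_cornerIdeal {f : CornerAlg} :
    f ∈ cornerIdeal ↔ ∀ r : ℕ → ℤ, (∃ N, ∀ k, |r k| < N) → corner r f = 0 := by
  simp [cornerIdeal, Submodule.mem_iInf, RingHom.mem_ker]

theorem sq_sub_mem_cornerIdeal (g : Gen) : X g ^ 2 - X g ∈ cornerIdeal := by
  rw [mem_cornerIdeal]
  intro r _
  rw [map_sub, map_pow, corner_X]
  split_ifs <;> simp

theorem corner_subst (r : ℕ → ℤ) (i a : ℕ) (f : CornerAlg) :
    corner r (subst i a f) = corner (Function.update r i (r a)) f := by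
  have : r ∘ Function.update id i a = Function.update r i (r a) := by
    rw [Function.comp_update]
    rfl
  rw [← this, subst, corner, corner, MvPolynomial.aeval_rename]
  congr 2
  funext g
  obtain ⟨u, s | w⟩ := g
  · simp [secondOrder]
  · simp [secondOrder]
    rfl

theorem corner_atZero {r : ℕ → ℤ} {N : ℤ} (hN : ∀ k, |r k| < N) (i : ℕ) (f : CornerAlg) :
    corner r (atZero i f) = corner (Function.update r i (-N)) f := by
  have : (corner r).comp (atZero i) = corner (Function.update r i (-N)) := by
    refine MvPolynomial.algHom_ext fun g => ?_
    have hN0 : 0 < N := (abs_nonneg _).trans_lt (hN 0)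
    obtain ⟨u, s | w⟩ := g
    · rcases eq_or_ne u i with rfl | h
      · simp [Uses, secondOrder, hN0]
      · simp [Uses, h, secondOrder]
    · have hu := abs_lt.1 (hN u)
      have hw := abs_lt.1 (hN w)
      rcases eq_or_ne u i with rfl | h
      · rcases eq_or_ne w u with rfl | h'
        · simp [Uses, secondOrder, hN0]
        · simp [Uses, secondOrder, h', hw.2]
      · rcases eq_or_ne w i with rfl | h'
        · simp [Uses, secondOrder, h, hu.2]
        · simp [Uses, h, h', secondOrder]
          rfl
  exact congrArg (fun φ => φ f) this

theorem corner_atInfty {r : ℕ → ℤ} {N : ℤ} (hN : ∀ k, |r k| < N) (i : ℕ) (f : CornerAlg) :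
    corner r (atInfty i f) = corner (Function.update r i N) f := by
  have : (corner r).comp (atInfty i) = corner (Function.update r i N) := by
    refine MvPolynomial.algHom_ext fun g => ?_
    have hN0 : 0 < N := (abs_nonneg _).trans_lt (hN 0)
    obtain ⟨u, s | w⟩ := g
    · rcases eq_or_ne u i with rfl | h
      · simp [Uses, secondOrder, hN0.le]
      · simp [Uses, h, secondOrder]
    · have hu := abs_lt.1 (hN u)
      have hw := abs_lt.1 (hN w)
      rcases eq_or_ne u i with rfl | h
      · rcases eq_or_ne w u with rfl | h'
        · simp [Uses, secondOrder, hN0.le]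
        · have : ¬N + r w < 0 := by omega
          simp [Uses, secondOrder, h', this]
      · rcases eq_or_ne w i with rfl | h'
        · have : ¬r u + N < 0 := by omega
          simp [Uses, secondOrder, h, this]
        · simp [Uses, h, h', secondOrder]
          rfl
  exact congrArg (fun φ => φ f) this

theorem bounded_update {r : ℕ → ℤ} (h : ∃ N, ∀ k, |r k| < N) (i : ℕ) (c : ℤ) :
    ∃ N, ∀ k, |Function.update r i c k| < N := by
  obtain ⟨N, hN⟩ := h
  refine ⟨max N (|c| + 1), fun k => ?_⟩
  rcases eq_or_ne k i with rfl | h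
  · simp
  · rw [Function.update_of_ne h]
    exact lt_max_of_lt_left (hN k)

theorem subst_mem_cornerIdeal (i a : ℕ) {f : CornerAlg} (hf : f ∈ cornerIdeal) :
    subst i a f ∈ cornerIdeal := by
  rw [mem_cornerIdeal] at hf ⊢
  intro r hr
  rw [corner_subst]
  exact hf _ (bounded_update hr _ _)

theorem atZero_mem_cornerIdeal (i : ℕ) {f : CornerAlg} (hf : f ∈ cornerIdeal) :
    atZero i f ∈ cornerIdeal := by
  rw [mem_cornerIdeal] at hf ⊢
  intro r hr
  obtain ⟨N, hN⟩ := hr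
  rw [corner_atZero hN]
  exact hf _ (bounded_update ⟨N, hN⟩ _ _)

theorem atInfty_mem_cornerIdeal (i : ℕ) {f : CornerAlg} (hf : f ∈ cornerIdeal) :
    atInfty i f ∈ cornerIdeal := by
  rw [mem_cornerIdeal] at hf ⊢
  intro r hr
  obtain ⟨N, hN⟩ := hr
  rw [corner_atInfty hN]
  exact hf _ (bounded_update ⟨N, hN⟩ _ _)

/-! ### Divided differences -/

/-- `d` represents `v a * (f(v a) - f(v i)) / (v a - v i)`, where `f` is regarded as a function of
the variable `i`. -/
def IsDividedDiff (L : Finset ℕ) (i a : ℕ) (f d : CornerAlg) : Prop :=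
  ∀ v, Good L v → v a * (ev v (subst i a f) - ev v f) = (v a - v i) * ev v d

/-- Divided differences exist in `CornerAlg`. At a corner where `v i` dominates `v a` they vanish;
at the other corners they are differences of corner values. -/
theorem exists_dividedDiff {L : Finset ℕ} {i a : ℕ} (hia : i ≠ a) (hi : i ∈ L) (ha : a ∈ L)
    {f : CornerAlg} (hf : f ∈ supp L) :
    ∃ d ∈ supp L, IsDividedDiff L i a f d ∧
      ∀ r, corner r d = if r i ≤ r a then corner r (subst i a f) - corner r f else 0 := by
  have hmul : ∀ f g d e : CornerAlg, f ∈ supp L → g ∈ supp L →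
      (d ∈ supp L ∧ IsDividedDiff L i a f d ∧
        ∀ r, corner r d = if r i ≤ r a then corner r (subst i a f) - corner r f else 0) →
      (e ∈ supp L ∧ IsDividedDiff L i a g e ∧
        ∀ r, corner r e = if r i ≤ r a then corner r (subst i a g) - corner r g else 0) →
      ∃ d ∈ supp L, IsDividedDiff L i a (f * g) d ∧
      ∀ r, corner r d =
        if r i ≤ r a then corner r (subst i a (f * g)) - corner r (f * g) else 0 := by
    rintro f g d e hf hg ⟨hd, h1, h1'⟩ ⟨he, h2, h2'⟩
    refine ⟨subst i a f * e + d * g, add_mem (mul_mem ?_ he) (mul_mem hd hg), fun v hv => ?_,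
      fun r => ?_⟩
    · exact subst_mem_supp ha (fun k hk _ => hk) hf
    · simp only [map_add, map_mul]
      linear_combination ev v (subst i a f) * h2 v hv + ev v g * h1 v hv
    · simp only [map_add, map_mul, h1', h2']
      split_ifs <;> ring
  -- A generator `1 / (1 - v i * v l)` with `l ≠ i`.
  have hgen : ∀ l : Bool ⊕ ℕ, l ≠ Sum.inr i → X (a, l) ∈ supp L → X (i, l) ∈ supp L →
      (∀ v, Good L v → den v (a, l) ≠ 0 ∧ den v (i, l) ≠ 0) → subst i a (X (i, l)) = X (a, l) →
      ∃ d ∈ supp L, IsDividedDiff L i a (X (i, l)) d ∧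
      ∀ r, corner r d =
        if r i ≤ r a then corner r (subst i a (X (i, l))) - corner r (X (i, l)) else 0 := by
    intro l hl hal hil hden hsub
    refine ⟨(X (a, l) - 1) * X (i, l), mul_mem (sub_mem hal (supp L).one_mem) hil,
      fun v hv => ?_, fun r => ?_⟩
    · obtain ⟨h1, h2⟩ := hden v hv
      rw [hsub]
      simp only [map_mul, map_sub, map_one, ev_X]
      field_simp
      simp only [den]
      ring
    · rw [hsub]
      simp only [map_mul, map_sub, map_one, corner_X]
      split_ifs <;> first | (exfalso; omega) | simp
  have hsign : ∀ s : Bool, ∃ d ∈ supp L, IsDividedDiff L i a (X (i, Sum.inl s)) d ∧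
      ∀ r, corner r d = if r i ≤ r a then
        corner r (subst i a (X (i, Sum.inl s))) - corner r (X (i, Sum.inl s)) else 0 := by
    intro s
    refine hgen _ (by simp) (X_sign_mem_supp ha s) (X_sign_mem_supp hi s) (fun v hv => ⟨?_, ?_⟩)
      (by simp)
    · refine hv.den_ne_zero fun k hk => ?_
      rcases hk with h | h
      · exact h ▸ ha
      · simp at h
    · refine hv.den_ne_zero fun k hk => ?_
      rcases hk with h | h
      · exact h ▸ hi
      · simp at h
  have hconst : ∀ f : CornerAlg, subst i a f = f →
      ∃ d ∈ supp L, IsDividedDiff L i a f d ∧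
      ∀ r, corner r d = if r i ≤ r a then corner r (subst i a f) - corner r f else 0 :=
    fun f h => ⟨0, (supp L).zero_mem, fun v _ => by simp [h], fun r => by simp [h]⟩
  have hpair : ∀ w ∈ L, w ≠ i → ∃ d ∈ supp L, IsDividedDiff L i a (X (i, Sum.inr w)) d ∧
      ∀ r, corner r d = if r i ≤ r a then
        corner r (subst i a (X (i, Sum.inr w))) - corner r (X (i, Sum.inr w)) else 0 := by
    intro w hw hwi
    exact hgen _ (by simpa using hwi) (X_pair_mem_supp ha hw) (X_pair_mem_supp hi hw)
      (fun v hv => ⟨sub_ne_zero.2 (hv a ha w hw).symm, sub_ne_zero.2 (hv i hi w hw).symm⟩)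
      (by simp [hwi])
  -- Different elements of `CornerAlg` may define the same function; a divided difference depends
  -- only on the function and on the corner values.
  have htrans : ∀ f g : CornerAlg, (∀ v, Good L v → ev v f = ev v g) →
      (∀ v, Good L v → ev v (subst i a f) = ev v (subst i a g)) →
      (∀ r, corner r f = corner r g) →
      (∃ d ∈ supp L, IsDividedDiff L i a f d ∧
        ∀ r, corner r d = if r i ≤ r a then corner r (subst i a f) - corner r f else 0) →
      ∃ d ∈ supp L, IsDividedDiff L i a g d ∧
        ∀ r, corner r d = if r i ≤ r a then corner r (subst i a g) - corner r g else 0 := by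
    rintro f g h1 h2 h3 ⟨d, hd, h4, h5⟩
    refine ⟨d, hd, fun v hv => ?_, fun r => ?_⟩
    · rw [← h1 v hv, ← h2 v hv]
      exact h4 v hv
    · rw [h5, corner_subst, corner_subst, h3, h3]
  -- `1 / (1 - v u ^ 2)` is not linear fractional in `v u`, but a product of two such functions.
  have hprod : ∀ v, ∀ u ∈ L, Good L v → (den v (u, Sum.inl true))⁻¹ * (den v (u, Sum.inl false))⁻¹ =
      (den v (u, Sum.inr u))⁻¹ := by
    intro v u _ _
    rw [← mul_inv]
    congr 1
    simp only [den, secondValue, Sum.elim_inl, Sum.elim_inr, if_true, Bool.false_eq_true, if_false]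
    ring
  induction hf using Algebra.adjoin_induction with
  | mem f hf =>
    obtain ⟨⟨u, l⟩, hg, rfl⟩ := hf
    have hu : u ∈ L := hg u (Or.inl rfl)
    rcases eq_or_ne u i with rfl | hui
    · obtain s | w := l
      · exact hsign s
      · rcases eq_or_ne w u with rfl | hw
        · refine htrans (X (w, Sum.inl true) * X (w, Sum.inl false)) _ (fun v hv => ?_)
            (fun v hv => ?_) (fun r => ?_) ?_
          · simp only [map_mul, ev_X]
            exact hprod v w hi hv
          · simp only [map_mul, subst_X, ev_X, Function.update_self, Sum.map_inl, Sum.map_inr, id]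
            exact hprod v a ha hv
          · have : r w + r w < 0 ↔ r w < 0 := by omega
            simp only [map_mul, corner_X, secondOrder, Sum.elim_inl, Sum.elim_inr, add_zero, this]
            split_ifs <;> simp
          · obtain ⟨d, hd⟩ := hsign true
            obtain ⟨e, he⟩ := hsign false
            exact hmul _ _ d e (X_sign_mem_supp hi _) (X_sign_mem_supp hi _) hd he
        · exact hpair w (hg w (Or.inr rfl)) hw
    · obtain s | w := l
      · exact hconst _ (by simp [hui])
      · rcases eq_or_ne w i with rfl | hw
        · refine htrans (X (w, Sum.inr u)) _ (fun v _ => ?_) (fun v _ => ?_) (fun r => ?_)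
            (hpair u hu hui)
          · simp [den, secondValue, mul_comm]
          · simp [hui, den, secondValue, mul_comm]
          · simp only [corner_X, secondOrder, Sum.elim_inr, add_comm]
            rfl
        · exact hconst _ (by simp [hui, hw])
  | algebraMap c => exact hconst _ (by rw [AlgHom.commutes])
  | add f g _ _ h1 h2 =>
    obtain ⟨d, hd, h1, h1'⟩ := h1
    obtain ⟨e, he, h2, h2'⟩ := h2
    refine ⟨d + e, add_mem hd he, fun v hv => ?_, fun r => ?_⟩
    · simp only [map_add]
      linear_combination h1 v hv + h2 v hv
    · simp only [map_add, h1', h2']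
      split_ifs <;> ring
  | mul f g hf hg h1 h2 =>
    obtain ⟨d, hd⟩ := h1
    obtain ⟨e, he⟩ := h2
    exact hmul f g d e hf hg hd he

theorem IsDividedDiff.euler {L : Finset ℕ} {i a j : ℕ} {f d : CornerAlg} (hf : f ∈ supp L)
    (hd : d ∈ supp L) (ha : a ∈ L) (h : IsDividedDiff L i a f d) (hji : j ≠ i) (hja : j ≠ a) :
    IsDividedDiff L i a (euler j f) (euler j d) := by
  intro v hv
  obtain ⟨c1, h1, h1'⟩ := hv.hasDerivAt j hf
  obtain ⟨c2, h2, h2'⟩ := hv.hasDerivAt j hd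
  obtain ⟨c3, h3, h3'⟩ := hv.hasDerivAt j (subst_mem_supp (L' := L) (i := i) ha (fun k hk _ => hk) hf)
  have h4 : HasDerivAt (fun t => v a * (ev (Function.update v j t) (subst i a f) -
      ev (Function.update v j t) f)) (v a * (c3 - c1)) (v j) := (h3.sub h1).const_mul _
  have h5 := h2.const_mul (v a - v i)
  have h6 : (fun t => v a * (ev (Function.update v j t) (subst i a f) -
      ev (Function.update v j t) f)) =ᶠ[𝓝 (v j)]
      fun t => (v a - v i) * ev (Function.update v j t) d := by
    filter_upwards [hv.eventually j] with t ht
    have := h _ ht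
    rwa [Function.update_of_ne hja.symm, Function.update_of_ne hji.symm] at this
  have h7 := h4.unique (h5.congr_of_eventuallyEq h6)
  rw [← euler_subst hji hja, h1', h2', h3']
  linear_combination v j * h7

theorem IsDividedDiff.eulers {L : Finset ℕ} {i a : ℕ} {f d : CornerAlg} (hf : f ∈ supp L)
    (hd : d ∈ supp L) (ha : a ∈ L) (h : IsDividedDiff L i a f d) (M : Multiset ℕ) (hi : i ∉ M)
    (haM : a ∉ M) : IsDividedDiff L i a (eulers M f) (eulers M d) := by
  induction M using Multiset.induction_on with
  | empty => exact h
  | cons j M ih =>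
    rw [Multiset.mem_cons, not_or] at hi haM
    rw [eulers_cons, eulers_cons]
    exact (ih hi.2 haM.2).euler (eulers_mem_supp M hf) (eulers_mem_supp M hd) ha (Ne.symm hi.1)
      (Ne.symm haM.1)

/-! ### Curves in symbolic form -/

/-- What the argument uses of the curve: `1 / (2 y dx)` and `ω_{1/2,1}`, in terms of the
logarithmic coordinate of `z`, are given by elements of `CornerAlg`, the former vanishing at all
corners. -/
structure SymbolicCurve (S : SpectralCurve) (Q μ : ℂ) where
  /-- The scale of the coordinate `x`. -/
  c : ℂ
  c_ne_zero : c ≠ 0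
  deriv_x : ∀ p : ℂ, p ≠ 0 → deriv S.x p = c * (1 - (p ^ 2)⁻¹)
  x_sub : ∀ p q : ℂ, p ≠ 0 → q ≠ 0 → S.x p - S.x q = c * ((p - q) * (1 - (p * q)⁻¹))
  /-- `1 / (2 ω_{0,1})` as a multiple of `(dz / z)⁻¹`. -/
  kernel : ℂ → ℂ
  kernel_eq : ∀ p : ℂ, p ≠ 0 → p ^ 2 ≠ 1 → (2 * omega01 S p)⁻¹ = p * kernel p
  /-- `1 / (2 ω_{0,1})` as a multiple of `(dz)⁻¹`, divided by `z ^ 2`. -/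
  kernelDiv : ℂ → ℂ
  kernelDiv_mem : kernelDiv ∈ ratFun {1, -1}
  kernel_eq_mul : ∀ p, kernel p = p * kernelDiv p
  /-- The symbol of `kernel` in the given variable. -/
  sym : ℕ → CornerAlg
  sym_mem_supp : ∀ a, sym a ∈ supp {a}
  sym_mem_cornerIdeal : ∀ a, sym a ∈ cornerIdeal
  ev_sym : ∀ v a, ev v (sym a) = kernel (v a)
  /-- The symbol of `ω_{1/2,1}` in the given variable. -/
  half : ℕ → CornerAlg
  half_mem_supp : ∀ a, half a ∈ supp {a}
  ev_half : ∀ v a, v a ≠ 0 → v a ^ 2 ≠ 1 → ev v (half a) = v a * omegaHalf S Q μ (v a)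
  corner_half : ∀ (r r' : ℕ → ℤ) a, r a < 0 → 0 < r' a →
    corner r (half a) + corner r' (half a) = -(Q * μ)
  omega01_odd : ∀ p : ℂ, p ≠ 0 → p ^ 2 ≠ 1 → omega01 S (σ p) * deriv σ p = -omega01 S p

theorem den_sign (v : ℕ → ℂ) (a : ℕ) (s : Bool) :
    den v (a, Sum.inl s) = 1 - v a * (if s then 1 else -1) := rfl

theorem den_pair (v : ℕ → ℂ) (a b : ℕ) : den v (a, Sum.inr b) = 1 - v a * v b := rfl

theorem deriv_σ {p : ℂ} : deriv σ p = -(p ^ 2)⁻¹ := by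
  have : σ = fun z => z⁻¹ := rfl
  rw [this, deriv_inv]

theorem ne_of_sq_ne_one {p : ℂ} (h : p ^ 2 ≠ 1) : 1 - p ≠ 0 ∧ 1 + p ≠ 0 := by
  constructor <;> intro h0 <;> apply h
  · linear_combination -(1 + p) * h0
  · linear_combination (p - 1) * h0

theorem corner_pair (r : ℕ → ℤ) (a b : ℕ) :
    corner r (X (a, Sum.inr b)) = if r a + r b < 0 then 1 else 0 := by
  rw [corner_X]
  rfl

theorem corner_sign (r : ℕ → ℤ) (a : ℕ) (s : Bool) :
    corner r (X (a, Sum.inl s)) = if r a < 0 then 1 else 0 := by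
  have : r a + 0 < 0 ↔ r a < 0 := by rw [add_zero]
  rw [corner_X, ← ite_cond_congr this.eq]
  rfl

/-- The Weber curve in symbolic form. -/
def symbolicWeber {s : ℂ} (hs : s ≠ 0) (Q μ : ℂ) : SymbolicCurve (weber s) Q μ := by
  have hx : ∀ z : ℂ, z ≠ 0 → deriv (weber s).x z = s * (1 - (z ^ 2)⁻¹) := fun z h => by
    have := (((hasDerivAt_id z).add (hasDerivAt_inv h)).const_mul s).deriv
    rw [sub_eq_add_neg]
    exact this
  have hy : ∀ z : ℂ, z ≠ 0 → deriv (weber s).y z = s / 2 * (1 + (z ^ 2)⁻¹) := fun z h => by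
    have := (((hasDerivAt_id z).sub (hasDerivAt_inv h)).const_mul (s / 2)).deriv
    rw [sub_neg_eq_add] at this
    exact this
  exact
  { c := s
    c_ne_zero := hs
    deriv_x := hx
    x_sub := fun p q hp hq => by
      simp only [weber]
      field_simp
      ring
    kernel := fun p => (s ^ 2)⁻¹ * ((1 - p * p)⁻¹ ^ 2 - (1 - p * p)⁻¹)
    kernel_eq := fun p hp hp1 => by
      have h1 : 1 - p * p ≠ 0 := fun h => hp1 (by linear_combination -h)
      have h2 : p ^ 2 - 1 ≠ 0 := sub_ne_zero.2 hp1
      rw [omega01, hx p hp]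
      simp only [weber]
      have e1 : 2 * (s / 2 * (p - p⁻¹) * (s * (1 - (p ^ 2)⁻¹))) =
          s ^ 2 * (1 - p * p) ^ 2 / p ^ 3 := by
        field_simp
        ring
      rw [e1]
      field_simp
      ring
    kernelDiv := fun p => (s ^ 2)⁻¹ * (p * ((1 - p * 1)⁻¹ * (1 - p * (-1))⁻¹) ^ 2)
    kernelDiv_mem := by
      refine (ratFun _).mul_mem (const_mem_ratFun _ _) ((ratFun _).mul_mem (id_mem_ratFun _)
        ((ratFun _).pow_mem ((ratFun _).mul_mem ?_ ?_) 2))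
      · exact one_sub_mul_inv_mem_ratFun (u := 1) (by simp)
      · exact one_sub_mul_inv_mem_ratFun (u := -1) (by simp)
    kernel_eq_mul := fun p => by
      have h : (1 - p * p)⁻¹ = (1 - p * 1)⁻¹ * (1 - p * (-1))⁻¹ := by
        rw [← mul_inv]
        congr 1
        ring
      by_cases h1 : 1 - p * p = 0
      · rw [← h, h1]
        simp
      · rw [← h]
        field_simp
        ring
    sym := fun a => algebraMap ℂ _ (s ^ 2)⁻¹ * (X (a, Sum.inr a) ^ 2 - X (a, Sum.inr a))
    sym_mem_supp := fun a => by
      have := X_pair_mem_supp (Finset.mem_singleton_self a) (Finset.mem_singleton_self a)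
      exact mul_mem ((supp _).algebraMap_mem _) (sub_mem (pow_mem this 2) this)
    sym_mem_cornerIdeal := fun a => Ideal.mul_mem_left _ _ (sq_sub_mem_cornerIdeal _)
    ev_sym := fun v a => by
      rw [map_mul, AlgHom.commutes, map_sub, map_pow, ev_X, den_pair]
      rfl
    half := fun a => algebraMap ℂ _ (Q / 2) * (2 * X (a, Sum.inr a) - algebraMap ℂ _ (1 + μ))
    half_mem_supp := fun a => by
      have := X_pair_mem_supp (Finset.mem_singleton_self a) (Finset.mem_singleton_self a)
      have h2 : (2 : CornerAlg) ∈ supp {a} := by exact_mod_cast natCast_mem (supp {a}) 2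
      exact mul_mem ((supp _).algebraMap_mem _)
        (sub_mem (mul_mem h2 this) ((supp _).algebraMap_mem _))
    ev_half := fun v a hp hp1 => by
      rw [map_mul, AlgHom.commutes, map_sub, map_mul, map_ofNat, ev_X, den_pair, AlgHom.commutes,
        omegaHalf, hy _ hp]
      generalize v a = p at *
      have h1 : 1 - p * p ≠ 0 := fun h => hp1 (by linear_combination -h)
      have e1 : s / 2 * (1 + (p ^ 2)⁻¹) / (weber s).y p = -(p ^ 2 + 1) / (p * (1 - p * p)) := by
        have h2 : p ^ 2 - 1 ≠ 0 := sub_ne_zero.2 hp1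
        have h3 : (weber s).y p = -(s / 2 * (1 - p * p) / p) := by
          simp only [weber]
          field_simp
          ring
        rw [h3]
        field_simp
      rw [e1]
      simp only [etaInfty, bergmanPrimitive, sub_zero, Algebra.algebraMap_self, RingHom.id_apply]
      field_simp
      ring
    corner_half := fun r r' a h h' => by
      simp only [map_mul, map_sub, AlgHom.commutes, corner_pair, map_ofNat,
        Algebra.algebraMap_self, RingHom.id_apply]
      rw [if_pos (by omega), if_neg (by omega)]
      ring
    omega01_odd := fun p hp hp1 => by
      have hσ : σ p ≠ 0 := inv_ne_zero hp
      rw [deriv_σ, omega01, omega01, hx _ hσ, hx _ hp, (weber_σ s p).2]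
      simp only [σ]
      field_simp
      ring }

/-- The Whittaker curve in symbolic form. -/
def symbolicWhittaker {m : ℂ} (hm : m ≠ 0) (Q μ : ℂ) : SymbolicCurve (whittaker m) Q μ := by
  have hx : ∀ z : ℂ, z ≠ 0 → deriv (whittaker m).x z = m * (1 - (z ^ 2)⁻¹) := fun z h => by
    have := ((((hasDerivAt_id z).sub_const 2).add (hasDerivAt_inv h)).const_mul m).deriv
    rw [sub_eq_add_neg]
    exact this
  have hy : ∀ z : ℂ, 1 - z ≠ 0 → deriv (whittaker m).y z = ((1 - z) ^ 2)⁻¹ := fun z h => by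
    have h1 : 2 * (z - 1) ≠ 0 := fun h0 => h (by linear_combination -(1 / 2) * h0)
    have := ((((hasDerivAt_id z).add_const 1).neg).div
      (((hasDerivAt_id z).sub_const 1).const_mul 2) h1).deriv
    refine this.trans ?_
    have h2 : z - 1 ≠ 0 := fun h0 => h (by linear_combination -h0)
    have e : (1 - z) ^ 2 = (z - 1) ^ 2 := by ring
    simp only [id]
    rw [e]
    field_simp
    change -(z - 1) - -(z + 1) = 2
    ring
  exact
  { c := m
    c_ne_zero := hm
    deriv_x := hx
    x_sub := fun p q hp hq => by
      simp only [whittaker]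
      field_simp
      ring
    kernel := fun p => m⁻¹ * ((1 - p * -1)⁻¹ ^ 2 - (1 - p * -1)⁻¹)
    kernel_eq := fun p hp hp1 => by
      obtain ⟨h1, h2⟩ := ne_of_sq_ne_one hp1
      have h3 : p - 1 ≠ 0 := fun h0 => h1 (by linear_combination -h0)
      have h4 : 1 - p * -1 ≠ 0 := fun h0 => h2 (by linear_combination h0)
      rw [omega01, hx p hp]
      simp only [whittaker]
      have e1 : 2 * (-(p + 1) / (2 * (p - 1)) * (m * (1 - (p ^ 2)⁻¹))) =
          -(m * (1 - p * -1) ^ 2 / p ^ 2) := by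
        field_simp
        ring
      rw [e1]
      field_simp
      ring
    kernelDiv := fun p => -m⁻¹ * (1 - p * -1)⁻¹ ^ 2
    kernelDiv_mem := (ratFun _).mul_mem (const_mem_ratFun _ _)
      ((ratFun _).pow_mem (one_sub_mul_inv_mem_ratFun (u := -1) (by simp)) 2)
    kernel_eq_mul := fun p => by
      by_cases h1 : 1 - p * -1 = 0
      · rw [h1]
        simp
      · field_simp
        ring
    sym := fun a => algebraMap ℂ _ m⁻¹ * (X (a, Sum.inl false) ^ 2 - X (a, Sum.inl false))
    sym_mem_supp := fun a => by
      have := X_sign_mem_supp (Finset.mem_singleton_self a) false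
      exact mul_mem ((supp _).algebraMap_mem _) (sub_mem (pow_mem this 2) this)
    sym_mem_cornerIdeal := fun a => Ideal.mul_mem_left _ _ (sq_sub_mem_cornerIdeal _)
    ev_sym := fun v a => by
      rw [map_mul, AlgHom.commutes, map_sub, map_pow, ev_X, den_sign]
      rfl
    half := fun a => algebraMap ℂ _ (Q / 2) *
      (X (a, Sum.inl false) - X (a, Sum.inl true) - algebraMap ℂ _ μ)
    half_mem_supp := fun a => mul_mem ((supp _).algebraMap_mem _)
      (sub_mem (sub_mem (X_sign_mem_supp (Finset.mem_singleton_self a) false)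
        (X_sign_mem_supp (Finset.mem_singleton_self a) true)) ((supp _).algebraMap_mem _))
    ev_half := fun v a hp hp1 => by
      obtain ⟨h1, h2⟩ := ne_of_sq_ne_one hp1
      rw [map_mul, AlgHom.commutes, map_sub, map_sub, ev_X, ev_X, den_sign, den_sign,
        AlgHom.commutes, omegaHalf, hy _ h1]
      generalize v a = p at *
      have h3 : p - 1 ≠ 0 := fun h0 => h1 (by linear_combination -h0)
      have h4 : p + 1 ≠ 0 := fun h0 => h2 (by linear_combination h0)
      simp only [Bool.false_eq_true, if_false, if_true, mul_one, mul_neg, sub_neg_eq_add,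
        etaInfty, bergmanPrimitive, sub_zero, Algebra.algebraMap_self, RingHom.id_apply]
      have e1 : ((1 - p) ^ 2)⁻¹ / (whittaker m).y p = 2 / ((1 - p) * (1 + p)) := by
        have h5 : (whittaker m).y p = (1 + p) / (2 * (1 - p)) := by
          simp only [whittaker]
          field_simp
          ring
        rw [h5]
        field_simp
      rw [e1]
      field_simp
      ring
    corner_half := fun r r' a _ _ => by
      simp only [map_mul, map_sub, AlgHom.commutes, corner_sign,
        Algebra.algebraMap_self, RingHom.id_apply]
      ring
    omega01_odd := fun p hp hp1 => by
      have hσ : σ p ≠ 0 := inv_ne_zero hp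
      rw [deriv_σ, omega01, omega01, hx _ hσ, hx _ hp, (whittaker_σ m p hp).2]
      simp only [σ]
      field_simp
      ring }

/-! ### The sum of residues in the recursion -/

theorem ev_congr {L : Finset ℕ} {v w : ℕ → ℂ} (h : ∀ k ∈ L, v k = w k) {f : CornerAlg}
    (hf : f ∈ supp L) : ev v f = ev w f := by
  induction hf using Algebra.adjoin_induction with
  | mem f hf =>
    obtain ⟨⟨u, s | t⟩, hg, rfl⟩ := hf
    · rw [ev_X, ev_X, den_sign, den_sign, h u (hg u (Or.inl rfl))]
    · rw [ev_X, ev_X, den_pair, den_pair, h u (hg u (Or.inl rfl)), h t (hg t (Or.inr rfl))]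
  | algebraMap c => rw [AlgHom.commutes, AlgHom.commutes]
  | add f g _ _ h1 h2 => rw [map_add, map_add, h1, h2]
  | mul f g _ _ h1 h2 => rw [map_mul, map_mul, h1, h2]

/-- As a function of one variable, an element of `CornerAlg` is rational with poles at `± 1` and
at the inverses of the other variables. -/
theorem ev_mem_ratFun {L : Finset ℕ} {v : ℕ → ℂ} {a : ℕ} {S : Set ℂ} (h1 : 1 ∈ S) (h2 : -1 ∈ S)
    (h3 : ∀ k ∈ L, k ≠ a → (v k)⁻¹ ∈ S) {f : CornerAlg} (hf : f ∈ supp L) :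
    (fun p => ev (Function.update v a p) f) ∈ ratFun S := by
  have hs : ∀ s : Bool, (fun p : ℂ => (1 - p * (if s then 1 else -1))⁻¹) ∈ ratFun S := by
    rintro (_ | _)
    · exact one_sub_mul_inv_mem_ratFun (u := -1) (by simpa using h2)
    · exact one_sub_mul_inv_mem_ratFun (u := 1) (by simpa using h1)
  induction hf using Algebra.adjoin_induction with
  | mem f hf =>
    obtain ⟨⟨u, s | t⟩, hg, rfl⟩ := hf
    · simp only [ev_X, den_sign]
      rcases eq_or_ne u a with rfl | hu
      · simpa only [Function.update_self] using hs s
      · simp only [Function.update_of_ne hu]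
        exact const_mem_ratFun _ _
    · simp only [ev_X, den_pair]
      rcases eq_or_ne u a with rfl | hu <;> rcases eq_or_ne t u with rfl | ht
      · have := (ratFun S).mul_mem (hs true) (hs false)
        convert this using 1
        funext p
        simp only [Pi.mul_apply, Function.update_self, if_true, Bool.false_eq_true, if_false]
        rw [← mul_inv]
        congr 1
        ring
      · simp only [Function.update_self, Function.update_of_ne ht]
        exact one_sub_mul_inv_mem_ratFun fun _ => h3 t (hg t (Or.inr rfl)) ht
      · simp only [Function.update_of_ne hu]
        exact const_mem_ratFun _ _
      · rcases eq_or_ne t a with rfl | hta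
        · simp only [Function.update_self, Function.update_of_ne hu, mul_comm]
          have := one_sub_mul_inv_mem_ratFun (u := v u) (S := S)
            fun _ => h3 u (hg u (Or.inl rfl)) hu
          simpa only [mul_comm] using this
        · simp only [Function.update_of_ne hu, Function.update_of_ne hta]
          exact const_mem_ratFun _ _
  | algebraMap c =>
    simp only [AlgHom.commutes]
    exact const_mem_ratFun _ _
  | add f g _ _ h1 h2 =>
    simp only [map_add]
    exact (ratFun S).add_mem h1 h2
  | mul f g _ _ h1 h2 =>
    simp only [map_mul]
    exact (ratFun S).mul_mem h1 h2

/-- The residue calculus of one recursion step. The factor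
`1 / (p₀ - p) - p / (p₀ p - 1)` is `η_p(p₀)`, and `1 / (p - q) ^ 2 - 1 / (p q - 1) ^ 2` comes from
`dx(p) dx(q) / (x(p) - x(q)) ^ 2`. The points `p₀` and `q i` are allowed to coincide: the polar
part of the second factor at `q i` does not contribute to the term with `1 / (p₀ - p)`. -/
theorem negResidueSum_step {I : Finset ℂ} {p₀ : ℂ} (hp₀ : p₀ ∉ I) (hp₀' : p₀⁻¹ ∈ I)
    (M : Finset ℕ) {q : ℕ → ℂ} (hq : ∀ i ∈ M, q i ∉ I) (hq' : ∀ i ∈ M, (q i)⁻¹ ∈ I)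
    {g : ℂ → ℂ} (hg : g ∈ ratFun (I : Set ℂ)) {h k l : ℕ → ℂ → ℂ}
    (hh : ∀ i ∈ M, h i ∈ ratFun (I : Set ℂ)) (hl : ∀ i ∈ M, l i ∈ ratFun (I : Set ℂ))
    (hk : ∀ i ∈ M, ∀ z ∉ I, h i z = h i (q i) + (z - q i) * k i z)
    (hl' : ∀ i ∈ M, ∀ z ∉ I, k i z = k i (q i) + (z - q i) * l i z) :
    NegResidueSum I (fun p => ((p₀ - p)⁻¹ - p * (p₀ * p - 1)⁻¹) * (g p +
        ∑ i ∈ M, h i p * (((p - q i) ^ 2)⁻¹ - ((p * q i - 1) ^ 2)⁻¹)))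
      (-g p₀ + ∑ i ∈ M, (-l i p₀ - deriv (fun p => p * (p₀ * p - 1)⁻¹ * h i p) (q i) +
        h i p₀ * ((p₀ * q i - 1) ^ 2)⁻¹)) := by
  have hI : I.Nonempty := ⟨_, hp₀'⟩
  have hK : ∀ u : ℂ, u⁻¹ ∈ I → (fun p => (p * u - 1)⁻¹) ∈ ratFun (I : Set ℂ) := by
    intro u hu
    have := (ratFun (I : Set ℂ)).neg_mem (one_sub_mul_inv_mem_ratFun (S := (I : Set ℂ)) (u := u)
      fun _ => by simpa using hu)
    convert this using 1
    funext p
    simp only [Pi.neg_apply, neg_inv, neg_sub]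
  have hK₀ : (fun p => p * (p₀ * p - 1)⁻¹) ∈ ratFun (I : Set ℂ) := by
    have := (ratFun (I : Set ℂ)).mul_mem (id_mem_ratFun _) (hK p₀ hp₀')
    convert this using 1
    funext p
    simp only [Pi.mul_apply, mul_comm p₀ p]
  have h1 := negResidueSum_div_sub hI hg hp₀
  have h2 := (negResidueSum_of_mem_ratFun hI ((ratFun _).mul_mem hK₀ hg)).smul (-1)
  have h3 := fun i (hi : i ∈ M) => by
    have hqi : (fun p => ((p * q i - 1) ^ 2)⁻¹) ∈ ratFun (I : Set ℂ) := by
      have := (ratFun (I : Set ℂ)).pow_mem (hK (q i) (hq' i hi)) 2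
      convert this using 1
      funext p
      simp only [Pi.pow_apply, inv_pow]
    have a1 := negResidueSum_div_sub hI (hl i hi) hp₀
    obtain ⟨a2, a3⟩ := negResidueSum_kernel hp₀ (hq i hi)
    have a4 := (negResidueSum_div_sub_sq hI ((ratFun _).mul_mem hK₀ (hh i hi)) (hq i hi)).smul (-1)
    have a5 := (negResidueSum_div_sub hI ((ratFun _).mul_mem (hh i hi) hqi) hp₀).smul (-1)
    have a6 := negResidueSum_of_mem_ratFun hI
      ((ratFun _).mul_mem ((ratFun _).mul_mem hK₀ (hh i hi)) hqi)
    exact ((((a1.add (a2.smul (h i (q i)))).add (a3.smul (k i (q i)))).add a4).add a5).add a6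
  have h4 := (h1.add h2).add (NegResidueSum.sum M h3)
  have e : ∀ {f : ℂ → ℂ} {a b : ℂ}, a = b → NegResidueSum I f a → NegResidueSum I f b := by
    rintro f a b rfl h
    exact h
  refine e ?_ (h4.congr (s := (I : Set ℂ) ∪ (insert p₀ (M.image q : Finset ℂ)))
    (I.finite_toSet.union ((Finset.finite_toSet _).insert p₀)) fun z hz => ?_)
  · simp only [mul_zero, add_zero, Pi.mul_apply]
    congr 1
    refine Finset.sum_congr rfl fun i _ => ?_
    have : (fun p => p * (p₀ * p - 1)⁻¹ * h i p) = (fun p => p * (p₀ * p - 1)⁻¹) * h i := rfl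
    rw [this]
    ring
  · rw [Set.mem_union, Set.mem_insert_iff, not_or, not_or] at hz
    obtain ⟨hz1, hz2, hz3⟩ := hz
    have hz1 : z ∉ I := by simpa using hz1
    simp only [Pi.add_apply, Pi.smul_apply, Pi.mul_apply, smul_eq_mul, Finset.sum_apply]
    rw [mul_add, Finset.mul_sum]
    congr 1
    · ring
    · refine Finset.sum_congr rfl fun i hi => ?_
      have hzq : z - q i ≠ 0 := sub_ne_zero.2 fun h => hz3 (by
        rw [h]
        exact Finset.mem_coe.2 (Finset.mem_image_of_mem q hi))
      have b1 : ((z - q i) ^ 2)⁻¹ * h i z =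
          l i z + h i (q i) * ((z - q i) ^ 2)⁻¹ + k i (q i) * (z - q i)⁻¹ := by
        rw [hk i hi z hz1, hl' i hi z hz1]
        field_simp
        ring
      linear_combination -(p₀ - z)⁻¹ * b1

/-- The Euler derivative of a divided difference is a second divided difference, also on the
diagonal. -/
theorem IsDividedDiff.ev_euler {L L' : Finset ℕ} {i a : ℕ} (hia : i ≠ a) {f d : CornerAlg}
    (hd : d ∈ supp L) (hf : f ∈ supp L') (ha : a ∉ L') (h : IsDividedDiff L i a f d)
    {v : ℕ → ℂ} (hv : Good L v) {k : ℂ} {l : ℂ → ℂ}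
    (hk : HasDerivAt (fun t => ev (Function.update v i t) f) k (v i))
    (hl : ∀ᶠ p in 𝓝 (v a), ev (Function.update v i p) f = ev v f +
      (p - v i) * (k + (p - v i) * l p))
    (hlc : ContinuousAt l (v a)) :
    ev v (RefinedTR.euler i d) = v i * (v a * l (v a)) := by
  have e0 : Function.update v a (v a) = v := Function.update_eq_self a v
  have hdep : ∀ p t, ev (Function.update (Function.update v a p) i t) f =
      ev (Function.update v i t) f := fun p t => by
    rw [Function.update_comm hia.symm]
    refine ev_congr (fun j hj => ?_) hf
    rw [Function.update_of_ne]
    rintro rfl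
    exact ha hj
  have hdep' : ∀ p, ev (Function.update v a p) f = ev v f := fun p => by
    refine ev_congr (fun j hj => ?_) hf
    rw [Function.update_of_ne]
    rintro rfl
    exact ha hj
  have hoff : ∀ᶠ p in 𝓝[≠] (v i), p ≠ v i := self_mem_nhdsWithin
  -- Off the diagonal the difference quotient can be differentiated directly.
  have key : ∀ p, Good L (Function.update v a p) → p ≠ v i →
      ev (Function.update v i p) f = ev v f + (p - v i) * (k + (p - v i) * l p) →
      ev (Function.update v a p) (RefinedTR.euler i d) = v i * (p * l p) := by
    intro p hp hpi hlp
    have e1 : Function.update v a p i = v i := Function.update_of_ne hia _ _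
    have e2 : Function.update v a p a = p := Function.update_self _ _ _
    obtain ⟨c, h1, h2⟩ := hp.hasDerivAt i hd
    rw [h2, e1]
    rw [e1] at h1
    congr 1
    have h4 : HasDerivAt (fun t => (p - t) *
        ev (Function.update (Function.update v a p) i t) d) _ (v i) :=
      ((hasDerivAt_id (v i)).const_sub p).mul h1
    have h5 : HasDerivAt (fun t => p * (ev (Function.update v i p) f -
        ev (Function.update v i t) f)) _ (v i) := (hk.const_sub _).const_mul p
    have h6 : (fun t => p * (ev (Function.update v i p) f - ev (Function.update v i t) f)) =ᶠ[𝓝 (v i)]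
        fun t => (p - t) * ev (Function.update (Function.update v a p) i t) d := by
      have := hp.eventually i
      rw [e1] at this
      filter_upwards [this] with t ht
      have h7 := h _ ht
      rw [ev_subst, Function.update_self, Function.update_of_ne hia.symm, e2,
        Function.update_idem, hdep, hdep] at h7
      exact h7
    have h7 := h5.unique (h4.congr_of_eventuallyEq h6)
    have h8 := h6.self_of_nhds
    simp only [Function.update_eq_self] at h8
    have h9 : Function.update (Function.update v a p) i (v i) = Function.update v a p := by
      rw [← e1, Function.update_eq_self]
    rw [h9] at h7 h8
    have hpi' : p - v i ≠ 0 := sub_ne_zero.2 hpi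
    rw [hlp] at h8
    have h10 : ev (Function.update v a p) d = p * (k + (p - v i) * l p) := by
      apply mul_left_cancel₀ hpi'
      linear_combination -h8
    simp only [id] at h7
    rw [h10] at h7
    apply mul_left_cancel₀ hpi'
    linear_combination -h7
  by_cases hdiag : v a = v i
  · obtain ⟨c, h1, -⟩ := hv.hasDerivAt a (euler_mem_supp i hd)
    have c2 : ContinuousAt (fun p => v i * (p * l p)) (v a) :=
      continuousAt_const.mul (continuousAt_id.mul hlc)
    have h3 : (fun p => ev (Function.update v a p) (RefinedTR.euler i d)) =ᶠ[𝓝[≠] (v a)]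
        fun p => v i * (p * l p) := by
      filter_upwards [nhdsWithin_le_nhds (hv.eventually a), nhdsWithin_le_nhds hl,
        self_mem_nhdsWithin] with p hp1 hp2 hp3
      exact key p hp1 (hdiag ▸ hp3) hp2
    have h4 := ((h1.continuousAt.eventuallyEq_nhds_iff_eventuallyEq_nhdsNE c2).1 h3).self_of_nhds
    simpa only [e0] using h4
  · have := key (v a) (by rwa [e0]) hdiag hl.self_of_nhds
    rwa [e0] at this

/-! ### Symbols of the multidifferentials -/

/-- `P` is a symbol of `ω_{h/2,n+1}` in the variables `a` and `M`: the multidifferential is the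
derivative of `P` with respect to all variables from `M`. Derivatives and differentials are taken
with respect to logarithms of the coordinates. The values of the variables in `M` have to be
distinct, but the variable `a` may coincide with one of them. -/
def Represents (S : SpectralCurve) (Q μ : ℂ) (h a : ℕ) (M : Finset ℕ) (P : CornerAlg) : Prop :=
  P ∈ supp (insert a M) ∧ ∀ v, Good (insert a M) v → (∀ k ∈ insert a M, v k ≠ 0) →
    Set.InjOn v M →
    v a * (∏ k ∈ M, v k) * omega S Q μ h (v a) (M.val.map v) = ev v (eulers M.val P)

theorem sum_antidiagonal_map (M : Finset ℕ) (v : ℕ → ℂ) (F : Multiset ℂ × Multiset ℂ → ℂ) :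
    ((M.val.map v).antidiagonal.map F).sum =
      ∑ K ∈ M.powerset, F (K.val.map v, (M \ K).val.map v) := by
  induction M using Finset.induction_on generalizing F with
  | empty => simp
  | insert i M hi ih =>
    rw [Finset.insert_val_of_notMem hi, Multiset.map_cons, Multiset.antidiagonal_cons,
      Multiset.map_add, Multiset.sum_add, Multiset.map_map, Multiset.map_map, ih, ih,
      Finset.sum_powerset_insert hi]
    congr 1
    · refine Finset.sum_congr rfl fun K hK => ?_
      have hK := Finset.mem_powerset.1 hK
      have h1 : insert i M \ K = insert i (M \ K) :=
        Finset.insert_sdiff_of_notMem _ fun h => hi (hK h)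
      have h2 : i ∉ M \ K := fun h => hi (Finset.mem_sdiff.1 h).1
      rw [h1, Finset.insert_val_of_notMem h2, Multiset.map_cons]
      rfl
    · refine Finset.sum_congr rfl fun K hK => ?_
      have hK := Finset.mem_powerset.1 hK
      have h1 : insert i M \ insert i K = M \ K := by
        ext k
        simp only [Finset.mem_sdiff, Finset.mem_insert]
        constructor
        · rintro ⟨h, h'⟩
          exact ⟨h.resolve_left fun h0 => h' (Or.inl h0), fun h0 => h' (Or.inr h0)⟩
        · rintro ⟨h, h'⟩
          exact ⟨Or.inr h, fun h0 => h0.elim (fun e => hi (e ▸ h)) h'⟩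
      have h2 : i ∉ K := fun h => hi (hK h)
      rw [h1, Finset.insert_val_of_notMem h2, Multiset.map_cons]
      rfl

section Step

variable {S : SpectralCurve} {Q μ : ℂ} {a : ℕ} {M : Finset ℕ}

/-- The quadratic terms of the recursion. -/
theorem Represents.mul {h₁ h₂ : ℕ} {P₁ P₂ : CornerAlg} {K : Finset ℕ} (ha : a ∉ M) (hK : K ⊆ M)
    (H₁ : Represents S Q μ h₁ a K P₁) (H₂ : Represents S Q μ h₂ a (M \ K) P₂) {v : ℕ → ℂ}
    (hv : Good (insert a M) v) (hv0 : ∀ k ∈ insert a M, v k ≠ 0) (hinj : Set.InjOn v M) :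
    ev v (eulers M.val (P₁ * P₂)) = v a ^ 2 * (∏ k ∈ M, v k) *
      (omega S Q μ h₁ (v a) (K.val.map v) * omega S Q μ h₂ (v a) ((M \ K).val.map v)) := by
  have hM : K.val + (M \ K).val = M.val := by
    rw [Finset.sdiff_val, add_tsub_cancel_of_le (Finset.val_le_iff.2 hK)]
  have s1 : insert a K ⊆ insert a M := Finset.insert_subset_insert _ hK
  have s2 : insert a (M \ K) ⊆ insert a M := Finset.insert_subset_insert _ Finset.sdiff_subset
  rw [← hM, eulers_mul, map_mul, ← H₁.2 v (hv.mono s1) (fun k hk => hv0 k (s1 hk))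
    (hinj.mono (Finset.coe_subset.2 hK)), ← H₂.2 v (hv.mono s2) (fun k hk => hv0 k (s2 hk))
    (hinj.mono (Finset.coe_subset.2 Finset.sdiff_subset)), ← Finset.prod_sdiff hK]
  · ring
  · intro k hk
    have hk := Finset.mem_sdiff.1 hk
    refine euler_eq_zero (fun h => ?_) H₁.1
    rcases Finset.mem_insert.1 h with rfl | h
    · exact ha hk.1
    · exact hk.2 h
  · intro k hk
    refine euler_eq_zero (fun h => ?_) H₂.1
    rcases Finset.mem_insert.1 h with rfl | h
    · exact ha (hK hk)
    · exact (Finset.mem_sdiff.1 h).2 hk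

/-- The term `ω_{g-1,n+2}(p, p, J)` of the recursion: the derivative in the additional variable `c`
is taken before `c` is identified with `a`. -/
theorem Represents.diag {h c : ℕ} {P : CornerAlg} (ha : a ∉ M) (hc : c ∉ insert a M)
    (H : Represents S Q μ h a (insert c M) P) {v : ℕ → ℂ}
    (hv : Good (insert a M) v) (hv0 : ∀ k ∈ insert a M, v k ≠ 0)
    (hinj : Set.InjOn v (insert a M : Finset ℕ)) :
    ev v (eulers M.val (subst c a (euler c P))) = v a ^ 2 * (∏ k ∈ M, v k) *
      omega S Q μ h (v a) (v a ::ₘ M.val.map v) := by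
  have hcM : c ∉ M := fun h => hc (Finset.mem_insert_of_mem h)
  have hca : a ≠ c := fun h => hc (h ▸ Finset.mem_insert_self _ _)
  set w := Function.update v c (v a) with hw
  have wa : w a = v a := Function.update_of_ne hca _ _
  have wc : w c = v a := Function.update_self _ _ _
  have wM : ∀ k ∈ M, w k = v k := fun k hk =>
    Function.update_of_ne (by rintro rfl; exact hcM hk) _ _
  -- All values of `w` are values of `v` at labels from `insert a M`.
  have hval : ∀ k ∈ insert a (insert c M), ∃ j ∈ insert a M, w k = v j := by
    intro k hk
    rcases Finset.mem_insert.1 hk with rfl | hk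
    · exact ⟨k, Finset.mem_insert_self _ _, wa⟩
    · rcases Finset.mem_insert.1 hk with rfl | hk
      · exact ⟨a, Finset.mem_insert_self _ _, wc⟩
      · exact ⟨k, Finset.mem_insert_of_mem hk, wM k hk⟩
  have h1 : Good (insert a (insert c M)) w := by
    intro k hk j hj
    obtain ⟨k', hk', e⟩ := hval k hk
    obtain ⟨j', hj', e'⟩ := hval j hj
    rw [e, e']
    exact hv k' hk' j' hj'
  have h2 : ∀ k ∈ insert a (insert c M), w k ≠ 0 := by
    intro k hk
    obtain ⟨k', hk', e⟩ := hval k hk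
    rw [e]
    exact hv0 k' hk'
  have hne : ∀ k ∈ M, v k ≠ v a := fun k hk h => by
    have := hinj (Finset.mem_coe.2 (Finset.mem_insert_of_mem hk))
      (Finset.mem_coe.2 (Finset.mem_insert_self a M)) h
    exact ha (this ▸ hk)
  have h3 : Set.InjOn w (insert c M : Finset ℕ) := by
    intro k hk j hj e
    rcases Finset.mem_insert.1 (Finset.mem_coe.1 hk) with rfl | hk' <;>
      rcases Finset.mem_insert.1 (Finset.mem_coe.1 hj) with rfl | hj'
    · rfl
    · rw [wc, wM j hj'] at e
      exact absurd e.symm (hne j hj')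
    · rw [wc, wM k hk'] at e
      exact absurd e (hne k hk')
    · rw [wM k hk', wM j hj'] at e
      exact hinj (Finset.mem_coe.2 (Finset.mem_insert_of_mem hk'))
        (Finset.mem_coe.2 (Finset.mem_insert_of_mem hj')) e
  have h4 := H.2 w h1 h2 h3
  rw [Finset.insert_val_of_notMem hcM, Multiset.map_cons, wa, wc, Finset.prod_insert hcM, wc,
    Finset.prod_congr rfl wM, Multiset.map_congr rfl fun k hk => wM k hk,
    eulers_cons, euler_eulers] at h4
  rw [eulers_subst _ hcM ha,
    ev_subst, ← hw, ← h4]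
  ring

/-- The term `dx d(ω / dx)` of the recursion. The derivative of the logarithm of `dx / (dz / z)`
accounts for the multiple of `P`. -/
theorem Represents.derivTerm {h : ℕ} {P : CornerAlg} (C : SymbolicCurve S Q μ) (ha : a ∉ M)
    (H : Represents S Q μ h a M P) {v : ℕ → ℂ}
    (hv : Good (insert a M) v) (hv0 : ∀ k ∈ insert a M, v k ≠ 0) (hinj : Set.InjOn v M) :
    ev v (eulers M.val (euler a P - (1 - 2 * X (a, Sum.inr a)) * P)) =
      v a ^ 2 * (∏ k ∈ M, v k) * (deriv S.x (v a) *
        deriv (fun q => omega S Q μ h q (M.val.map v) / deriv S.x q) (v a)) := by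
  have hamem : a ∈ insert a M := Finset.mem_insert_self a M
  have hp0 : v a ≠ 0 := hv0 a hamem
  have hp1 : v a * v a ≠ 1 := hv a hamem a hamem
  have hprod : ∏ k ∈ M, v k ≠ 0 :=
    Finset.prod_ne_zero_iff.2 fun k hk => hv0 k (Finset.mem_insert_of_mem hk)
  obtain ⟨c, h1, h2⟩ := hv.hasDerivAt a (eulers_mem_supp M.val H.1)
  have hupd : ∀ t, ∀ k ∈ M, Function.update v a t k = v k := fun t k hk =>
    Function.update_of_ne (by rintro rfl; exact ha hk) _ _
  have h3 : (fun q => omega S Q μ h q (M.val.map v) / deriv S.x q) =ᶠ[𝓝 (v a)]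
      fun t => ev (Function.update v a t) (eulers M.val P) *
        ((∏ k ∈ M, v k) * (C.c * (t - t⁻¹)))⁻¹ := by
    filter_upwards [hv.eventually a, eventually_ne_nhds hp0] with t ht ht0
    have h4 := H.2 _ ht (fun k hk => by
      rcases eq_or_ne k a with rfl | hk'
      · rwa [Function.update_self]
      · rw [Function.update_of_ne hk']
        exact hv0 k hk) (fun k hk j hj e => by
      rw [hupd t k hk, hupd t j hj] at e
      exact hinj hk hj e)
    rw [Function.update_self, Finset.prod_congr rfl (hupd t),
      Multiset.map_congr rfl (hupd t)] at h4
    rw [← h4, C.deriv_x t ht0]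
    have ht1 : t * t ≠ 1 := by
      have := ht a hamem a hamem
      rwa [Function.update_self] at this
    have ht2 : t ^ 2 - 1 ≠ 0 := fun h0 => ht1 (by linear_combination h0)
    have ec := C.c_ne_zero
    have e1 : t - t⁻¹ = (t ^ 2 - 1) / t := by field_simp
    have e2 : 1 - (t ^ 2)⁻¹ = (t ^ 2 - 1) / t ^ 2 := by field_simp
    rw [e1, e2]
    field_simp
  have hp2 : (v a) ^ 2 - 1 ≠ 0 := fun h0 => hp1 (by linear_combination h0)
  have ec := C.c_ne_zero
  have e1 : v a - (v a)⁻¹ = ((v a) ^ 2 - 1) / v a := by field_simp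
  have h5 := ((((hasDerivAt_id (v a)).sub (hasDerivAt_inv hp0)).const_mul C.c).const_mul
    (∏ k ∈ M, v k)).inv (by
      change (∏ k ∈ M, v k) * (C.c * (v a - (v a)⁻¹)) ≠ 0
      rw [e1]
      exact mul_ne_zero hprod (mul_ne_zero ec (div_ne_zero hp2 hp0)))
  have h6 := (h1.mul h5).deriv
  have h7 : ∀ k ∈ M.val, euler k (1 - 2 * X (a, Sum.inr a) : CornerAlg) = 0 := by
    intro k hk
    have hX := X_pair_mem_supp (Finset.mem_singleton_self a) (Finset.mem_singleton_self a)
    have h2 : (2 : CornerAlg) ∈ supp {a} := by exact_mod_cast natCast_mem (supp {a}) 2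
    refine euler_eq_zero (L := {a}) (fun h => ha ?_) (sub_mem (supp _).one_mem (mul_mem h2 hX))
    exact (Finset.mem_singleton.1 h) ▸ hk
  rw [eulers_sub, ← euler_eulers, eulers_mul_left _ h7, map_sub, h2, map_mul, map_sub, map_one,
    map_mul, map_ofNat, ev_X, den_pair, h3.deriv_eq]
  refine Eq.trans ?_ (congrArg (fun z => v a ^ 2 * (∏ k ∈ M, v k) * (deriv S.x (v a) * z)) h6.symm)
  rw [C.deriv_x _ hp0]
  simp only [Function.update_eq_self]
  change _ = v a ^ 2 * (∏ k ∈ M, v k) * (C.c * (1 - (v a ^ 2)⁻¹) *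
    (c * ((∏ k ∈ M, v k) * (C.c * (v a - (v a)⁻¹)))⁻¹ + ev v (eulers M.val P) *
      (-((∏ k ∈ M, v k) * (C.c * (1 - -(v a ^ 2)⁻¹))) /
        ((∏ k ∈ M, v k) * (C.c * (v a - (v a)⁻¹))) ^ 2)))
  rw [e1]
  generalize ev v (eulers M.val P) = w
  generalize ∏ k ∈ M, v k = π at *
  generalize v a = p at *
  have e3 : 1 - p * p = -(p ^ 2 - 1) := by ring
  have e4 : 1 - (p ^ 2)⁻¹ = (p ^ 2 - 1) / p ^ 2 := by field_simp
  rw [e3, e4, inv_neg]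
  field_simp
  ring

/-- The symbol of the part of `Rec` without the terms with `1 / (x(p) - x(q)) ^ 2`; the variable
`c` is auxiliary. -/
def inhomSymbol (P : ℕ → ℕ → Finset ℕ → CornerAlg) (Q : ℂ) (h a c : ℕ) (M : Finset ℕ) :
    CornerAlg :=
  ∑ h₁ ∈ Finset.range (h + 1), ∑ K ∈ M.powerset,
      (if (h₁ = 0 ∧ K = ∅) ∨ (h₁ = h ∧ M \ K = ∅) then 0 else P h₁ a K * P (h - h₁) a (M \ K))
    + (if 2 ≤ h then subst c a (euler c (P (h - 2) a (insert c M))) else 0)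
    + (if 1 ≤ h then algebraMap ℂ _ Q *
        (euler a (P (h - 1) a M) - (1 - 2 * X (a, Sum.inr a)) * P (h - 1) a M) else 0)

/-- The family `P` consists of symbols below the level of `(h, M)`. -/
def RepresentsBelow (S : SpectralCurve) (Q μ : ℂ) (h : ℕ) (M : Finset ℕ)
    (P : ℕ → ℕ → Finset ℕ → CornerAlg) : Prop :=
  ∀ h' a' M', h' + M'.card < h + M.card → (h' ≠ 0 ∨ M' ≠ ∅) → a' ∉ M' →
    Represents S Q μ h' a' M' (P h' a' M')

variable {P : ℕ → ℕ → Finset ℕ → CornerAlg} {h c : ℕ}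

theorem quad_lt {K : Finset ℕ} {h₁ : ℕ} (hK : K ⊆ M) (hh : h₁ ≤ h)
    (hne : ¬((h₁ = 0 ∧ K = ∅) ∨ (h₁ = h ∧ M \ K = ∅))) :
    (h₁ + K.card < h + M.card ∧ (h₁ ≠ 0 ∨ K ≠ ∅)) ∧
      (h - h₁) + (M \ K).card < h + M.card ∧ (h - h₁ ≠ 0 ∨ M \ K ≠ ∅) := by
  push Not at hne
  have hc := Finset.card_sdiff_add_card_eq_card hK
  have h1 : h₁ ≠ 0 ∨ K ≠ ∅ := by
    by_cases h0 : h₁ = 0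
    · exact Or.inr (hne.1 h0).ne_empty
    · exact Or.inl h0
  have h2 : h - h₁ ≠ 0 ∨ M \ K ≠ ∅ := by
    by_cases h0 : h₁ = h
    · exact Or.inr (hne.2 h0).ne_empty
    · exact Or.inl (by omega)
  have h1' : 0 < h₁ + K.card := by
    rcases h1 with h | h
    · omega
    · have := Finset.card_pos.2 (Finset.nonempty_iff_ne_empty.2 h)
      omega
  have h2' : 0 < h - h₁ + (M \ K).card := by
    rcases h2 with h | h
    · omega
    · have := Finset.card_pos.2 (Finset.nonempty_iff_ne_empty.2 h)
      omega
  exact ⟨⟨by omega, h1⟩, by omega, h2⟩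

theorem inhomSymbol_mem_supp (HP : RepresentsBelow S Q μ h M P) (ha : a ∉ M)
    (hc : c ∉ insert a M) (hh : 2 ≤ h + M.card) : inhomSymbol P Q h a c M ∈ supp (insert a M) := by
  have hcM : c ∉ M := fun h => hc (Finset.mem_insert_of_mem h)
  have hac : a ∉ insert c M := by
    rw [Finset.mem_insert, not_or]
    exact ⟨fun h => hc (h ▸ Finset.mem_insert_self _ _), ha⟩
  refine add_mem (add_mem (sum_mem fun h₁ hh₁ => sum_mem fun K hK => ?_) ?_) ?_
  · have hK := Finset.mem_powerset.1 hK
    split_ifs with hif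
    · exact (supp _).zero_mem
    · obtain ⟨h1, h2⟩ := quad_lt hK (Nat.lt_succ_iff.1 (Finset.mem_range.1 hh₁)) hif
      exact mul_mem
        (supp_mono (Finset.insert_subset_insert _ hK) (HP _ _ _ h1.1 h1.2 fun h => ha (hK h)).1)
        (supp_mono (Finset.insert_subset_insert _ Finset.sdiff_subset)
          (HP _ _ _ h2.1 h2.2 fun h => ha (Finset.mem_sdiff.1 h).1).1)
  · split_ifs with hif
    · refine subst_mem_supp (L := insert a (insert c M)) (Finset.mem_insert_self a M)
        (fun k hk hkc => ?_) (euler_mem_supp c (HP _ _ _ ?_ (Or.inr (Finset.insert_ne_empty _ _))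
          hac).1)
      · rcases Finset.mem_insert.1 hk with rfl | hk
        · exact Finset.mem_insert_self _ _
        · exact Finset.mem_insert_of_mem ((Finset.mem_insert.1 hk).resolve_left hkc)
      · rw [Finset.card_insert_of_notMem hcM]
        omega
    · exact (supp _).zero_mem
  · split_ifs with hif
    · have hP : P (h - 1) a M ∈ supp (insert a M) := by
        refine (HP _ _ _ (by omega) ?_ ha).1
        by_cases hM : M = ∅
        · left
          rw [hM, Finset.card_empty] at hh
          omega
        · exact Or.inr hM
      have hX := X_pair_mem_supp (Finset.mem_insert_self a M) (Finset.mem_insert_self a M)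
      have h2 : (2 : CornerAlg) ∈ supp (insert a M) := by
        exact_mod_cast natCast_mem (supp (insert a M)) 2
      exact mul_mem ((supp _).algebraMap_mem _) (sub_mem (euler_mem_supp a hP)
        (mul_mem (sub_mem (supp _).one_mem (mul_mem h2 hX)) hP))
    · exact (supp _).zero_mem

/-- The expression `Rec / (2 ω_{0,1})` at pairwise distinct points, in terms of symbols. -/
theorem recTerm_eq (C : SymbolicCurve S Q μ) (HP : RepresentsBelow S Q μ h M P) (ha : a ∉ M)
    (hc : c ∉ insert a M) (hh : 2 ≤ h + M.card) {v : ℕ → ℂ} (hv : Good (insert a M) v)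
    (hv0 : ∀ k ∈ insert a M, v k ≠ 0) (hinj : Set.InjOn v (insert a M : Finset ℕ)) :
    (∏ k ∈ M, v k) * ((2 * omega01 S (v a))⁻¹ *
      recTerm S Q (omega S Q μ) h (v a) (M.val.map v)) =
      C.kernelDiv (v a) * ev v (eulers M.val (inhomSymbol P Q h a c M)) +
      ∑ i ∈ M, v i * (C.kernel (v a) * ev (Function.update v i (v a))
        (eulers (M.erase i).val (P h i (M.erase i)))) *
        (((v a - v i) ^ 2)⁻¹ - ((v a * v i - 1) ^ 2)⁻¹) := by
  have hamem : a ∈ insert a M := Finset.mem_insert_self a M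
  have hp0 : v a ≠ 0 := hv0 a hamem
  have hp1 : v a ^ 2 ≠ 1 := by
    rw [sq]
    exact hv a hamem a hamem
  have hinj' : Set.InjOn v M := hinj.mono (Finset.coe_subset.2 (Finset.subset_insert a M))
  have hcM : c ∉ M := fun h => hc (Finset.mem_insert_of_mem h)
  have hac : a ∉ insert c M := by
    rw [Finset.mem_insert, not_or]
    exact ⟨fun h => hc (h ▸ hamem), ha⟩
  have hmem := fun k (hk : k ∈ M) => Finset.mem_insert_of_mem (a := k) (b := a) hk
  -- The terms with `1 / (x(p) - x(q)) ^ 2`.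
  have t1 : ∀ i ∈ M, (∏ k ∈ M, v k) * ((2 * omega01 S (v a))⁻¹ * (deriv S.x (v a) *
      deriv S.x (v i) / (S.x (v a) - S.x (v i)) ^ 2 *
        omega S Q μ h (v a) ((M.val.map v).erase (v i)))) =
      v i * (C.kernel (v a) * ev (Function.update v i (v a))
        (eulers (M.erase i).val (P h i (M.erase i)))) *
        (((v a - v i) ^ 2)⁻¹ - ((v a * v i - 1) ^ 2)⁻¹) := by
    intro i hi
    have hia : a ≠ i := fun h => ha (h ▸ hi)
    have hq0 : v i ≠ 0 := hv0 i (hmem i hi)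
    have hlt : h + (M.erase i).card < h + M.card := by
      have := Finset.card_erase_lt_of_mem hi
      omega
    have hMpos := Finset.card_pos.2 ⟨i, hi⟩
    have hne0 : h ≠ 0 ∨ M.erase i ≠ ∅ := by
      by_cases h0 : h = 0
      · refine Or.inr (Finset.nonempty_iff_ne_empty.1 (Finset.card_pos.1 ?_))
        rw [Finset.card_erase_of_mem hi]
        omega
      · exact Or.inl h0
    have H := HP h i (M.erase i) hlt hne0 (Finset.notMem_erase i M)
    set w := Function.update v i (v a) with hw
    have wi : w i = v a := Function.update_self _ _ _
    have wM : ∀ k ∈ M.erase i, w k = v k := fun k hk =>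
      Function.update_of_ne (Finset.ne_of_mem_erase hk) _ _
    have hval : ∀ k ∈ insert i (M.erase i), ∃ j ∈ insert a M, w k = v j := by
      intro k hk
      rcases Finset.mem_insert.1 hk with rfl | hk
      · exact ⟨a, hamem, wi⟩
      · exact ⟨k, hmem k (Finset.mem_of_mem_erase hk), wM k hk⟩
    have H2 := H.2 w (fun k hk j hj => by
      obtain ⟨k', hk', e⟩ := hval k hk
      obtain ⟨j', hj', e'⟩ := hval j hj
      rw [e, e']
      exact hv k' hk' j' hj') (fun k hk => by
      obtain ⟨k', hk', e⟩ := hval k hk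
      rw [e]
      exact hv0 k' hk') (fun k hk j hj e => by
      rw [wM k hk, wM j hj] at e
      exact hinj' (Finset.mem_of_mem_erase hk) (Finset.mem_of_mem_erase hj) e)
    rw [wi, Finset.prod_congr rfl wM,
      Multiset.map_congr rfl fun k hk => wM k hk] at H2
    rw [← H2, ← Finset.mul_prod_erase M v hi, C.kernel_eq _ hp0 hp1, C.deriv_x _ hp0,
      C.deriv_x _ hq0, C.x_sub _ _ hp0 hq0, ← Multiset.map_erase_of_mem v M.val hi,
      ← Finset.erase_val]
    have hpq : v a - v i ≠ 0 := sub_ne_zero.2 fun e => hia (hinj (Finset.mem_coe.2 hamem)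
      (Finset.mem_coe.2 (hmem i hi)) e)
    have hpq1 : v a * v i - 1 ≠ 0 := sub_ne_zero.2 (hv a hamem i (hmem i hi))
    have ec := C.c_ne_zero
    have e1 : C.c * (1 - (v a ^ 2)⁻¹) * (C.c * (1 - (v i ^ 2)⁻¹)) /
        (C.c * ((v a - v i) * (1 - (v a * v i)⁻¹))) ^ 2 =
        ((v a - v i) ^ 2)⁻¹ - ((v a * v i - 1) ^ 2)⁻¹ := by
      have e2 : 1 - (v a * v i)⁻¹ = (v a * v i - 1) / (v a * v i) := by field_simp
      rw [e2]
      field_simp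
      ring
    rw [e1]
    ring
  -- The quadratic term.
  have t2 : v a ^ 2 * (∏ k ∈ M, v k) * ∑ h₁ ∈ Finset.range (h + 1),
      ((M.val.map v).antidiagonal.map fun K =>
        if (h₁ = 0 ∧ K.1 = 0) ∨ (h₁ = h ∧ K.2 = 0) then 0
        else omega S Q μ h₁ (v a) K.1 * omega S Q μ (h - h₁) (v a) K.2).sum =
      ∑ h₁ ∈ Finset.range (h + 1), ∑ K ∈ M.powerset, ev v (eulers M.val
        (if (h₁ = 0 ∧ K = ∅) ∨ (h₁ = h ∧ M \ K = ∅) then 0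
          else P h₁ a K * P (h - h₁) a (M \ K))) := by
    rw [Finset.mul_sum]
    refine Finset.sum_congr rfl fun h₁ hh₁ => ?_
    rw [sum_antidiagonal_map, Finset.mul_sum]
    refine Finset.sum_congr rfl fun K hK => ?_
    have hK := Finset.mem_powerset.1 hK
    simp only [Multiset.map_eq_zero, Finset.val_eq_zero]
    split_ifs with hif
    · rw [mul_zero, eulers_map_zero, map_zero]
    · obtain ⟨h1, h2⟩ := quad_lt hK (Nat.lt_succ_iff.1 (Finset.mem_range.1 hh₁)) hif
      rw [Represents.mul ha hK (HP _ _ _ h1.1 h1.2 fun h => ha (hK h))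
        (HP _ _ _ h2.1 h2.2 fun h => ha (Finset.mem_sdiff.1 h).1) hv hv0 hinj']
  have t3 : v a ^ 2 * (∏ k ∈ M, v k) *
      (if 2 ≤ h then omega S Q μ (h - 2) (v a) (v a ::ₘ M.val.map v) else 0) = ev v (eulers M.val
        (if 2 ≤ h then subst c a (euler c (P (h - 2) a (insert c M))) else 0)) := by
    split_ifs with hif
    · rw [Represents.diag ha hc (HP _ _ _ (by
        rw [Finset.card_insert_of_notMem hcM]
        omega) (Or.inr (Finset.insert_ne_empty _ _)) hac) hv hv0 hinj]
    · rw [mul_zero, eulers_map_zero, map_zero]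
  have t4 : v a ^ 2 * (∏ k ∈ M, v k) * (if 1 ≤ h then Q * deriv S.x (v a) *
      deriv (fun q => omega S Q μ (h - 1) q (M.val.map v) / deriv S.x q) (v a) else 0) =
      ev v (eulers M.val (if 1 ≤ h then algebraMap ℂ _ Q *
        (euler a (P (h - 1) a M) - (1 - 2 * X (a, Sum.inr a)) * P (h - 1) a M) else 0)) := by
    split_ifs with hif
    · have hne : h - 1 ≠ 0 ∨ M ≠ ∅ := by
        by_cases hM : M = ∅
        · left
          rw [hM, Finset.card_empty] at hh
          omega
        · exact Or.inr hM
      rw [eulers_algebraMap_mul, map_mul, AlgHom.commutes,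
        Represents.derivTerm C ha (HP _ _ _ (by omega) hne ha) hv hv0 hinj',
        Algebra.algebraMap_self, RingHom.id_apply]
      ring
    · rw [mul_zero, eulers_map_zero, map_zero]
  rw [inhomSymbol, eulers_add, eulers_add, eulers_sum, map_add, map_add, map_sum]
  simp only [eulers_sum, map_sum]
  rw [← t2, ← t3, ← t4, ← Finset.sum_congr rfl t1, recTerm, Multiset.map_map]
  have t0 : (M.val.map ((fun q => deriv S.x (v a) * deriv S.x q / (S.x (v a) - S.x q) ^ 2 *
      omega S Q μ h (v a) ((M.val.map v).erase q)) ∘ v)).sum =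
      ∑ i ∈ M, deriv S.x (v a) * deriv S.x (v i) / (S.x (v a) - S.x (v i)) ^ 2 *
        omega S Q μ h (v a) ((M.val.map v).erase (v i)) := rfl
  rw [t0, ← Finset.mul_sum, ← Finset.mul_sum, C.kernel_eq _ hp0 hp1, C.kernel_eq_mul]
  ring

end Step

/-! ### Existence of symbols -/

/-- The contribution to `ω(p₀, J)` of the double pole at a point of `J`, in symbolic form. -/
theorem ev_euler_poleTerm {L L' : Finset ℕ} {i a : ℕ} (hi : i ∈ L) (haL : a ∈ L) (hia : i ≠ a)
    {f d : CornerAlg} (hL : L' ⊆ L) (hd : d ∈ supp L) (hf : f ∈ supp L') (ha : a ∉ L')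
    (h : IsDividedDiff L i a f d) {v : ℕ → ℂ} (hv : Good L v) {k : ℂ} {l : ℂ → ℂ}
    (hk : HasDerivAt (fun t => ev (Function.update v i t) f) k (v i))
    (hl : ∀ᶠ p in 𝓝 (v a), ev (Function.update v i p) f = ev v f +
      (p - v i) * (k + (p - v i) * l p))
    (hlc : ContinuousAt l (v a)) :
    ev v (euler i (-d - (1 - X (a, Sum.inr i)) * f + X (a, Sum.inr i) * subst i a f)) =
      v a * (v i * (-l (v a) - deriv (fun p => p * (v a * p - 1)⁻¹ *
        ev (Function.update v i p) f) (v i) +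
        ev (Function.update v i (v a)) f * ((v a * v i - 1) ^ 2)⁻¹)) := by
  have hpq : v a * v i - 1 ≠ 0 := sub_ne_zero.2 (hv a haL i hi)
  have hpq' : 1 - v a * v i ≠ 0 := sub_ne_zero.2 (hv a haL i hi).symm
  have e1 := h.ev_euler hia hd hf ha hv hk hl hlc
  have hX := X_pair_mem_supp haL hi
  -- The middle term.
  have e2 : ev v (euler i ((1 - X (a, Sum.inr i)) * f)) = v a * (v i * deriv (fun p =>
      p * (v a * p - 1)⁻¹ * ev (Function.update v i p) f) (v i)) := by
    obtain ⟨c, h1, h2⟩ := hv.hasDerivAt i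
      (mul_mem (sub_mem (supp L).one_mem hX) (supp_mono hL hf))
    have h3 : (fun t => ev (Function.update v i t) ((1 - X (a, Sum.inr i)) * f)) =ᶠ[𝓝 (v i)]
        fun t => v a * (t * (v a * t - 1)⁻¹ * ev (Function.update v i t) f) := by
      filter_upwards [hv.eventually i] with t ht
      have ht1 := sub_ne_zero.2 (ht a haL i hi)
      rw [Function.update_self, Function.update_of_ne hia.symm] at ht1
      have ht2 : 1 - v a * t ≠ 0 := fun h0 => ht1 (by linear_combination -h0)
      rw [map_mul, map_sub, map_one, ev_X, den_pair, Function.update_self,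
        Function.update_of_ne hia.symm, ← mul_assoc]
      congr 1
      field_simp
      ring
    rw [h2, ← h1.deriv, h3.deriv_eq, deriv_const_mul_field]
    ring
  -- In the last term the second factor does not involve the variable `i`.
  have e3 : ev v (euler i (X (a, Sum.inr i) * subst i a f)) =
      v a * (v i * (ev (Function.update v i (v a)) f * ((v a * v i - 1) ^ 2)⁻¹)) := by
    have h1 : euler i (subst i a f) = 0 := by
      refine euler_eq_zero (L := insert a (L.erase i)) ?_ (subst_mem_supp (L := L)
        (Finset.mem_insert_self _ _) (fun k hk hki => Finset.mem_insert_of_mem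
          (Finset.mem_erase.2 ⟨hki, hk⟩)) (supp_mono hL hf))
      rw [Finset.mem_insert, not_or]
      exact ⟨hia, Finset.notMem_erase _ _⟩
    have h2 : mult (a, Sum.inr i) i = 1 := by simp [mult, hia.symm]
    rw [Derivation.leibniz, h1, smul_zero, zero_add, smul_eq_mul, euler_X, h2, one_smul, map_mul,
      ev_subst, map_sub, map_pow, ev_X, den_pair]
    field_simp
    ring
  rw [map_add, map_sub, map_neg, map_add, map_sub, map_neg, e1, e2, e3]
  ring

theorem represents_zero_singleton {S : SpectralCurve} {Q μ : ℂ} {a i : ℕ} (hai : a ≠ i) :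
    Represents S Q μ 0 a {i} (X (a, Sum.inr i)) := by
  refine ⟨X_pair_mem_supp (Finset.mem_insert_self _ _)
    (Finset.mem_insert_of_mem (Finset.mem_singleton_self i)), fun v hv hv0 _ => ?_⟩
  have h0 : v a ≠ 0 := hv0 a (Finset.mem_insert_self _ _)
  have h1 : 1 - v a * v i ≠ 0 := sub_ne_zero.2 (hv a (Finset.mem_insert_self _ _) i
    (Finset.mem_insert_of_mem (Finset.mem_singleton_self i))).symm
  have h2 : omega S Q μ 0 (v a) {v i} = omega02 (v a) (v i) := by
    simp [omega, omegaAux]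
  have h3 : mult (a, Sum.inr i) i = 1 := by simp [mult, hai]
  have h4 : ({i} : Finset ℕ).val = i ::ₘ 0 := rfl
  rw [h4, Multiset.map_cons, Multiset.map_zero, eulers_cons, eulers_zero, euler_X, h3, one_smul,
    Finset.prod_singleton, map_sub, map_pow, ev_X, den_pair]
  have h5 : (v i ::ₘ (0 : Multiset ℂ)) = {v i} := rfl
  rw [h5, h2, omega02, deriv_σ, bergman, σ]
  have e : (v a)⁻¹ - v i = (1 - v a * v i) / v a := by field_simp
  rw [e]
  field_simp
  ring

theorem SymbolicCurve.represents_half {S : SpectralCurve} {Q μ : ℂ} (C : SymbolicCurve S Q μ)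
    (a : ℕ) : Represents S Q μ 1 a ∅ (C.half a) := by
  refine ⟨C.half_mem_supp a, fun v hv hv0 _ => ?_⟩
  have ha := Finset.mem_insert_self a (∅ : Finset ℕ)
  have h2 : omega S Q μ 1 (v a) 0 = omegaHalf S Q μ (v a) := by
    simp [omega, omegaAux]
  have h3 := C.ev_half v a (hv0 a ha) (by rw [sq]; exact hv a ha a ha)
  rw [Finset.empty_val, Multiset.map_zero, eulers_zero, h2, h3, Finset.prod_empty, mul_one]

section

variable {S : SpectralCurve} {Q μ : ℂ} {a h : ℕ} {M : Finset ℕ}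
  {P : ℕ → ℕ → Finset ℕ → CornerAlg}

/-- One step of the recursion. Every summand of the new symbol contains the symbol of
`1 / ω_{0,1}` or a divided difference of a multiple of it, so it vanishes at all corners. -/
theorem exists_represents_step (C : SymbolicCurve S Q μ) (HP : RepresentsBelow S Q μ h M P)
    (ha : a ∉ M) (hh : 2 ≤ h + M.card) :
    ∃ R ∈ cornerIdeal, Represents S Q μ h a M R := by
  obtain ⟨c, hc⟩ := Infinite.exists_notMem_finset (insert a M)
  have hamem : a ∈ insert a M := Finset.mem_insert_self a M
  have hmem := fun k (hk : k ∈ M) => Finset.mem_insert_of_mem (a := k) (b := a) hk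
  have hsub : M ⊆ insert a M := Finset.subset_insert a M
  have hne : ∀ i ∈ M, i ≠ a := fun i hi h => ha (h ▸ hi)
  have hPsupp : ∀ i ∈ M, P h i (M.erase i) ∈ supp M := by
    intro i hi
    have hlt : h + (M.erase i).card < h + M.card := by
      have := Finset.card_erase_lt_of_mem hi
      omega
    have hMpos := Finset.card_pos.2 ⟨i, hi⟩
    have hne0 : h ≠ 0 ∨ M.erase i ≠ ∅ := by
      by_cases h0 : h = 0
      · refine Or.inr (Finset.nonempty_iff_ne_empty.1 (Finset.card_pos.1 ?_))
        rw [Finset.card_erase_of_mem hi]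
        omega
      · exact Or.inl h0
    have := (HP h i (M.erase i) hlt hne0 (Finset.notMem_erase i M)).1
    rwa [Finset.insert_erase hi] at this
  have hsym : ∀ i ∈ M, C.sym i ∈ supp M := fun i hi =>
    supp_mono (Finset.singleton_subset_iff.2 hi) (C.sym_mem_supp i)
  set F : ℕ → CornerAlg := fun i => P h i (M.erase i) * C.sym i with hFdef
  have hF : ∀ i ∈ M, F i ∈ supp M := fun i hi => mul_mem (hPsupp i hi) (hsym i hi)
  have hFc : ∀ i, F i ∈ cornerIdeal := fun i =>
    Ideal.mul_mem_left _ _ (C.sym_mem_cornerIdeal i)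
  have hd : ∀ i, ∃ d, i ∈ M → d ∈ supp (insert a M) ∧ IsDividedDiff (insert a M) i a (F i) d ∧
      ∀ r, corner r d = if r i ≤ r a then corner r (subst i a (F i)) - corner r (F i) else 0 := by
    intro i
    by_cases hi : i ∈ M
    · obtain ⟨d, h1, h2, h3⟩ := exists_dividedDiff (hne i hi) (hmem i hi) hamem
        (supp_mono hsub (hF i hi))
      exact ⟨d, fun _ => ⟨h1, h2, h3⟩⟩
    · exact ⟨0, fun h => absurd h hi⟩
  choose d hd using hd
  set term : ℕ → CornerAlg := fun i =>
    -d i - (1 - X (a, Sum.inr i)) * F i + X (a, Sum.inr i) * subst i a (F i) with hterm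
  have hB := inhomSymbol_mem_supp HP ha hc hh
  refine ⟨∑ i ∈ M, term i - C.sym a * inhomSymbol P Q h a c M, ?_, ?_, ?_⟩
  · refine sub_mem (sum_mem fun i hi => ?_) (Ideal.mul_mem_right _ _ (C.sym_mem_cornerIdeal a))
    refine add_mem (sub_mem (neg_mem (mem_cornerIdeal.2 fun r hr => ?_))
      (Ideal.mul_mem_left _ _ (hFc i)))
      (Ideal.mul_mem_left _ _ (subst_mem_cornerIdeal i a (hFc i)))
    rw [(hd i hi).2.2, mem_cornerIdeal.1 (subst_mem_cornerIdeal i a (hFc i)) r hr,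
      mem_cornerIdeal.1 (hFc i) r hr, sub_zero, ite_self]
  · refine sub_mem (sum_mem fun i hi => ?_) (mul_mem (supp_mono
      (Finset.singleton_subset_iff.2 hamem) (C.sym_mem_supp a)) hB)
    have hX := X_pair_mem_supp hamem (hmem i hi)
    exact add_mem (sub_mem (neg_mem (hd i hi).1) (mul_mem (sub_mem (supp _).one_mem hX)
      (supp_mono hsub (hF i hi)))) (mul_mem hX (subst_mem_supp (L := M) hamem
        (fun k hk _ => hmem k hk) (hF i hi)))
  intro v hv hv0 hinj
  have hp0 : v a ≠ 0 := hv0 a hamem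
  have hprod : ∏ k ∈ M, v k ≠ 0 :=
    Finset.prod_ne_zero_iff.2 fun k hk => hv0 k (Finset.mem_insert_of_mem hk)
  -- The points at which residues are taken.
  set I : Finset ℂ := ramification ∪ ((v a ::ₘ M.val.map v).map σ).toFinset with hI
  have hI1 : (1 : ℂ) ∈ I := Finset.mem_union_left _ (by simp [ramification])
  have hI2 : (-1 : ℂ) ∈ I := Finset.mem_union_left _ (by simp [ramification])
  have hI3 : ∀ k ∈ insert a M, (v k)⁻¹ ∈ I := by
    intro k hk
    refine Finset.mem_union_right _ (Multiset.mem_toFinset.2 (Multiset.mem_map_of_mem σ ?_))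
    rcases Finset.mem_insert.1 hk with rfl | hk
    · exact Multiset.mem_cons_self _ _
    · exact Multiset.mem_cons_of_mem (Multiset.mem_map_of_mem v hk)
  have hI4 : ∀ r ∈ I, r = 1 ∨ r = -1 ∨ ∃ k ∈ insert a M, r = (v k)⁻¹ := by
    intro r hr
    rcases Finset.mem_union.1 hr with hr | hr
    · simpa [ramification, or_assoc] using Or.inl hr
    · obtain ⟨t, ht, rfl⟩ := Multiset.mem_map.1 (Multiset.mem_toFinset.1 hr)
      right
      right
      rcases Multiset.mem_cons.1 ht with rfl | ht
      · exact ⟨a, hamem, rfl⟩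
      · obtain ⟨k, hk, rfl⟩ := Multiset.mem_map.1 ht
        exact ⟨k, hmem k hk, rfl⟩
  have hI5 : ∀ k ∈ insert a M, v k ∉ I := by
    intro k hk hkI
    rcases hI4 _ hkI with h1 | h1 | ⟨j, hj, h1⟩
    · exact hv k hk k hk (by rw [h1]; norm_num)
    · exact hv k hk k hk (by rw [h1]; norm_num)
    · exact hv k hk j hj (by rw [h1, inv_mul_cancel₀ (hv0 j hj)])
  have hclosed : ∀ k ∈ insert a M, ∀ᶠ p in 𝓝 (v k), p ∉ I := fun k hk =>
    I.finite_toSet.isClosed.isOpen_compl.mem_nhds (by simpa using hI5 k hk)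
  -- The coefficient functions of the double poles.
  set f : ℕ → CornerAlg := fun i => eulers (M.erase i).val (F i) with hfdef
  have hf : ∀ i ∈ M, f i ∈ supp M := fun i hi => eulers_mem_supp _ (hF i hi)
  have hfmul : ∀ i ∈ M, f i = eulers (M.erase i).val (P h i (M.erase i)) * C.sym i := by
    intro i hi
    have : ∀ k ∈ (M.erase i).val, euler k (C.sym i) = 0 := fun k hk =>
      euler_eq_zero (fun h => by
        rw [Finset.mem_singleton.1 h] at hk
        exact Finset.notMem_erase i M hk) (C.sym_mem_supp i)
    rw [hfdef]
    simp only [hFdef]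
    rw [mul_comm, eulers_mul_left _ this, mul_comm]
  set H : ℕ → ℂ → ℂ := fun i p => ev (Function.update v i p) (f i) with hH
  have hHrat : ∀ i ∈ M, H i ∈ ratFun (I : Set ℂ) := fun i hi =>
    ev_mem_ratFun hI1 hI2 (fun k hk _ => hI3 k (hmem k hk)) (hf i hi)
  have hkl : ∀ i, ∃ k l : ℂ → ℂ, i ∈ M → k ∈ ratFun (I : Set ℂ) ∧ l ∈ ratFun (I : Set ℂ) ∧
      (∀ z ∉ I, H i z = H i (v i) + (z - v i) * k z) ∧
      ∀ z ∉ I, k z = k (v i) + (z - v i) * l z := by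
    intro i
    by_cases hi : i ∈ M
    · have hiI : v i ∉ (I : Set ℂ) := by simpa using hI5 i (hmem i hi)
      obtain ⟨k, hk, h1⟩ := ratFun_divide (hHrat i hi) hiI
      obtain ⟨l, hl, h2⟩ := ratFun_divide hk hiI
      exact ⟨k, l, fun _ => ⟨hk, hl, fun z hz => h1 z (by simpa using hz),
        fun z hz => h2 z (by simpa using hz)⟩⟩
    · exact ⟨0, 0, fun h => absurd h hi⟩
  choose k l hkl using hkl
  set g : ℂ → ℂ := fun p => C.kernelDiv p *
    ev (Function.update v a p) (eulers M.val (inhomSymbol P Q h a c M)) with hg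
  have hgrat : g ∈ ratFun (I : Set ℂ) := by
    refine (ratFun _).mul_mem (Algebra.adjoin_mono (Set.insert_subset_insert (Set.image_mono ?_))
      C.kernelDiv_mem) (ev_mem_ratFun hI1 hI2 (fun k hk _ => hI3 k hk) (eulers_mem_supp _ hB))
    rintro z (rfl | rfl)
    · exact hI1
    · exact hI2
  have hstep := (negResidueSum_step (hI5 a hamem) (hI3 a hamem) M (q := v)
    (fun i hi => hI5 i (hmem i hi)) (fun i hi => hI3 i (hmem i hi)) hgrat
    (h := fun i => v i • H i) (k := fun i => v i • k i) (l := fun i => v i • l i)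
    (fun i hi => (ratFun _).smul_mem (hHrat i hi) _)
    (fun i hi => (ratFun _).smul_mem (hkl i hi).2.1 _)
    (fun i hi z hz => by
      simp only [Pi.smul_apply, smul_eq_mul]
      linear_combination v i * (hkl i hi).2.2.1 z hz)
    (fun i hi z hz => by
      simp only [Pi.smul_apply, smul_eq_mul]
      linear_combination v i * (hkl i hi).2.2.2 z hz)).smul (∏ k ∈ M, v k)⁻¹
  have hres := (hstep.congr (g := fun p => eta p (v a) / (2 * omega01 S p) *
    recTerm S Q (omega S Q μ) h p (M.val.map v)) (s := ↑I ∪ insert 0 (M.image v : Finset ℂ))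
    (I.finite_toSet.union ((Finset.finite_toSet _).insert 0)) fun z hz => ?_).residue_eq
  · rw [omega_recursion S Q μ h (v a) _ (by simpa using hh), recursionStep, hres]
    rw [mul_assoc, mul_inv_cancel_left₀ hprod, eulers_sub, eulers_sum, map_sub, map_sum,
      eulers_mul_left M.val (fun k hk => euler_eq_zero (fun h => by
        rw [Finset.mem_singleton.1 h] at hk
        exact ha hk) (C.sym_mem_supp a)), map_mul, C.ev_sym, C.kernel_eq_mul,
      hg]
    simp only [Function.update_eq_self]
    rw [mul_add, Finset.mul_sum]
    rw [neg_mul_eq_mul_neg, add_comm, sub_eq_add_neg, ← mul_neg, mul_assoc]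
    congr 1
    refine Finset.sum_congr rfl fun i hi => ?_
    have hval : M.val = i ::ₘ (M.erase i).val := by
      rw [Finset.erase_val]
      exact (Multiset.cons_erase hi).symm
    have hX0 : ∀ j ∈ (M.erase i).val, euler j (X (a, Sum.inr i) : CornerAlg) = 0 := by
      intro j hj
      have hj : j ∈ M.erase i := hj
      refine euler_eq_zero (L := {a, i}) ?_ (X_pair_mem_supp (by simp) (by simp))
      simp only [Finset.mem_insert, Finset.mem_singleton, not_or]
      exact ⟨hne j (Finset.mem_of_mem_erase hj), Finset.ne_of_mem_erase hj⟩
    have hia : i ∉ (M.erase i).val := Finset.notMem_erase i M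
    have haM : a ∉ (M.erase i).val := fun h => ha (Finset.mem_of_mem_erase h)
    have e1 : eulers M.val (term i) = euler i (-eulers (M.erase i).val (d i) -
        (1 - X (a, Sum.inr i)) * f i + X (a, Sum.inr i) * subst i a (f i)) := by
      rw [hval, eulers_cons, hterm, hfdef]
      simp only
      rw [eulers_add, eulers_sub, eulers_neg, eulers_mul_left _ hX0, eulers_mul_left,
        eulers_subst _ hia haM]
      intro j hj
      rw [map_sub, euler_one, hX0 j hj, sub_zero]
    obtain ⟨hk1, hl1, hk2, hl2⟩ := hkl i hi
    have hiI : v i ∉ (I : Set ℂ) := by simpa using hI5 i (hmem i hi)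
    have haI : v a ∉ (I : Set ℂ) := by simpa using hI5 a hamem
    have hHv : H i (v i) = ev v (f i) := by
      rw [hH]
      simp only [Function.update_eq_self]
    have hder : HasDerivAt (fun t => ev (Function.update v i t) (f i)) (k i (v i)) (v i) := by
      have h4 := (((hasDerivAt_id (v i)).sub_const (v i)).mul
        (ratFun_differentiableAt hk1 hiI).hasDerivAt).const_add (H i (v i))
      simp only [id, sub_self, zero_mul, add_zero, one_mul] at h4
      refine h4.congr_of_eventuallyEq ?_
      filter_upwards [hclosed i (hmem i hi)] with z hz using hk2 z hz
    have e2 := ev_euler_poleTerm (hmem i hi) hamem (hne i hi) hsub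
      (eulers_mem_supp _ (hd i hi).1) (hf i hi) ha
      ((hd i hi).2.1.eulers (supp_mono hsub (hF i hi)) (hd i hi).1 hamem _ hia haM) hv hder
      (l := l i) (by
        filter_upwards [hclosed a hamem] with z hz
        rw [← hHv, ← hl2 z hz]
        exact hk2 z hz) (ratFun_differentiableAt hl1 haI).continuousAt
    rw [e1, e2]
    have e3 : (fun p => p * (v a * p - 1)⁻¹ * (v i • H i) p) =
        fun p => v i * (p * (v a * p - 1)⁻¹ * ev (Function.update v i p) (f i)) := by
      funext p
      simp only [Pi.smul_apply, smul_eq_mul, hH]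
      ring
    rw [e3, deriv_const_mul_field]
    simp only [Pi.smul_apply, smul_eq_mul, hH]
    ring
  · rw [Set.mem_union, Set.mem_insert_iff, not_or, not_or] at hz
    obtain ⟨hz1, hz2, hz3⟩ := hz
    have hz1 : z ∉ I := by simpa using hz1
    set w := Function.update v a z with hw
    have wa : w a = z := Function.update_self _ _ _
    have wM : ∀ k ∈ M, w k = v k := fun k hk => Function.update_of_ne (hne k hk) _ _
    have hzz : z * z ≠ 1 := fun h0 => by
      rcases mul_self_eq_one_iff.1 h0 with rfl | rfl
      · exact hz1 hI1
      · exact hz1 hI2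
    have hzk : ∀ k ∈ M, z * v k ≠ 1 := fun k hk h0 =>
      hz1 (by rw [eq_inv_of_mul_eq_one_left h0]; exact hI3 k (hmem k hk))
    have w1 : Good (insert a M) w := by
      intro i hi j hj
      rcases Finset.mem_insert.1 hi with rfl | hi' <;> rcases Finset.mem_insert.1 hj with rfl | hj'
      · rw [wa]
        exact hzz
      · rw [wa, wM j hj']
        exact hzk j hj'
      · rw [wa, wM i hi', mul_comm]
        exact hzk i hi'
      · rw [wM i hi', wM j hj']
        exact hv i hi j hj
    have w2 : ∀ i ∈ insert a M, w i ≠ 0 := by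
      intro i hi
      rcases Finset.mem_insert.1 hi with rfl | hi'
      · rwa [wa]
      · rw [wM i hi']
        exact hv0 i hi
    have hzv : ∀ i ∈ M, z ≠ v i := by
      rintro i hi rfl
      exact hz3 (Finset.mem_coe.2 (Finset.mem_image_of_mem v hi))
    have w3 : Set.InjOn w (insert a M : Finset ℕ) := by
      intro i hi j hj e
      rcases Finset.mem_insert.1 (Finset.mem_coe.1 hi) with rfl | hi' <;>
        rcases Finset.mem_insert.1 (Finset.mem_coe.1 hj) with rfl | hj'
      · rfl
      · rw [wa, wM j hj'] at e
        exact absurd e (hzv j hj')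
      · rw [wa, wM i hi'] at e
        exact absurd e.symm (hzv i hi')
      · rw [wM i hi', wM j hj'] at e
        exact hinj hi' hj' e
    have h1 := recTerm_eq C HP ha hc hh w1 w2 w3
    rw [wa, Finset.prod_congr rfl wM, Multiset.map_congr rfl wM] at h1
    have h2 : eta z (v a) = (v a - z)⁻¹ - z * (v a * z - 1)⁻¹ := by
      have e : v a - z⁻¹ = (v a * z - 1) / z := by field_simp
      rw [eta, bergmanPrimitive, bergmanPrimitive, σ, e, one_div, one_div, inv_div, div_eq_mul_inv]
    have h3 : ∀ i ∈ M, w i * (C.kernel z * ev (Function.update w i z)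
        (eulers (M.erase i).val (P h i (M.erase i)))) = (v i • H i) z := by
      intro i hi
      have e : ev (Function.update w i z) (f i) = ev (Function.update v i z) (f i) := by
        refine ev_congr (fun j hj => ?_) (hf i hi)
        rcases eq_or_ne j i with rfl | hji
        · rw [Function.update_self, Function.update_self]
        · rw [Function.update_of_ne hji, Function.update_of_ne hji, wM j hj]
      rw [Pi.smul_apply, smul_eq_mul, wM i hi, hH]
      simp only
      rw [← e, hfmul i hi, map_mul, C.ev_sym, Function.update_self]
      ring
    have h4 : g z + ∑ i ∈ M, (v i • H i) z * (((z - v i) ^ 2)⁻¹ - ((z * v i - 1) ^ 2)⁻¹) =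
        (∏ k ∈ M, v k) * ((2 * omega01 S z)⁻¹ *
          recTerm S Q (omega S Q μ) h z (M.val.map v)) := by
      rw [h1, hg]
      simp only [← hw]
      congr 1
      refine Finset.sum_congr rfl fun i hi => ?_
      rw [h3 i hi, wM i hi]
    rw [Pi.smul_apply, smul_eq_mul, h4, h2]
    field_simp

/-- Every multidifferential has a symbol, and beyond `ω_{0,2}` and `ω_{1/2,1}` the symbols vanish
at all corners. -/
theorem exists_represents (C : SymbolicCurve S Q μ) (h a : ℕ) (M : Finset ℕ)
    (hne : h ≠ 0 ∨ M ≠ ∅) (ha : a ∉ M) :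
    ∃ R, Represents S Q μ h a M R ∧ (2 ≤ h + M.card → R ∈ cornerIdeal) := by
  induction hN : h + M.card using Nat.strong_induction_on generalizing h a M with
  | _ N ih =>
    subst hN
    by_cases h2 : 2 ≤ h + M.card
    · have : ∀ h' a' M', ∃ R, h' + M'.card < h + M.card → (h' ≠ 0 ∨ M' ≠ ∅) → a' ∉ M' →
          Represents S Q μ h' a' M' R := by
        intro h' a' M'
        by_cases hlt : h' + M'.card < h + M.card ∧ (h' ≠ 0 ∨ M' ≠ ∅) ∧ a' ∉ M'
        · obtain ⟨R, hR, -⟩ := ih _ hlt.1 h' a' M' hlt.2.1 hlt.2.2 rfl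
          exact ⟨R, fun _ _ _ => hR⟩
        · exact ⟨0, fun h1 h2 h3 => absurd ⟨h1, h2, h3⟩ hlt⟩
      choose P hP using this
      obtain ⟨R, hR1, hR2⟩ := exists_represents_step C (P := P) hP ha h2
      exact ⟨R, hR2, fun _ => hR1⟩
    · rcases Nat.eq_zero_or_pos h with rfl | hpos
      · have hM := Finset.card_pos.2 (Finset.nonempty_iff_ne_empty.2 (hne.resolve_left (by simp)))
        obtain ⟨i, rfl⟩ := Finset.card_eq_one.1 (by omega : M.card = 1)
        exact ⟨_, represents_zero_singleton (by simpa using ha), fun h => absurd h h2⟩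
      · obtain rfl : h = 1 := by omega
        obtain rfl : M = ∅ := Finset.card_eq_zero.1 (by omega)
        exact ⟨_, C.represents_half a, fun h => absurd h h2⟩

end

/-! ### Integrals along rays -/

/-- All values of the variables lie on the open ray through `z`. -/
def OnRay (z : ℂ) (v : ℕ → ℂ) : Prop := ∀ j, ∃ t : ℝ, 0 < t ∧ v j = t * z

theorem OnRay.update {z : ℂ} {v : ℕ → ℂ} (h : OnRay z v) (i : ℕ) {t : ℝ} (ht : 0 < t) :
    OnRay z (Function.update v i (t * z)) := by
  intro j
  rcases eq_or_ne j i with rfl | hj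
  · exact ⟨t, ht, by simp⟩
  · rw [Function.update_of_ne hj]
    exact h j

/-- Off the positive real axis `1 - T w` is comparable to `1 + T ‖w‖`. -/
theorem exists_le_normSq_one_sub {w : ℂ} (hw : w.re ≤ 0 ∨ w.im ≠ 0) :
    ∃ δ : ℝ, 0 < δ ∧ ∀ T : ℝ, 0 ≤ T → δ * (1 + (T * ‖w‖) ^ 2) ≤ ‖1 - T * w‖ ^ 2 := by
  have key : ∀ T : ℝ, ‖1 - T * w‖ ^ 2 = 1 - 2 * T * w.re + T ^ 2 * (w.re ^ 2 + w.im ^ 2) := by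
    intro T
    rw [Complex.sq_norm, Complex.normSq_apply]
    simp
    ring
  have hn : ‖w‖ ^ 2 = w.re ^ 2 + w.im ^ 2 := by
    rw [Complex.sq_norm, Complex.normSq_apply]
    ring
  by_cases h : w.re ≤ 0
  · refine ⟨1, one_pos, fun T hT => ?_⟩
    rw [key, mul_pow, hn]
    nlinarith [mul_nonneg hT (neg_nonneg.2 h)]
  · have him : w.im ≠ 0 := hw.resolve_left h
    have hb : 0 < w.im ^ 2 := by positivity
    -- The smaller eigenvalue of a positive definite form is at least `det / trace`.
    refine ⟨w.im ^ 2 / (1 + (w.re ^ 2 + w.im ^ 2)) ^ 2, by positivity, fun T _ => ?_⟩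
    rw [key, mul_pow, hn, div_mul_eq_mul_div, div_le_iff₀ (by positivity)]
    generalize w.re = x at *
    generalize w.im = y at *
    have h1 : y ^ 2 * (1 + T ^ 2) ≤
        (1 - 2 * T * x + T ^ 2 * (x ^ 2 + y ^ 2)) * (1 + (x ^ 2 + y ^ 2)) := by
      nlinarith [sq_nonneg (x - T * (x ^ 2 + y ^ 2)), sq_nonneg (1 - T * x)]
    have h2 : 1 + T ^ 2 * (x ^ 2 + y ^ 2) ≤ (1 + T ^ 2) * (1 + (x ^ 2 + y ^ 2)) := by
      nlinarith [sq_nonneg T, sq_nonneg x, sq_nonneg y]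
    calc y ^ 2 * (1 + T ^ 2 * (x ^ 2 + y ^ 2))
        ≤ y ^ 2 * ((1 + T ^ 2) * (1 + (x ^ 2 + y ^ 2))) := mul_le_mul_of_nonneg_left h2 hb.le
      _ = (y ^ 2 * (1 + T ^ 2)) * (1 + (x ^ 2 + y ^ 2)) := by ring
      _ ≤ ((1 - 2 * T * x + T ^ 2 * (x ^ 2 + y ^ 2)) * (1 + (x ^ 2 + y ^ 2))) *
          (1 + (x ^ 2 + y ^ 2)) := mul_le_mul_of_nonneg_right h1 (by positivity)
      _ = _ := by ring

theorem one_sub_mul_ne_zero {w : ℂ} (hw : w.re ≤ 0 ∨ w.im ≠ 0) {T : ℝ} (hT : 0 ≤ T) :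
    1 - T * w ≠ 0 := by
  obtain ⟨δ, hδ, h⟩ := exists_le_normSq_one_sub hw
  intro h0
  have := h T hT
  rw [h0, norm_zero] at this
  have : 0 < δ * (1 + (T * ‖w‖) ^ 2) := by positivity
  nlinarith

theorem ray_re_im {z : ℂ} (hz : z.im ≠ 0) {s : ℝ} (hs : 0 < s) :
    ((s : ℂ) * z ^ 2).re ≤ 0 ∨ ((s : ℂ) * z ^ 2).im ≠ 0 := by
  by_cases h : z.re = 0
  · left
    rw [Complex.re_ofReal_mul, sq, Complex.mul_re, h]
    nlinarith [mul_nonneg hs.le (sq_nonneg z.im)]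
  · right
    rw [Complex.im_ofReal_mul, sq, Complex.mul_im]
    have : s * (z.re * z.im + z.im * z.re) = 2 * s * z.re * z.im := by ring
    rw [this]
    positivity

/-- Bounds for `e = 1 / (1 - T w)` and its logarithmic derivative `e ^ 2 - e`. -/
theorem exists_ray_bound {w : ℂ} (hw : w.re ≤ 0 ∨ w.im ≠ 0) :
    ∃ C : ℝ, 0 ≤ C ∧ ∀ T : ℝ, 0 ≤ T → ‖(1 - T * w)⁻¹‖ ≤ C ∧
      ‖(1 - T * w)⁻¹ ^ 2 - (1 - T * w)⁻¹‖ ≤ C ∧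
      ‖(1 - T * w)⁻¹ ^ 2 - (1 - T * w)⁻¹‖ ≤ C * T ∧
      ‖(1 - T * w)⁻¹ ^ 2 - (1 - T * w)⁻¹‖ * T ≤ C := by
  obtain ⟨δ, hδ, h⟩ := exists_le_normSq_one_sub hw
  refine ⟨1 + δ⁻¹ + δ⁻¹ * ‖w‖ + δ⁻¹ * ‖w‖⁻¹, by positivity, fun T hT => ?_⟩
  have hne := one_sub_mul_ne_zero hw hT
  have h1 := h T hT
  set x := T * ‖w‖ with hx
  have hx0 : 0 ≤ x := by positivity
  have hn : 0 < ‖1 - T * w‖ := norm_pos_iff.2 hne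
  have p1 : 0 ≤ δ⁻¹ := by positivity
  have p2 : 0 ≤ δ⁻¹ * ‖w‖ := by positivity
  have p3 : 0 ≤ δ⁻¹ * ‖w‖⁻¹ := by positivity
  have e : (1 - T * w)⁻¹ ^ 2 - (1 - T * w)⁻¹ = T * w / (1 - T * w) ^ 2 := by
    field_simp
    ring
  have e1 : ‖(1 - T * w)⁻¹ ^ 2 - (1 - T * w)⁻¹‖ ≤ δ⁻¹ * (x / (1 + x ^ 2)) := by
    rw [e, norm_div, norm_mul, norm_pow, Complex.norm_real, Real.norm_of_nonneg hT, ← hx]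
    calc x / ‖1 - T * w‖ ^ 2 ≤ x / (δ * (1 + x ^ 2)) :=
          div_le_div_of_nonneg_left hx0 (by positivity) h1
      _ = _ := by field_simp
  have b1 : x / (1 + x ^ 2) ≤ 1 := by
    rw [div_le_one (by positivity)]
    nlinarith [sq_nonneg (x - 1)]
  have b2 : x / (1 + x ^ 2) ≤ T * ‖w‖ := div_le_self hx0 (by nlinarith [sq_nonneg x])
  have b3 : x / (1 + x ^ 2) * T ≤ ‖w‖⁻¹ := by
    rcases eq_or_ne w 0 with rfl | hw0
    · simp [hx]
    · have hwn : 0 < ‖w‖ := norm_pos_iff.2 hw0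
      rw [div_mul_eq_mul_div, div_le_iff₀ (by positivity)]
      have : ‖w‖⁻¹ * (1 + x ^ 2) = ‖w‖⁻¹ + x * T := by
        rw [hx]
        field_simp
      rw [this]
      have : 0 ≤ ‖w‖⁻¹ := by positivity
      linarith
  refine ⟨?_, ?_, ?_, ?_⟩
  · rw [norm_inv]
    have h2 : ‖1 - T * w‖⁻¹ ^ 2 ≤ δ⁻¹ := by
      rw [inv_pow]
      refine inv_anti₀ hδ ?_
      nlinarith [sq_nonneg x]
    nlinarith [sq_nonneg (‖1 - T * w‖⁻¹ - 1)]
  · have := mul_le_mul_of_nonneg_left b1 p1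
    linarith
  · have := mul_le_mul_of_nonneg_left b2 p1
    nlinarith [mul_nonneg p1 hT, mul_nonneg p3 hT]
  · have := mul_le_mul_of_nonneg_left b3 p1
    have := mul_le_mul_of_nonneg_right e1 hT
    nlinarith

/-- On a ray the monomial of a generator is a power of the parameter times a number off the
positive real axis. -/
theorem den_ray {z : ℂ} (hz : z.im ≠ 0) {v : ℕ → ℂ} (hv : OnRay z v) (i : ℕ) (g : Gen)
    (hg : Uses g i) : ∃ w : ℂ, w ≠ 0 ∧ (w.re ≤ 0 ∨ w.im ≠ 0) ∧
      ((∀ t : ℝ, den (Function.update v i (t * z)) g = 1 - t * w) ∨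
        ∀ t : ℝ, den (Function.update v i (t * z)) g = 1 - (t ^ 2 : ℝ) * w) := by
  have hz0 : z ≠ 0 := by
    rintro rfl
    simp at hz
  obtain ⟨u, s | k⟩ := g
  · obtain rfl : u = i := hg.resolve_right (by simp)
    simp only [den_sign, Function.update_self]
    cases s
    · refine ⟨-z, neg_ne_zero.2 hz0, Or.inr (by simpa using hz), Or.inl fun t => ?_⟩
      simp
    · exact ⟨z, hz0, Or.inr hz, Or.inl fun t => by simp⟩
  · simp only [den_pair]
    rcases eq_or_ne u i with rfl | hu <;> rcases eq_or_ne k u with rfl | hk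
    · refine ⟨z ^ 2, pow_ne_zero 2 hz0, ?_, Or.inr fun t => ?_⟩
      · simpa using ray_re_im hz one_pos
      · simp only [Function.update_self]
        push_cast
        ring
    · obtain ⟨s, hs, e⟩ := hv k
      refine ⟨s * z ^ 2, mul_ne_zero (by exact_mod_cast hs.ne') (pow_ne_zero 2 hz0),
        ray_re_im hz hs, Or.inl fun t => ?_⟩
      rw [Function.update_self, Function.update_of_ne hk, e]
      ring
    · exact absurd (hg.elim (fun h => h) fun h => Sum.inr.inj h) hu
    · obtain rfl : k = i := hg.elim (fun h => absurd h hu) fun h => Sum.inr.inj h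
      obtain ⟨s, hs, e⟩ := hv u
      refine ⟨s * z ^ 2, mul_ne_zero (by exact_mod_cast hs.ne') (pow_ne_zero 2 hz0),
        ray_re_im hz hs, Or.inl fun t => ?_⟩
      rw [Function.update_self, Function.update_of_ne hu, e]
      ring

theorem den_ray_of_not_uses {v : ℕ → ℂ} {i : ℕ} {g : Gen} (hg : ¬Uses g i) (t : ℂ) :
    den (Function.update v i t) g = den v g := by
  obtain ⟨u, s | k⟩ := g
  · have hu : u ≠ i := fun h => hg (Or.inl h)
    rw [den_sign, den_sign, Function.update_of_ne hu]
  · have hu : u ≠ i := fun h => hg (Or.inl h)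
    have hk : k ≠ i := fun h => hg (Or.inr (congrArg Sum.inr h))
    rw [den_pair, den_pair, Function.update_of_ne hu, Function.update_of_ne hk]

theorem OnRay.den_ne_zero {z : ℂ} (hz : z.im ≠ 0) {v : ℕ → ℂ} (hv : OnRay z v) (g : Gen) :
    den v g ≠ 0 := by
  obtain ⟨t, ht, e⟩ := hv g.1
  obtain ⟨w, -, hw, h | h⟩ := den_ray hz hv g.1 g (Or.inl rfl)
  · have := h t
    rw [← e, Function.update_eq_self] at this
    rw [this]
    exact one_sub_mul_ne_zero hw ht.le
  · have := h t
    rw [← e, Function.update_eq_self] at this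
    rw [this]
    exact one_sub_mul_ne_zero hw (sq_nonneg t)

/-- The bounds that make the derivative `1 / t * euler i G` along a ray integrable, at both ends of
the ray. -/
theorem exists_bound_ev {z : ℂ} (hz : z.im ≠ 0) {v : ℕ → ℂ} (hv : OnRay z v) (i : ℕ)
    (G : CornerAlg) : ∃ C : ℝ, 0 ≤ C ∧ ∀ t : ℝ, 0 < t →
      ‖ev (Function.update v i (t * z)) G‖ ≤ C ∧
      ‖ev (Function.update v i (t * z)) (euler i G)‖ ≤ C * t ∧
      ‖ev (Function.update v i (t * z)) (euler i G)‖ * t ≤ C := by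
  have hG := algOn_univ G
  induction hG using Algebra.adjoin_induction with
  | mem f hf =>
    obtain ⟨g, -, rfl⟩ := hf
    by_cases hg : Uses g i
    · obtain ⟨w, -, hw, h⟩ := den_ray hz hv i g hg
      obtain ⟨C, hC, hb⟩ := exists_ray_bound hw
      refine ⟨(mult g i + 1) * C, by positivity, fun t ht => ?_⟩
      simp only [euler_X, map_nsmul, map_sub, map_pow, ev_X]
      simp only [nsmul_eq_mul, norm_mul, Complex.norm_natCast]
      have hm : (0 : ℝ) ≤ mult g i := Nat.cast_nonneg _
      have main : ∀ {n : ℂ}, ‖n⁻¹‖ ≤ C → ‖n⁻¹ ^ 2 - n⁻¹‖ ≤ C * t → ‖n⁻¹ ^ 2 - n⁻¹‖ * t ≤ C →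
          ‖n⁻¹‖ ≤ (mult g i + 1) * C ∧ mult g i * ‖n⁻¹ ^ 2 - n⁻¹‖ ≤ (mult g i + 1) * C * t ∧
          mult g i * ‖n⁻¹ ^ 2 - n⁻¹‖ * t ≤ (mult g i + 1) * C := by
        intro n h1 h2 h3
        have q1 := mul_le_mul_of_nonneg_left h2 hm
        have q2 := mul_le_mul_of_nonneg_left h3 hm
        have q3 := mul_nonneg hm hC
        have q4 := mul_nonneg hC ht.le
        refine ⟨by linarith, by linarith, by linarith⟩
      rcases h with h | h
      · obtain ⟨h1, -, h3, h4⟩ := hb t ht.le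
        rw [h t]
        exact main h1 h3 h4
      · obtain ⟨h1, h2, h3, h4⟩ := hb (t ^ 2) (sq_nonneg t)
        rw [h t]
        refine main h1 ?_ ?_
        · rcases le_total t 1 with h5 | h5
          · refine h3.trans (mul_le_mul_of_nonneg_left ?_ hC)
            nlinarith
          · refine h2.trans ?_
            nlinarith
        · have h6 := norm_nonneg ((1 - ((t ^ 2 : ℝ) : ℂ) * w)⁻¹ ^ 2 - (1 - ((t ^ 2 : ℝ) : ℂ) * w)⁻¹)
          rcases le_total t 1 with h5 | h5
          · exact (mul_le_of_le_one_right h6 h5).trans h2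
          · refine (mul_le_mul_of_nonneg_left ?_ h6).trans h4
            nlinarith
    · refine ⟨‖(den v g)⁻¹‖, norm_nonneg _, fun t ht => ?_⟩
      rw [euler_X, mult_eq_zero hg, zero_smul, map_zero, ev_X, den_ray_of_not_uses hg, norm_zero,
        zero_mul]
      exact ⟨le_rfl, by positivity, norm_nonneg _⟩
  | algebraMap c =>
    refine ⟨‖c‖, norm_nonneg _, fun t ht => ?_⟩
    rw [Derivation.map_algebraMap, map_zero, norm_zero, zero_mul, AlgHom.commutes]
    exact ⟨le_rfl, by positivity, norm_nonneg _⟩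
  | add f g _ _ h1 h2 =>
    obtain ⟨C, hC, h1⟩ := h1
    obtain ⟨D, hD, h2⟩ := h2
    refine ⟨C + D, by positivity, fun t ht => ?_⟩
    obtain ⟨a1, a2, a3⟩ := h1 t ht
    obtain ⟨b1, b2, b3⟩ := h2 t ht
    simp only [map_add]
    have n2 := norm_add_le (ev (Function.update v i (t * z)) (euler i f))
      (ev (Function.update v i (t * z)) (euler i g))
    refine ⟨(norm_add_le _ _).trans (by linarith), n2.trans (by linarith), ?_⟩
    have := mul_le_mul_of_nonneg_right n2 ht.le
    linarith
  | mul f g _ _ h1 h2 =>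
    obtain ⟨C, hC, h1⟩ := h1
    obtain ⟨D, hD, h2⟩ := h2
    refine ⟨2 * (C * D), by positivity, fun t ht => ?_⟩
    obtain ⟨a1, a2, a3⟩ := h1 t ht
    obtain ⟨b1, b2, b3⟩ := h2 t ht
    simp only [Derivation.leibniz, map_add, map_mul, smul_eq_mul]
    set F := ev (Function.update v i (t * z)) f
    set G := ev (Function.update v i (t * z)) g
    set F' := ev (Function.update v i (t * z)) (euler i f)
    set G' := ev (Function.update v i (t * z)) (euler i g)
    have n1 : ‖F * G‖ ≤ C * D := by
      rw [norm_mul]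
      exact mul_le_mul a1 b1 (norm_nonneg _) hC
    have n2 : ‖F * G' + G * F'‖ ≤ ‖F‖ * ‖G'‖ + ‖G‖ * ‖F'‖ := by
      refine (norm_add_le _ _).trans ?_
      rw [norm_mul, norm_mul]
    have n3 : ‖F‖ * ‖G'‖ ≤ C * (D * t) := mul_le_mul a1 b2 (norm_nonneg _) hC
    have n4 : ‖G‖ * ‖F'‖ ≤ D * (C * t) := mul_le_mul b1 a2 (norm_nonneg _) hD
    have n5 : ‖F‖ * (‖G'‖ * t) ≤ C * D := mul_le_mul a1 b3 (by positivity) hC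
    have n6 : ‖G‖ * (‖F'‖ * t) ≤ D * C := mul_le_mul b1 a3 (by positivity) hD
    refine ⟨n1.trans (by nlinarith [mul_nonneg hC hD]), n2.trans (by linarith), ?_⟩
    have := mul_le_mul_of_nonneg_right n2 ht.le
    linarith

theorem tendsto_ev_ray_zero {z : ℂ} (hz : z.im ≠ 0) {v : ℕ → ℂ} (hv : OnRay z v) (i : ℕ)
    (G : CornerAlg) : Tendsto (fun t : ℝ => ev (Function.update v i (t * z)) G) (𝓝[>] 0)
      (𝓝 (ev v (atZero i G))) := by
  have hG := algOn_univ G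
  induction hG using Algebra.adjoin_induction with
  | mem f hf =>
    obtain ⟨g, -, rfl⟩ := hf
    simp only [ev_X, atZero_X]
    by_cases hg : Uses g i
    · rw [if_pos hg, map_one]
      obtain ⟨w, -, hw, h⟩ := den_ray hz hv i g hg
      have c1 : Tendsto (fun t : ℝ => (1 - (t : ℂ) * w)⁻¹) (𝓝 0) (𝓝 1) := by
        have : ContinuousAt (fun t : ℝ => (1 - (t : ℂ) * w)⁻¹) 0 := by
          refine ContinuousAt.inv₀ (by fun_prop) ?_
          simp
        simpa [ContinuousAt] using this
      have c2 : Tendsto (fun t : ℝ => t ^ 2) (𝓝 0) (𝓝 0) := by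
        have : ContinuousAt (fun t : ℝ => t ^ 2) 0 := by fun_prop
        simpa [ContinuousAt] using this
      rcases h with h | h
      · simp only [h]
        exact c1.mono_left nhdsWithin_le_nhds
      · simp only [h]
        exact (c1.comp c2).mono_left nhdsWithin_le_nhds
    · simp only [if_neg hg, den_ray_of_not_uses hg, ev_X]
      exact tendsto_const_nhds
  | algebraMap c =>
    simp only [AlgHom.commutes]
    exact tendsto_const_nhds
  | add f g _ _ h1 h2 =>
    simp only [map_add]
    exact h1.add h2
  | mul f g _ _ h1 h2 =>
    simp only [map_mul]
    exact h1.mul h2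

theorem tendsto_ev_ray_infty {z : ℂ} (hz : z.im ≠ 0) {v : ℕ → ℂ} (hv : OnRay z v) (i : ℕ)
    (G : CornerAlg) : Tendsto (fun t : ℝ => ev (Function.update v i (t * z)) G) atTop
      (𝓝 (ev v (atInfty i G))) := by
  have hG := algOn_univ G
  induction hG using Algebra.adjoin_induction with
  | mem f hf =>
    obtain ⟨g, -, rfl⟩ := hf
    simp only [ev_X, atInfty_X]
    by_cases hg : Uses g i
    · rw [if_pos hg, map_zero]
      obtain ⟨w, hw0, hw, h⟩ := den_ray hz hv i g hg
      have c1 : Tendsto (fun t : ℝ => (1 - (t : ℂ) * w)⁻¹) atTop (𝓝 0) := by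
        rw [tendsto_zero_iff_norm_tendsto_zero]
        simp only [norm_inv]
        refine tendsto_inv_atTop_zero.comp ?_
        have h1 : Tendsto (fun t : ℝ => t * ‖w‖ - 1) atTop atTop :=
          tendsto_atTop_add_const_right _ _ (tendsto_id.atTop_mul_const (norm_pos_iff.2 hw0))
        refine tendsto_atTop_mono' _ ?_ h1
        filter_upwards [eventually_ge_atTop 0] with t ht
        have := norm_sub_norm_le ((t : ℂ) * w) 1
        rw [norm_mul, Complex.norm_real, Real.norm_of_nonneg ht, norm_one, norm_sub_rev] at this
        exact this
      rcases h with h | h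
      · simp only [h]
        exact c1
      · simp only [h]
        exact c1.comp (tendsto_pow_atTop two_ne_zero)
    · simp only [if_neg hg, den_ray_of_not_uses hg, ev_X]
      exact tendsto_const_nhds
  | algebraMap c =>
    simp only [AlgHom.commutes]
    exact tendsto_const_nhds
  | add f g _ _ h1 h2 =>
    simp only [map_add]
    exact h1.add h2
  | mul f g _ _ h1 h2 =>
    simp only [map_mul]
    exact h1.mul h2

theorem hasDerivAt_ev_ray {z : ℂ} (hz : z.im ≠ 0) {v : ℕ → ℂ} (hv : OnRay z v) (i : ℕ)
    (G : CornerAlg) {t : ℝ} (ht : 0 < t) :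
    HasDerivAt (fun t : ℝ => ev (Function.update v i (t * z)) G)
      (ev (Function.update v i (t * z)) (euler i G) / t) t := by
  obtain ⟨c, h1, h2⟩ := hasDerivAt_ev (s := Set.univ)
    (fun g _ => (hv.update i ht).den_ne_zero hz g) i (algOn_univ G)
  rw [Function.update_self] at h1 h2
  simp only [Function.update_idem] at h1
  have h3 : HasDerivAt (fun t : ℝ => (t : ℂ) * z) z t := by
    simpa using (Complex.ofRealCLM.hasDerivAt (x := t)).mul_const z
  have h4 := h1.scomp t h3
  refine h4.congr_deriv ?_
  have : (t : ℂ) ≠ 0 := by exact_mod_cast ht.ne'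
  rw [h2, smul_eq_mul]
  field_simp

/-- The fundamental theorem of calculus along the two halves of a ray. -/
theorem ray_integrals {z : ℂ} (hz : z.im ≠ 0) {v : ℕ → ℂ} (hv : OnRay z v) (i : ℕ)
    (G : CornerAlg) {φ : ℝ → ℂ} {s : Set ℝ} (hs : s.Finite)
    (hφ : ∀ t : ℝ, 0 < t → t ∉ s → φ t = ev (Function.update v i (t * z)) (euler i G) / t) :
    (∫ t in (0 : ℝ)..1, φ t) = ev (Function.update v i z) G - ev v (atZero i G) ∧
      (∫ t in Set.Ioi (1 : ℝ), φ t) = ev v (atInfty i G) - ev (Function.update v i z) G := by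
  obtain ⟨C, hC, hb⟩ := exists_bound_ev hz hv i G
  set ψ : ℝ → ℂ := fun t => ev (Function.update v i (t * z)) (euler i G) / t with hψ
  have hae : ∀ᵐ t : ℝ, t ∉ s := hs.countable.ae_notMem volume
  have hcont : ContinuousOn ψ (Set.Ioi 0) := by
    intro t ht
    have ht : 0 < t := ht
    have h1 := (hasDerivAt_ev_ray hz hv i (euler i G) ht).continuousAt
    refine (h1.div Complex.continuous_ofReal.continuousAt ?_).continuousWithinAt
    exact_mod_cast ht.ne'
  have hone : Function.update v i (((1 : ℝ) : ℂ) * z) = Function.update v i z := by simp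
  have hnorm : ∀ t : ℝ, 0 < t → ‖ψ t‖ = ‖ev (Function.update v i (t * z)) (euler i G)‖ / t := by
    intro t ht
    rw [hψ]
    simp only [norm_div, Complex.norm_real, Real.norm_of_nonneg ht.le]
  have hlim : ContinuousAt (fun t : ℝ => ev (Function.update v i (t * z)) G) 1 :=
    (hasDerivAt_ev_ray hz hv i G one_pos).continuousAt
  constructor
  · have h1 : (∫ t in (0 : ℝ)..1, φ t) = ∫ t in (0 : ℝ)..1, ψ t := by
      refine intervalIntegral.integral_congr_ae ?_
      filter_upwards [hae] with t ht ht'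
      rw [Set.uIoc_of_le zero_le_one] at ht'
      exact hφ t ht'.1 ht
    rw [h1]
    refine intervalIntegral.integral_eq_sub_of_hasDerivAt_of_tendsto zero_lt_one
      (fun t ht => hasDerivAt_ev_ray hz hv i G ht.1) ?_ (tendsto_ev_ray_zero hz hv i G) ?_
    · rw [intervalIntegrable_iff_integrableOn_Ioc_of_le zero_le_one]
      refine Integrable.mono' (integrableOn_const (C := C) (by simp)) ?_ ?_
      · exact (hcont.mono Set.Ioc_subset_Ioi_self).aestronglyMeasurable measurableSet_Ioc
      · refine (ae_restrict_iff' measurableSet_Ioc).2 (Eventually.of_forall fun t ht => ?_)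
        rw [hnorm t ht.1, div_le_iff₀ ht.1]
        exact (hb t ht.1).2.1
    · rw [← hone]
      exact hlim.tendsto.mono_left nhdsWithin_le_nhds
  · have h1 : (∫ t in Set.Ioi (1 : ℝ), φ t) = ∫ t in Set.Ioi (1 : ℝ), ψ t := by
      refine setIntegral_congr_ae measurableSet_Ioi ?_
      filter_upwards [hae] with t ht ht'
      exact hφ t (one_pos.trans ht') ht
    rw [h1]
    have hint : IntegrableOn ψ (Set.Ioi 1) := by
      have h2 : IntegrableOn (fun t : ℝ => C * t ^ (-2 : ℝ)) (Set.Ioi 1) :=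
        (integrableOn_Ioi_rpow_of_lt (by norm_num) one_pos).const_mul C
      refine Integrable.mono' h2 ?_ ?_
      · exact (hcont.mono (Set.Ioi_subset_Ioi zero_le_one)).aestronglyMeasurable measurableSet_Ioi
      · refine (ae_restrict_iff' measurableSet_Ioi).2 (Eventually.of_forall fun t ht => ?_)
        have ht0 : 0 < t := one_pos.trans ht
        rw [hnorm t ht0, Real.rpow_neg ht0.le, Real.rpow_two, div_le_iff₀ ht0]
        have := (hb t ht0).2.2
        have e : C * (t ^ 2)⁻¹ * t = C / t := by field_simp
        rwa [e, le_div_iff₀ ht0]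
    have := integral_Ioi_of_hasDerivAt_of_tendsto' (a := (1 : ℝ))
      (fun t ht => hasDerivAt_ev_ray hz hv i G (one_pos.trans_le ht)) hint
      (tendsto_ev_ray_infty hz hv i G)
    rwa [hone] at this

/-- Evaluation of the variable `i` at the divisor `[v a] - ν₊ [∞] - ν₋ [0]`. -/
def divisorEval (νp νm : ℂ) (a i : ℕ) (f : CornerAlg) : CornerAlg :=
  subst i a f - algebraMap ℂ _ νp * atInfty i f - algebraMap ℂ _ νm * atZero i f

/-- Evaluation of the variables from a list at that divisor, the last variable first. -/
def divisorEvals (νp νm : ℂ) (a : ℕ) (l : List ℕ) (f : CornerAlg) : CornerAlg :=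
  l.foldr (divisorEval νp νm a) f

theorem euler_divisorEvals {νp νm : ℂ} {a j : ℕ} (hja : j ≠ a) {l : List ℕ} (hjl : j ∉ l)
    (f : CornerAlg) :
    euler j (divisorEvals νp νm a l f) = divisorEvals νp νm a l (euler j f) := by
  induction l with
  | nil => rfl
  | cons i l ih =>
    rw [List.mem_cons, not_or] at hjl
    change euler j (divisorEval νp νm a i (divisorEvals νp νm a l f)) =
      divisorEval νp νm a i (divisorEvals νp νm a l (euler j f))
    rw [← ih hjl.2, divisorEval, divisorEval, map_sub, map_sub, Derivation.leibniz,
      Derivation.leibniz, Derivation.map_algebraMap, Derivation.map_algebraMap, smul_zero,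
      smul_zero, add_zero, add_zero, smul_eq_mul, smul_eq_mul, euler_subst hjl.1 hja,
      euler_atInfty, euler_atZero]

theorem divisorEvals_mem_cornerIdeal {νp νm : ℂ} {a : ℕ} (l : List ℕ) {f : CornerAlg}
    (hf : f ∈ cornerIdeal) : divisorEvals νp νm a l f ∈ cornerIdeal := by
  induction l with
  | nil => exact hf
  | cons i l ih =>
    exact sub_mem (sub_mem (subst_mem_cornerIdeal i a ih)
      (Ideal.mul_mem_left _ _ (atInfty_mem_cornerIdeal i ih)))
      (Ideal.mul_mem_left _ _ (atZero_mem_cornerIdeal i ih))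

/-- Iterated integrals along `D(z)` of the derivative of `P` are evaluations of `P`. The function
`f` has to be known only for distinct values of the variables that avoid a finite set `B`. -/
theorem multiInt_eq_ev {νp νm : ℂ} (hν : νp + νm = 1) {z : ℂ} (hz : z.im ≠ 0) {a : ℕ}
    (l : List ℕ) (hl : (a :: l).Nodup) (P : CornerAlg) {v : ℕ → ℂ} (hv : OnRay z v)
    (hva : v a = z) {B : Set ℂ} (hB : B.Finite) {κ : ℂ} (f : Multiset ℂ → ℂ)
    (hf : ∀ u, OnRay z u → (∀ j ∉ l, u j = v j) → (l.map u).Nodup → (∀ j ∈ l, u j ∉ B) →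
      f (l.map u) * (κ * (l.map u).prod) = ev u (eulers l P)) :
    multiInt νp νm l.length f z * κ = ev v (divisorEvals νp νm a l P) := by
  have hz0 : z ≠ 0 := by
    rintro rfl
    simp at hz
  induction l generalizing P v B κ f with
  | nil => simpa [divisorEvals, multiInt] using hf v hv (fun _ _ => rfl) (by simp) (by simp)
  | cons i l ih =>
    have hai : a ≠ i := fun h => by simp [h] at hl
    have hal : a ∉ l := fun h => by simp [h] at hl
    have hil : i ∉ l := fun h => by simp [h] at hl
    have hl' : l.Nodup := by
      simp only [List.nodup_cons] at hl
      exact hl.2.2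
    set G := divisorEvals νp νm a l P with hG
    set F : ℂ → ℂ := fun ζ => multiInt νp νm l.length (fun J => f (ζ ::ₘ J)) z with hF
    have key : ∀ t : ℝ, 0 < t → (t : ℂ) * z ∉ B → F (t * z) * (κ * (t * z)) =
        ev (Function.update v i (t * z)) (euler i G) := by
      intro t ht htB
      rw [hG, euler_divisorEvals hai.symm hil]
      refine ih (List.nodup_cons.2 ⟨hal, hl'⟩) (euler i P) (hv.update i ht)
        (by rw [Function.update_of_ne hai, hva]) (hB.insert ((t : ℂ) * z)) _
        fun u hu huv hinj huB => ?_
      have hui : u i = t * z := by rw [huv i hil, Function.update_self]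
      have := hf u hu (fun j hj => by
        rw [List.mem_cons, not_or] at hj
        rw [huv j hj.2, Function.update_of_ne hj.1]) (by
        rw [List.map_cons, List.nodup_cons]
        refine ⟨fun h => ?_, hinj⟩
        obtain ⟨j, hj, e⟩ := List.mem_map.1 h
        exact huB j hj (Or.inl (e.trans hui))) (fun j hj => by
        rcases List.mem_cons.1 hj with rfl | hj
        · rwa [hui]
        · exact fun h => huB j hj (Or.inr h))
      have e : eulers (↑(i :: l)) P = eulers (↑l) (euler i P) := by
        rw [← Multiset.cons_coe, eulers_cons, euler_eulers]
      rw [e, List.map_cons, hui, List.prod_cons, ← Multiset.cons_coe] at this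
      rw [← this]
      ring
    have hfin : {t : ℝ | (t : ℂ) * z ∈ B}.Finite := by
      refine Set.Finite.preimage (f := fun t : ℝ => (t : ℂ) * z) (fun s _ t _ h => ?_) hB
      exact_mod_cast mul_right_cancel₀ hz0 h
    obtain ⟨h1, h2⟩ := ray_integrals hz hv i G (φ := fun t => κ * (F (t * z) * z)) hfin
      fun t ht htB => by
        have h0 : (t : ℂ) ≠ 0 := by exact_mod_cast ht.ne'
        rw [← key t ht htB]
        field_simp
    rw [intervalIntegral.integral_const_mul] at h1
    rw [integral_const_mul] at h2
    change divisorInt νp νm F z * κ = ev v (divisorEval νp νm a i G)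
    rw [divisorInt, intFromInfty, intFromZero, divisorEval, map_sub, map_sub, map_mul, map_mul,
      AlgHom.commutes, AlgHom.commutes, ev_subst, hva, Algebra.algebraMap_self, RingHom.id_apply,
      RingHom.id_apply]
    linear_combination νm * h1 - νp * h2 + ev (Function.update v i z) G * hν

/-! ### The coefficients of the logarithmic derivative -/

/-- Integrated along `D(z)`, a recursion differential is the evaluation of its symbol. -/
theorem Represents.multiInt_mul {S : SpectralCurve} {Q μ : ℂ} {h a : ℕ} {l : List ℕ}
    {P : CornerAlg} (hP : Represents S Q μ h a l.toFinset P) (hl : (a :: l).Nodup)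
    {νp νm : ℂ} (hν : νp + νm = 1) {z : ℂ} (hz : z.im ≠ 0) :
    multiInt νp νm l.length (fun J => omega S Q μ h z J) z * z =
      ev (fun _ => z) (divisorEvals νp νm a l P) := by
  have hz0 : z ≠ 0 := by
    rintro rfl
    simp at hz
  have hal : a ∉ l := (List.nodup_cons.1 hl).1
  have hln : l.Nodup := (List.nodup_cons.1 hl).2
  refine multiInt_eq_ev hν hz l hl P (v := fun _ => z) (fun _ => ⟨1, one_pos, by simp⟩) rfl
    Set.finite_empty _ fun u hu hua hinj _ => ?_
  have hval : l.toFinset.val = (l : Multiset ℕ) := by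
    rw [List.toFinset_val, hln.dedup]
  have key := hP.2 u (fun i _ j _ => ?_) (fun k _ => ?_) ?_
  · rw [hua a hal, hval, Finset.prod_eq_multiset_prod, hval, Multiset.map_coe,
      Multiset.prod_coe] at key
    rw [← key]
    ring
  · have := hu.den_ne_zero hz (i, Sum.inr j)
    rw [den_pair] at this
    exact fun e => this (by rw [e, sub_self])
  · obtain ⟨t, ht, e⟩ := hu k
    rw [e]
    exact mul_ne_zero (by exact_mod_cast ht.ne') hz0
  · intro i hi j hj e
    exact List.inj_on_of_nodup_map hinj (by simpa using hi) (by simpa using hj) e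

/-- The symbol of the coefficient of `ħ ^ (j - 1)`, `j ≥ 2`, vanishes at all corners. -/
theorem exists_symbol_T {S : SpectralCurve} {b μ : ℂ} (C : SymbolicCurve S (b - b⁻¹) μ)
    {νp νm : ℂ} (hν : νp + νm = 1) {j : ℕ} (hj : 2 ≤ j) :
    ∃ F ∈ cornerIdeal, ∀ z : ℂ, z.im ≠ 0 → T S b μ νp νm j z * z = ev (fun _ => z) F := by
  have H : ∀ n : ℕ, ∃ P ∈ cornerIdeal, n ≤ j →
      Represents S (b - b⁻¹) μ (j - n) 0 (List.range' 1 n).toFinset P := by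
    intro n
    by_cases hn : n ≤ j
    · have hc : (List.range' 1 n).toFinset.card = n := by
        rw [List.toFinset_card_of_nodup List.nodup_range', List.length_range']
      obtain ⟨P, h1, h2⟩ := exists_represents C (j - n) 0 (List.range' 1 n).toFinset (by
        rcases Nat.eq_zero_or_pos n with rfl | h0
        · left
          omega
        · right
          rintro h
          rw [h, Finset.card_empty] at hc
          omega) (by simp)
      exact ⟨P, h2 (by omega), fun _ => h1⟩
    · exact ⟨0, zero_mem _, fun h => absurd h hn⟩
  choose P hP1 hP2 using H
  refine ⟨∑ n ∈ Finset.range (j + 1), algebraMap ℂ CornerAlg (1 / ((n.factorial : ℂ) * b ^ (n + 1)))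
    * divisorEvals νp νm 0 (List.range' 1 n) (P n), sum_mem fun n _ =>
      Ideal.mul_mem_left _ _ (divisorEvals_mem_cornerIdeal _ (hP1 n)), fun z hz => ?_⟩
  rw [T, Finset.sum_mul, map_sum]
  refine Finset.sum_congr rfl fun n hn => ?_
  have := (hP2 n (Nat.lt_succ_iff.1 (Finset.mem_range.1 hn))).multiInt_mul
    (List.nodup_cons.2 ⟨by simp, List.nodup_range'⟩) hν hz
  rw [List.length_range'] at this
  rw [map_mul, AlgHom.commutes, ← this]
  simp only [Algebra.algebraMap_self, RingHom.id_apply]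
  ring

/-- The symbol of the constant coefficient, made up of `ω_{1/2,1}` and `ω_{0,2}`. -/
theorem exists_symbol_T_one {S : SpectralCurve} {b μ : ℂ} (C : SymbolicCurve S (b - b⁻¹) μ)
    {νp νm : ℂ} (hν : νp + νm = 1) :
    ∃ F, corner (fun _ => -1) F + corner (fun _ => 1) F =
        -((b - b⁻¹) * μ) / b + (νp - νm) / b ^ 2 ∧
      ∀ z : ℂ, z.im ≠ 0 → T S b μ νp νm 1 z * z = ev (fun _ => z) F := by
  refine ⟨algebraMap ℂ CornerAlg (1 / b) * C.half 0 + algebraMap ℂ CornerAlg (1 / b ^ 2) *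
    divisorEval νp νm 0 1 (X (0, Sum.inr 1)), ?_, fun z hz => ?_⟩
  · have h1 := C.corner_half (fun _ => -1) (fun _ => 1) 0 (by norm_num) (by norm_num)
    have h2 : ∀ r : ℕ → ℤ, corner r (divisorEval νp νm 0 1 (X (0, Sum.inr 1))) =
        (if r 0 + r 0 < 0 then 1 else 0) - νm := by
      intro r
      have u : Uses ((0, Sum.inr 1) : Gen) 1 := Or.inr rfl
      rw [divisorEval, atZero_X, atInfty_X, subst_X, if_pos u, if_pos u, mul_zero, mul_one,
        sub_zero, map_sub, AlgHom.commutes]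
      exact congrArg (· - νm) (corner_pair r 0 0)
    rw [map_add, map_add, map_mul, map_mul, map_mul, map_mul, h2, h2, AlgHom.commutes,
      AlgHom.commutes, AlgHom.commutes, AlgHom.commutes, if_pos (by norm_num),
      if_neg (by norm_num)]
    simp only [Algebra.algebraMap_self, RingHom.id_apply]
    linear_combination (1 / b) * h1 - (1 / b ^ 2) * hν
  · have h1 := Represents.multiInt_mul (l := []) (by simpa using C.represents_half 0)
      (by simp) hν hz
    have h2 := Represents.multiInt_mul (l := [1])
      (by simpa using represents_zero_singleton (S := S) (Q := b - b⁻¹) (μ := μ) zero_ne_one)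
      (by simp) hν hz
    simp only [List.length_nil, List.length_singleton] at h1 h2
    change _ = ev _ (C.half 0) at h1
    change _ = ev _ (divisorEval νp νm 0 1 (X (0, Sum.inr 1))) at h2
    rw [map_add, map_mul, map_mul, ← h1, ← h2, T, Finset.sum_range_succ, Finset.sum_range_one,
      AlgHom.commutes, AlgHom.commutes]
    simp only [Algebra.algebraMap_self, RingHom.id_apply, Nat.factorial_zero, Nat.factorial_one,
      Nat.cast_one, one_mul, zero_add, pow_one, Nat.sub_zero, Nat.sub_self, one_add_one_eq_two]
    ring

/-! ### Integrals over the cycle -/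

/-- On the diagonal, the value at `z = 0` is the value at a corner. -/
theorem ev_const_zero (f : CornerAlg) : ev (fun _ => 0) f = corner (fun _ => -1) f := by
  have : ev (fun _ => 0) = corner (fun _ => -1) := by
    refine MvPolynomial.algHom_ext fun g => ?_
    obtain ⟨u, s | k⟩ := g
    · rw [ev_X, corner_sign, den_sign]
      simp
    · rw [ev_X, corner_pair, den_pair]
      simp
  rw [this]

theorem differentiableAt_ev_const {z : ℂ} (hz : z ^ 2 ≠ 1) (f : CornerAlg) :
    DifferentiableAt ℂ (fun z => ev (fun _ => z) f) z := by
  have hf := algOn_univ f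
  induction hf using Algebra.adjoin_induction with
  | mem f hf =>
    obtain ⟨g, -, rfl⟩ := hf
    simp only [ev_X]
    obtain ⟨u, s | k⟩ := g
    · simp only [den_sign]
      refine DifferentiableAt.inv (by fun_prop) fun h => hz ?_
      cases s
      · have h : 1 - z * -1 = 0 := h
        linear_combination (z - 1) * h
      · have h : 1 - z * 1 = 0 := h
        linear_combination -(z + 1) * h
    · simp only [den_pair]
      refine DifferentiableAt.inv (by fun_prop) fun h => hz ?_
      linear_combination -h
  | algebraMap c =>
    simp only [AlgHom.commutes]
    exact differentiableAt_const _
  | add f g _ _ h1 h2 =>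
    simp only [map_add]
    exact h1.add h2
  | mul f g _ _ h1 h2 =>
    simp only [map_mul]
    exact h1.mul h2

theorem tendsto_ev_const_cocompact (f : CornerAlg) :
    Tendsto (fun z => ev (fun _ => z) f) (cocompact ℂ) (𝓝 (corner (fun _ => 1) f)) := by
  have hf := algOn_univ f
  have key : ∀ w : ℂ → ℂ, Tendsto (fun z => ‖w z‖) (cocompact ℂ) atTop →
      Tendsto (fun z => (1 - w z)⁻¹) (cocompact ℂ) (𝓝 0) := by
    intro w hw
    refine tendsto_inv₀_cobounded.comp ?_
    rw [tendsto_norm_atTop_iff_cobounded.symm]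
    refine tendsto_atTop_mono (fun z => ?_) (tendsto_atTop_add_const_right _ (-1) hw)
    have := norm_sub_norm_le (w z) 1
    rw [norm_one, norm_sub_rev] at this
    linarith
  have hn : Tendsto (fun z : ℂ => ‖z‖) (cocompact ℂ) atTop := tendsto_norm_cocompact_atTop
  induction hf using Algebra.adjoin_induction with
  | mem f hf =>
    obtain ⟨g, -, rfl⟩ := hf
    simp only [ev_X]
    obtain ⟨u, s | k⟩ := g
    · simp only [den_sign, corner_sign]
      rw [if_neg (show ¬(1 : ℤ) < 0 by decide)]
      refine key _ ?_
      cases s <;> simpa using hn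
    · simp only [den_pair, corner_pair]
      rw [if_neg (by norm_num)]
      refine key _ ?_
      simp only [norm_mul]
      exact hn.atTop_mul_atTop₀ hn
  | algebraMap c =>
    simp only [AlgHom.commutes]
    exact tendsto_const_nhds
  | add f g _ _ h1 h2 =>
    simp only [map_add]
    exact h1.add h2
  | mul f g _ _ h1 h2 =>
    simp only [map_mul]
    exact h1.mul h2

/-- The integral over a circle outside of which `φ` is holomorphic is given by the limit of `φ`
at infinity. -/
theorem circleIntegral_inv_mul_of_tendsto_cocompact {φ : ℂ → ℂ} {B : ℂ} {R : ℝ} (hR : 0 < R)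
    (hd : ∀ z : ℂ, R ≤ ‖z‖ → DifferentiableAt ℂ φ z) (h : Tendsto φ (cocompact ℂ) (𝓝 B)) :
    (∮ z in C(0, R), z⁻¹ * φ z) = 2 * Real.pi * I * B := by
  have hc : ∀ r, R ≤ r → ContinuousOn (fun z => z⁻¹ * φ z) (Metric.sphere 0 r) := by
    intro r hr z hz
    have hz' : ‖z‖ = r := by simpa using hz
    refine ((continuousAt_inv₀ ?_).mul (hd z (hz' ▸ hr)).continuousAt).continuousWithinAt
    rw [← norm_pos_iff, hz']
    linarith
  have hconst : ∀ r, R ≤ r → (∮ z in C(0, R), z⁻¹ * φ z) = ∮ z in C(0, r), z⁻¹ * φ z := by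
    intro r hr
    have := circleIntegral_sub_center_inv_smul_eq_of_differentiable_on_annulus_off_countable
      (c := 0) (f := φ) hR hr Set.countable_empty (fun z hz => ?_) fun z hz => ?_
    · simpa using this.symm
    · refine (hd z ?_).continuousAt.continuousWithinAt
      simpa using hz.2
    · refine hd z ?_
      have := hz.1.2
      simp only [Metric.mem_closedBall, dist_zero_right, not_le] at this
      exact this.le
  have hB : ∀ r, R ≤ r → (∮ z in C(0, r), z⁻¹ * φ z) - 2 * Real.pi * I * B =
      ∮ z in C(0, r), z⁻¹ * (φ z - B) := by
    intro r hr
    have hr0 : 0 < r := hR.trans_le hr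
    have h1 := circleIntegral.integral_sub_center_inv (0 : ℂ) hr0.ne'
    simp only [sub_zero] at h1
    have h2 : ContinuousOn (fun z : ℂ => z⁻¹ * B) (Metric.sphere 0 r) := by
      intro z hz
      have hz' : ‖z‖ = r := by simpa using hz
      refine ((continuousAt_inv₀ ?_).mul continuousAt_const).continuousWithinAt
      rw [← norm_pos_iff, hz']
      exact hr0
    have h3 := circleIntegral.integral_const_mul B (fun z : ℂ => z⁻¹) 0 r
    simp only [mul_comm B] at h3
    simp only [mul_sub]
    rw [circleIntegral.integral_sub ((hc r hr).circleIntegrable hr0.le)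
      (h2.circleIntegrable hr0.le), h3, h1]
  refine sub_eq_zero.1 (norm_le_zero_iff.1 (le_of_forall_pos_le_add fun ε hε => ?_))
  have hε' : 0 < ε / (2 * Real.pi) := by positivity
  have h1 := (Metric.tendsto_nhds.1 h _ hε')
  rw [← Metric.cobounded_eq_cocompact, ← comap_norm_atTop, eventually_comap] at h1
  obtain ⟨r, hr, hrR⟩ := (h1.and (eventually_ge_atTop R)).exists
  have hr0 : 0 < r := hR.trans_le hrR
  rw [hconst r hrR, hB r hrR, zero_add]
  refine (circleIntegral.norm_integral_le_of_norm_le_const hr0.le (C := r⁻¹ * (ε / (2 * Real.pi)))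
    fun z hz => ?_).trans_eq (by field_simp)
  have hz' : ‖z‖ = r := by simpa using hz
  rw [norm_mul, norm_inv, hz', ← dist_eq_norm]
  exact mul_le_mul_of_nonneg_left (hr z hz').le (by positivity)

/-- The integral of `φ dz / z` over a circle, where `φ` is holomorphic on the punctured plane off the
unit circle: the limit of `φ` at the puncture on the same side contributes. -/
theorem circleIntegral_inv_mul {φ : ℂ → ℂ} {A B : ℂ} {R : ℝ} (hR : 0 < R) (hR1 : R ≠ 1)
    (hd : ∀ z : ℂ, z ≠ 0 → ‖z‖ ≠ 1 → DifferentiableAt ℂ φ z) (h0 : Tendsto φ (𝓝[≠] 0) (𝓝 A))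
    (h : Tendsto φ (cocompact ℂ) (𝓝 B)) :
    (∮ z in C(0, R), z⁻¹ * φ z) = 2 * Real.pi * I * if R < 1 then A else B := by
  split_ifs with hlt
  · have := circleIntegral_sub_center_inv_smul_of_differentiable_on_off_countable_of_tendsto
      (c := 0) (f := φ) hR Set.countable_empty (fun z hz => ?_) (fun z hz => ?_) h0
    · simpa using this
    · have h1 : ‖z‖ ≤ R := by simpa using hz.1
      exact (hd z (by simpa using hz.2) (h1.trans_lt hlt).ne).continuousAt.continuousWithinAt
    · have h1 : ‖z‖ < R := by simpa using hz.1.1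
      exact hd z (by simpa using hz.1.2) (h1.trans hlt).ne
  · have h1 : 1 < R := lt_of_le_of_ne (not_lt.1 hlt) hR1.symm
    refine circleIntegral_inv_mul_of_tendsto_cocompact hR (fun z hz => hd z ?_ ?_) h
    · rw [← norm_pos_iff]
      linarith
    · linarith

/-- The cycle integral of the odd part of a one-form with a symbol sees the symbol only at the
two corners `z = 0` and `z = ∞`. -/
theorem gammaInt_odd {f : ℂ → ℂ} {F : CornerAlg} {R : ℝ} (hR : 0 < R) (hR1 : R ≠ 1)
    (hf : ∀ z : ℂ, z.im ≠ 0 → f z * z = ev (fun _ => z) F) :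
    gammaInt R (fun z => (f z - f (σ z) * deriv σ z) / 2) =
      -(Real.pi * I * (corner (fun _ => -1) F + corner (fun _ => 1) F)) := by
  set τ : ℂ → ℂ := fun z => ev (fun _ => z) F with hτ
  have hsq : ∀ z : ℂ, ‖z‖ ≠ 1 → z ^ 2 ≠ 1 := fun z hz h => by
    have := congrArg norm h
    rw [norm_pow, norm_one] at this
    exact hz ((pow_eq_one_iff_of_nonneg (norm_nonneg z) two_ne_zero).1 this)
  have hd : ∀ z : ℂ, ‖z‖ ≠ 1 → DifferentiableAt ℂ τ z := fun z hz =>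
    differentiableAt_ev_const (hsq z hz) F
  have h0 : Tendsto τ (𝓝 0) (𝓝 (corner (fun _ => -1) F)) := by
    rw [← ev_const_zero]
    exact (hd 0 (by simp)).continuousAt
  have hinf : Tendsto τ (cocompact ℂ) (𝓝 (corner (fun _ => 1) F)) := tendsto_ev_const_cocompact F
  have hd' : ∀ z : ℂ, z ≠ 0 → ‖z‖ ≠ 1 → DifferentiableAt ℂ (fun z => τ z⁻¹) z :=
    fun z h hz => (hd z⁻¹ (by simpa using hz)).comp z (differentiableAt_inv h)
  have i1 := circleIntegral_inv_mul hR hR1 (fun z _ hz => hd z hz)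
    (h0.mono_left nhdsWithin_le_nhds) hinf
  have i2 := circleIntegral_inv_mul hR hR1 hd' (hinf.comp (by
    rw [← Metric.cobounded_eq_cocompact]
    exact tendsto_inv₀_nhdsNE_zero)) (h0.comp (by
    rw [← Metric.cobounded_eq_cocompact]
    exact tendsto_inv₀_cobounded))
  have hcirc : ∀ φ : ℂ → ℂ, (∀ z : ℂ, z ≠ 0 → ‖z‖ ≠ 1 → DifferentiableAt ℂ φ z) →
      CircleIntegrable (fun z => z⁻¹ * φ z) 0 R := by
    intro φ hφ
    refine ContinuousOn.circleIntegrable hR.le fun z hz => ?_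
    have hz' : ‖z‖ = R := by simpa using hz
    have hz0 : z ≠ 0 := by
      rw [← norm_pos_iff, hz']
      exact hR
    exact ((continuousAt_inv₀ hz0).mul (hφ z hz0 (hz' ▸ hR1)).continuousAt).continuousWithinAt
  have hcongr : (∮ z in C(0, R), (f z - f (σ z) * deriv σ z) / 2) =
      ∮ z in C(0, R), (1 / 2 : ℂ) * (z⁻¹ * τ z + z⁻¹ * τ z⁻¹) := by
    refine circleIntegral.circleIntegral_congr_codiscreteWithin ?_ hR.ne'
    -- The symbol computes `f` off the two real points of the circle.
    have hfin : ({(R : ℂ), -(R : ℂ)} : Set ℂ).Finite := Set.toFinite _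
    filter_upwards [compl_finite_mem_codiscreteWithin (s := Metric.sphere (0 : ℂ) |R|) hfin,
      self_mem_codiscreteWithin (Metric.sphere (0 : ℂ) |R|)] with z hz hzR
    have hzR' : ‖z‖ = R := by simpa [abs_of_pos hR] using hzR
    have him : z.im ≠ 0 := by
      intro h
      refine hz ?_
      have e : ((z.re : ℝ) : ℂ) = z := Complex.ext (by simp) (by simp [h])
      rw [← e, Complex.norm_real, Real.norm_eq_abs] at hzR'
      rw [← e]
      rcases abs_eq hR.le |>.1 hzR' with h1 | h1 <;> simp [h1]
    have hz0 : z ≠ 0 := by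
      rintro rfl
      simp at him
    have him' : (σ z).im ≠ 0 := by
      rw [σ, Complex.inv_im]
      exact div_ne_zero (neg_ne_zero.2 him) (by simpa using hz0)
    have e1 := hf z him
    have e2 := hf (σ z) him'
    change f z * z = τ z at e1
    change f (σ z) * σ z = τ z⁻¹ at e2
    rw [← e1, ← e2, deriv_σ, σ]
    field_simp
    ring
  rw [gammaInt, hcongr, circleIntegral.integral_const_mul,
    circleIntegral.integral_add (hcirc _ fun z _ hz => hd z hz) (hcirc _ hd'), i1, i2]
  split_ifs <;> ring


/-- The leading coefficient of `T_odd dz` is `ω_{0,1} / β ^ (1/2)`, as `ω_{0,1}` is odd. -/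
theorem gammaInt_Todd_zero {S : SpectralCurve} {b μ νp νm : ℂ}
    (C : SymbolicCurve S (b - b⁻¹) μ) {R : ℝ} (hR : 0 < R) (hR1 : R ≠ 1) :
    gammaInt R (Todd S b μ νp νm 0) = b⁻¹ * centralCharge S R := by
  have hT : ∀ z, T S b μ νp νm 0 z = b⁻¹ * omega01 S z := by
    intro z
    simp [T, multiInt, omega, omegaAux]
  rw [centralCharge, gammaInt, gammaInt, mul_neg, ← circleIntegral.integral_const_mul]
  congr 1
  refine circleIntegral.integral_congr hR.le fun z hz => ?_
  have hz' : ‖z‖ = R := by simpa using hz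
  have hz0 : z ≠ 0 := by
    rw [← norm_pos_iff, hz']
    exact hR
  have hz1 : z ^ 2 ≠ 1 := fun h => by
    have := congrArg norm h
    rw [norm_pow, norm_one, hz'] at this
    exact hR1 ((pow_eq_one_iff_of_nonneg hR.le two_ne_zero).1 this)
  have := C.omega01_odd z hz0 hz1
  simp only [Todd, hT]
  linear_combination -b⁻¹ / 2 * this

theorem quantumCorrection_eq (Q μ : ℂ) {R : ℝ} (hR : 0 < R) :
    quantumCorrection Q μ R = Real.pi * I * (Q * μ) := by
  have h := circleIntegral.integral_sub_center_inv (0 : ℂ) hR.ne'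
  simp only [sub_zero] at h
  have e : omegaHalfOdd Q μ = fun z => -(Q / 2 * μ) * z⁻¹ := by
    funext z
    simp only [omegaHalfOdd, etaInfty, bergmanPrimitive, sub_zero]
    ring
  rw [quantumCorrection, gammaInt, e, circleIntegral.integral_const_mul, h]
  ring

theorem vorosGamma_eq {S : SpectralCurve} {b μ νp νm : ℂ} (C : SymbolicCurve S (b - b⁻¹) μ)
    (hν : νp + νm = 1) {R : ℝ} (hR : 0 < R) (hR1 : R ≠ 1) :
    vorosGamma S b μ νp νm R =
      HahnSeries.single (-1) b⁻¹ *
          HahnSeries.ofPowerSeries ℤ ℂ (quantumCentralCharge S (b - b⁻¹) μ R)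
        - HahnSeries.C (Real.pi * I * (νp - νm) / b ^ 2) := by
  have h1 : gammaInt R (Todd S b μ νp νm 1) =
      b⁻¹ * quantumCorrection (b - b⁻¹) μ R - Real.pi * I * (νp - νm) / b ^ 2 := by
    obtain ⟨F, hF1, hF2⟩ := exists_symbol_T_one C hν
    have := gammaInt_odd hR hR1 hF2
    rw [hF1] at this
    refine this.trans ?_
    rw [quantumCorrection_eq _ _ hR]
    ring
  have h2 : ∀ j, 2 ≤ j → gammaInt R (Todd S b μ νp νm j) = 0 := by
    intro j hj
    obtain ⟨F, hF1, hF2⟩ := exists_symbol_T C hν hj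
    refine (gammaInt_odd hR hR1 hF2).trans ?_
    rw [mem_cornerIdeal] at hF1
    rw [hF1 _ ⟨2, by norm_num⟩, hF1 _ ⟨2, by norm_num⟩, add_zero, mul_zero, neg_zero]
  have hps : (PowerSeries.mk fun j => gammaInt R (Todd S b μ νp νm j)) =
      PowerSeries.C b⁻¹ * quantumCentralCharge S (b - b⁻¹) μ R -
        PowerSeries.X * PowerSeries.C (Real.pi * I * (νp - νm) / b ^ 2) := by
    ext j
    rw [PowerSeries.coeff_mk, map_sub, PowerSeries.coeff_C_mul, quantumCentralCharge, map_add]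
    match j with
    | 0 => simp [gammaInt_Todd_zero C hR hR1]
    | 1 => simp [h1]
    | j + 2 =>
      rw [h2 _ (by omega)]
      simp [PowerSeries.coeff_X]
  have hu : (HahnSeries.single (-1 : ℤ) (1 : ℂ)) * HahnSeries.single 1 1 = 1 := by
    rw [HahnSeries.single_mul_single, mul_one, neg_add_cancel]
    rfl
  have hb : HahnSeries.single (-1 : ℤ) b⁻¹ = HahnSeries.single (-1) 1 * HahnSeries.C b⁻¹ := by
    rw [HahnSeries.C_apply, HahnSeries.single_mul_single, one_mul, add_zero]
  rw [vorosGamma, hps, hb, map_sub, map_mul, map_mul, HahnSeries.ofPowerSeries_C,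
    HahnSeries.ofPowerSeries_C, HahnSeries.ofPowerSeries_X]
  linear_combination -HahnSeries.C (Real.pi * I * (νp - νm) / b ^ 2) * hu

end RefinedTR

end

theorem mainTheorem6 (m : ℂ) (hm : m ≠ 0) (S : RefinedTR.SpectralCurve)
    (hS : (∃ s : ℂ, s ^ 2 = m ∧ S = RefinedTR.weber s) ∨ S = RefinedTR.whittaker m)
    (β b : ℂ) (hβ : β ≠ 0) (hb : b ^ 2 = β) (μ νp νm : ℂ) (hν : νp + νm = 1)
    (R : ℝ) (hR : 0 < R) (hR1 : R ≠ 1) :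
    RefinedTR.vorosGamma S b μ νp νm R =
      HahnSeries.single (-1) b⁻¹ *
          HahnSeries.ofPowerSeries ℤ ℂ (RefinedTR.quantumCentralCharge S (b - b⁻¹) μ R)
        - HahnSeries.C (Real.pi * Complex.I * (νp - νm) / β) := by
  subst hb
  rcases hS with ⟨s, rfl, rfl⟩ | rfl
  · have hs : s ≠ 0 := fun h => hm (by rw [h, sq, zero_mul])
    exact RefinedTR.vorosGamma_eq (RefinedTR.symbolicWeber hs _ _) hν hR hR1
  · exact RefinedTR.vorosGamma_eq (RefinedTR.symbolicWhittaker hm _ _) hν hR hR1
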